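/- **Setting.** Let $A\le\tilde A$ be abelian groups, let $V$ be a strongly $A$-graded Möbius or conformal vertex algebra, let $W_1,W_2$ be strongly $\tilde A$-graded generalized $V$-modules, and let $z\in\mathbb C^\times$. (Thus $V=\coprod_{n\in\mathbb Z}V_{(n)}=\coprod_{\alpha\in A}V^{(\alpha)}$ and $W_i=\coprod_{n\in\mathbb C}(W_i)_{[n]}=\coprod_{\beta\in\tilde A}W_i^{(\beta)}$ with compatible gradings, where $V_{(n)}$, resp. $(W_i)_{[n]}$, consists of eigenvectors, resp. generalized eigenvectors, of $L(0)$ for $n$; the doubly homogeneous subspaces $V^{(\alpha)}_{(n)}$, $(W_i)^{(\beta)}_{[n]}$ are finite dimensional, and $V^{(\alpha)}_{(n+k)}=0$, $(W_i)^{(\beta)}_{[n+k]}=0$ for $k\in\mathbb Z$ sufficiently negative; the vertex operators are additive for the $A$- and $\tilde A$-gradings; and the vacuum, creation, $L(-1)$-derivative and Jacobi axioms hold, together with the $\mathfrak{sl}(2)$-axioms for $L(-1),L(0),L(1)$, which preserve the $A$- and $\tilde A$-gradings, in the Möbius case, and the Virasoro axioms for $L(n)=\omega_{n+1}$, $\omega\in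 V^{(0)}_{(2)}$, in the conformal case.) For a $V$-module $W$ write $Y_W(v,x)=\sum_n v_nx^{-n-1}$ and let $\tau_W:V\otimes\mathbb C((t))\to\mathrm{End}\,W$ be the linear map with $\tau_W(v\otimes\sum_n a_nt^n)=\sum_n a_nv_n$. For $v\in V_{(h)}$ put $v^o=(-1)^h\sum_{m\ge0}\frac1{m!}L(1)^mv\otimes t^{2h-m-2}$, extend linearly to $V$, and let $o(v\otimes f(t))=v^of(t^{-1})$ for $f\in\mathbb C((t^{-1}))$. For a rational function $f\in R:=\mathbb C[t,t^{-1},(z+t)^{-1}]$ let $T^{\pm}_{-z}f$ be the expansion of $f(t-z)$ in $\mathbb C((t^{\pm1}))$; extend $T^\pm_{-z}$ to $V\otimes R$ and put $T^o_{-z}=o\circ T^-_{-z}$. For $\xi\in V\otimes R$ define the operator $\tau_{Q(z)}(\xi)$ on the full dual $(W_1\otimes W_2)^*$ by $$(\tau_{Q(z)}(\xi)\lambda)(w_1\otimes w_2)=\lambda(\tau_{W_1}(T^o_{-z}\xi)w_1\otimes w_2)-\lambda(w_1\otimes\tau_{W_2}(T^+_{-z}\xi)w_2),$$ and put $Y'_{Q(z)}(v,x)=\sum_{n\in\mathbb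 Z}\tau_{Q(z)}(v\otimes t^n)x^{-n-1}$. In the Möbius case define, for $j=-1,0,1$, $$(L'_{Q(z)}(j)\lambda)(w_1\otimes w_2)=\sum_{i=0}^{j+1}\binom{j+1}{i}(-z)^i\bigl(\lambda(L(i-j)w_1\otimes w_2)-\lambda(w_1\otimes L(j-i)w_2)\bigr);$$ in the conformal case put $L'_{Q(z)}(j)=\tau_{Q(z)}(\omega\otimes t^{j+1})$. * $\mathrm{COMP}_{Q(z)}((W_1\otimes W_2)^*)$ is the space of all $\lambda\in(W_1\otimes W_2)^*$ such that for all $v\in V$: (a) $Y'_{Q(z)}(v,x)\lambda$ involves only finitely many negative powers of $x$; (b) with $Y_t(v,x)=\sum_n(v\otimes t^n)x^{-n-1}$, $$\tau_{Q(z)}\Bigl(z^{-1}\delta\Bigl(\frac{x_1-x_0}{z}\Bigr)Y_t(v,x_0)\Bigr)\lambda=z^{-1}\delta\Bigl(\frac{x_1-x_0}{z}\Bigr)Y'_{Q(z)}(v,x_0)\lambda,$$ i.e. $\tau_{Q(z)}(v\otimes(z+t)^mt^n)\lambda=\sum_{i\ge0}\binom mi z^{m-i}\tau_{Q(z)}(v\otimes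 t^{n+i})\lambda$ for all $m,n\in\mathbb Z$. * For $\beta\in\tilde A$ let $((W_1\otimes W_2)^*)^{(\beta)}$ be the space of those $\lambda$ that vanish on $(W_1\otimes W_2)^{(\gamma)}=\coprod_{\beta_1+\beta_2=\gamma}W_1^{(\beta_1)}\otimes W_2^{(\beta_2)}$ for all $\gamma\ne-\beta$. For $n\in\mathbb C$ let $P_{[n]}^{(\beta)}$ (resp. $P_{(n)}^{(\beta)}$) be the space of the generalized eigenvectors (resp. eigenvectors) of $L'_{Q(z)}(0)$ for $n$ in $((W_1\otimes W_2)^*)^{(\beta)}$, and $0$. Then $\mathrm{LGR}_{[\mathbb C];Q(z)}((W_1\otimes W_2)^*)$ is the space of all $\lambda$ such that (a) $\lambda\in\coprod_{n,\beta}P_{[n]}^{(\beta)}$, and (b) the smallest doubly graded subspace $W_\lambda$ of $\coprod_{n,\beta}P_{[n]}^{(\beta)}$ that contains $\lambda$ and is stable under all $\tau_{Q(z)}(v\otimes t^m)$ ($v\in V$, $m\in\mathbb Z$) and under $L'_{Q(z)}(-1),L'_{Q(z)}(0),L'_{Q(z)}(1)$ satisfies, for all $n\in\mathbb C$, $\beta\in\tilde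 A$, $\dim(W_\lambda\cap P_{[n]}^{(\beta)})<\infty$ and $W_\lambda\cap P_{[n+k]}^{(\beta)}=0$ for $k\in\mathbb Z$ sufficiently negative. $\mathrm{LGR}_{(\mathbb C);Q(z)}((W_1\otimes W_2)^*)$ is defined in the same way with $P_{(n)}^{(\beta)}$ in place of $P_{[n]}^{(\beta)}$. **Theorem.** Each of the three subspaces $\mathrm{COMP}_{Q(z)}((W_1\otimes W_2)^*)$, $\mathrm{LGR}_{[\mathbb C];Q(z)}((W_1\otimes W_2)^*)$ and $\mathrm{LGR}_{(\mathbb C);Q(z)}((W_1\otimes W_2)^*)$ of $(W_1\otimes W_2)^*$ is stable under the operators $\tau_{Q(z)}(v\otimes t^n)$ for all $v\in V$ and $n\in\mathbb Z$, and, both in the Möbius and in the conformal case, under the operators $L'_{Q(z)}(-1)$, $L'_{Q(z)}(0)$ and $L'_{Q(z)}(1)$. -/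

import Mathlib

open scoped TensorProduct VertexOperator

/-!
Conventions. A formal series `∑ aₙ x^{-n-1}` is recorded by its coefficients `aₙ`; for a vertex
operator `Y v` the operator `(Y v)[[n]]` is the coefficient `vₙ` of `x^{-n-1}`.
-/

namespace LogTensor

noncomputable section

/-! ### Axioms on vertex operators -/

section Axioms

variable {V W : Type*} [AddCommGroup V] [Module ℂ V] [AddCommGroup W] [Module ℂ W]

/-- The action of a vertex algebra `V` on `W` as a map `Y_W(·, x)`: for `v ∈ V`, the series
`Y_W(v, x) w` has coefficients in `W` and is lower truncated. The modes `vₙ` are linear in `v`. -/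
def mode (Y : V →ₗ[ℂ] (W →ₗ[ℂ] HahnModule ℤ ℂ W)) (v : V) (n : ℤ) : Module.End ℂ W :=
  (show VertexOperator ℂ W from Y v)[[n]]

/-- The Jacobi identity
`x₀⁻¹δ((x₁-x₂)/x₀) Y(u,x₁)Y(v,x₂)w - x₀⁻¹δ((x₂-x₁)/(-x₀)) Y(v,x₂)Y(u,x₁)w
  = x₂⁻¹δ((x₁-x₀)/x₂) Y(Y(u,x₀)v,x₂)w`,
where `x₂⁻¹δ((x₁-x₀)/x₂) = x₁⁻¹δ((x₂+x₀)/x₁)`. The equation for `l m n` is the equality of the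
coefficients of `x₀^{-l-1} x₁^{-m-1} x₂^{-n-1}`; all sums are finite by lower truncation. -/
def JacobiIdentity (YV : V →ₗ[ℂ] VertexOperator ℂ V) (YW : V →ₗ[ℂ] VertexOperator ℂ W) : Prop :=
  ∀ (u v : V) (w : W) (l m n : ℤ),
    (∑ᶠ i : ℕ, ((-1 : ℂ) ^ i * (Ring.choose l i : ℤ)) •
        mode YW u (m + l - i) (mode YW v (n + i) w))
      - (∑ᶠ i : ℕ, ((-1 : ℂ) ^ (l - i) * (Ring.choose l i : ℤ)) •
        mode YW v (n + l - i) (mode YW u (m + i) w))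
    = ∑ᶠ i : ℕ, ((Ring.choose m i : ℤ) : ℂ) • mode YW (mode YV u (l + i) v) (m + n - i) w

/-- Three operators `L(-1), L(0), L(1)` giving a representation of `𝔰𝔩(2)`, with respect to the
basis with brackets `[L₀,L₋₁] = L₋₁`, `[L₀,L₁] = -L₁`, `[L₋₁,L₁] = -2L₀`. -/
structure Sl2Rep (W : Type*) [AddCommGroup W] [Module ℂ W] where
  Lneg : Module.End ℂ W
  Lzero : Module.End ℂ W
  Lone : Module.End ℂ W
  lie_zero_neg : ⁅Lzero, Lneg⁆ = Lneg
  lie_zero_one : ⁅Lzero, Lone⁆ = -Lone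
  lie_neg_one : ⁅Lneg, Lone⁆ = -(2 : ℂ) • Lzero

/-- The operator `L(j)` for `j = -1, 0, 1` (and `0` for the other integers, which are not used). -/
def Sl2Rep.L (ρ : Sl2Rep W) (j : ℤ) : Module.End ℂ W :=
  if j = -1 then ρ.Lneg else if j = 0 then ρ.Lzero else if j = 1 then ρ.Lone else 0

/-- `[L(j), Y_W(v,x)] = ∑_{k=0}^{j+1} binom(j+1,k) x^{j+1-k} Y_W(L(k-1)v, x)` for `j = -1, 0, 1`,
as an identity for the coefficients of `x^{-n-1}`. -/
def Sl2Commutator (YW : V →ₗ[ℂ] VertexOperator ℂ W) (ρV : Sl2Rep V) (ρW : Sl2Rep W) : Prop :=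
  ∀ (v : V) (n : ℤ),
    ⁅ρW.Lneg, mode YW v n⁆ = mode YW (ρV.Lneg v) n ∧
    ⁅ρW.Lzero, mode YW v n⁆ = mode YW (ρV.Lzero v) n + mode YW (ρV.Lneg v) (n + 1) ∧
    ⁅ρW.Lone, mode YW v n⁆ = mode YW (ρV.Lone v) n + (2 : ℂ) • mode YW (ρV.Lzero v) (n + 1)
      + mode YW (ρV.Lneg v) (n + 2)

/-- The `L(-1)`-derivative property `d/dx Y_W(v,x) = Y_W(L(-1)v,x)`. -/
def DerivativeProperty (YW : V →ₗ[ℂ] VertexOperator ℂ W) (L : Module.End ℂ V) : Prop :=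
  ∀ (v : V) (n : ℤ), mode YW (L v) n = -(n : ℂ) • mode YW v (n - 1)

/-- The Virasoro relations with central charge `c` for the operators `L(n) = ω_{n+1}` on `W`. -/
def VirasoroRelations (YW : V →ₗ[ℂ] VertexOperator ℂ W) (ω : V) (c : ℂ) : Prop :=
  ∀ m n : ℤ, ⁅mode YW ω (m + 1), mode YW ω (n + 1)⁆ =
    ((m : ℂ) - n) • mode YW ω (m + n + 1)
      + (if m + n = 0 then (1 / 12 * ((m : ℂ) ^ 3 - m) * c) • (1 : Module.End ℂ W) else 0)

end Axioms

/-! ### Strongly graded vertex algebras and their generalized modules -/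

/-- The data and axioms common to strongly `A`-graded Möbius and conformal vertex algebras:
a weight grading `V = ∐ V_(n)` and an `A`-grading `V = ∐ V^(α)`, compatible with each other,
with `dim V^(α)_(n) < ∞` and `V^(α)_(n) = 0` for `n` sufficiently negative, together with a lower
truncated vertex operator map and a vacuum satisfying the vacuum and creation properties and the
Jacobi identity. -/
structure GradedVertexAlgebra (A : Type*) [AddCommGroup A] (V : Type*) [AddCommGroup V]
    [Module ℂ V] where
  Y : V →ₗ[ℂ] VertexOperator ℂ V
  vac : V
  wt : ℤ → Submodule ℂ V
  gr : A → Submodule ℂ V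
  wt_indep : iSupIndep wt
  wt_span : ⨆ n, wt n = ⊤
  gr_indep : iSupIndep gr
  gr_span : ⨆ α, gr α = ⊤
  compatible : ∀ α, gr α = ⨆ n, gr α ⊓ wt n
  lower_bound : ∀ α, ∃ N : ℤ, ∀ n ≤ N, gr α ⊓ wt n = ⊥
  finite_dim : ∀ α n, FiniteDimensional ℂ ↥(gr α ⊓ wt n)
  vac_mem : vac ∈ gr 0 ⊓ wt 0
  vacuum : ∀ n, mode Y vac n = if n = -1 then 1 else 0
  creation : ∀ v, mode Y v (-1) vac = v
  creation_regular : ∀ (v : V) (n : ℤ), 0 ≤ n → mode Y v n vac = 0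
  jacobi : JacobiIdentity Y Y
  mode_gr : ∀ (α β : A) (v w : V) (n : ℤ), v ∈ gr α → w ∈ gr β → mode Y v n w ∈ gr (α + β)

/-- A strongly `A`-graded Möbius vertex algebra. -/
structure MobiusVertexAlgebra (A : Type*) [AddCommGroup A] (V : Type*) [AddCommGroup V]
    [Module ℂ V] extends GradedVertexAlgebra A V where
  sl2 : Sl2Rep V
  sl2_comm : Sl2Commutator Y sl2 sl2
  derivative : DerivativeProperty Y sl2.Lneg
  L_zero : ∀ (n : ℤ) (v : V), v ∈ wt n → sl2.Lzero v = (n : ℂ) • v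
  L_gr : ∀ (j : ℤ) (α : A) (v : V), v ∈ gr α → sl2.L j v ∈ gr α

/-- A strongly `A`-graded conformal vertex algebra, with conformal vector `ω` and central charge
`c`; here `L(n) = ω_{n+1}`. -/
structure ConformalVertexAlgebra (A : Type*) [AddCommGroup A] (V : Type*) [AddCommGroup V]
    [Module ℂ V] extends GradedVertexAlgebra A V where
  ω : V
  c : ℂ
  ω_mem : ω ∈ gr 0 ⊓ wt 2
  virasoro : VirasoroRelations Y ω c
  derivative : DerivativeProperty Y (mode Y ω 0)
  L_zero : ∀ (n : ℤ) (v : V), v ∈ wt n → mode Y ω 1 v = (n : ℂ) • v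

/-- The data and axioms common to strongly `B`-graded generalized modules for strongly `A`-graded
Möbius and conformal vertex algebras, where `A` is a subgroup of `B`: gradings `W = ∐ W_[n]`
(`n ∈ ℂ`) and `W = ∐ W^(β)` (`β ∈ B`), compatible with each other, with
`dim W^(β)_[n] < ∞` and `W^(β)_[n+k] = 0` for `k ∈ ℤ` sufficiently negative, and a lower truncated
vertex operator map satisfying the vacuum property and the Jacobi identity. -/
structure GradedModule {B : Type*} [AddCommGroup B] {A : AddSubgroup B} {V : Type*}
    [AddCommGroup V] [Module ℂ V] (𝒱 : GradedVertexAlgebra A V) (W : Type*) [AddCommGroup W]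
    [Module ℂ W] where
  Y : V →ₗ[ℂ] VertexOperator ℂ W
  wt : ℂ → Submodule ℂ W
  gr : B → Submodule ℂ W
  wt_indep : iSupIndep wt
  wt_span : ⨆ n, wt n = ⊤
  gr_indep : iSupIndep gr
  gr_span : ⨆ β, gr β = ⊤
  compatible : ∀ β, gr β = ⨆ n, gr β ⊓ wt n
  lower_bound : ∀ β n, ∃ K : ℤ, ∀ k ≤ K, gr β ⊓ wt (n + k) = ⊥
  finite_dim : ∀ β n, FiniteDimensional ℂ ↥(gr β ⊓ wt n)
  vacuum : ∀ n, mode Y 𝒱.vac n = if n = -1 then 1 else 0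
  jacobi : JacobiIdentity 𝒱.Y Y
  mode_gr : ∀ (α : A) (β : B) (v : V) (w : W) (n : ℤ),
    v ∈ 𝒱.gr α → w ∈ gr β → mode Y v n w ∈ gr (α + β)

/-- A strongly graded generalized module for a Möbius vertex algebra: `W_[n]` consists of
generalized `L(0)`-eigenvectors of generalized eigenvalue `n`. -/
structure MobiusVertexAlgebra.GenModule {B : Type*} [AddCommGroup B] {A : AddSubgroup B}
    {V : Type*} [AddCommGroup V] [Module ℂ V] (𝒱 : MobiusVertexAlgebra A V) (W : Type*)
    [AddCommGroup W] [Module ℂ W] extends GradedModule 𝒱.toGradedVertexAlgebra W where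
  sl2 : Sl2Rep W
  sl2_comm : Sl2Commutator Y 𝒱.sl2 sl2
  derivative : DerivativeProperty Y 𝒱.sl2.Lneg
  L_zero : ∀ n, wt n ≤ sl2.Lzero.maxGenEigenspace n
  L_gr : ∀ (j : ℤ) (β : B) (w : W), w ∈ gr β → sl2.L j w ∈ gr β

/-- A strongly graded generalized module for a conformal vertex algebra; `L(n) = ω_{n+1}`. -/
structure ConformalVertexAlgebra.GenModule {B : Type*} [AddCommGroup B] {A : AddSubgroup B}
    {V : Type*} [AddCommGroup V] [Module ℂ V] (𝒱 : ConformalVertexAlgebra A V) (W : Type*)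
    [AddCommGroup W] [Module ℂ W] extends GradedModule 𝒱.toGradedVertexAlgebra W where
  virasoro : VirasoroRelations Y 𝒱.ω 𝒱.c
  derivative : DerivativeProperty Y (mode 𝒱.Y 𝒱.ω 0)
  L_zero : ∀ n, wt n ≤ (mode Y 𝒱.ω 1).maxGenEigenspace n

/-! ### A conformal vertex algebra is a Möbius vertex algebra -/

section Conformal

variable {V W : Type*} [AddCommGroup V] [Module ℂ V] [AddCommGroup W] [Module ℂ W]

/-- The operators `L(j) = ω_{j+1}`, `j = -1, 0, 1`, represent `𝔰𝔩(2)`. -/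
def VirasoroRelations.sl2 {Y : V →ₗ[ℂ] VertexOperator ℂ W} {ω : V} {c : ℂ}
    (h : VirasoroRelations Y ω c) : Sl2Rep W where
  Lneg := mode Y ω 0
  Lzero := mode Y ω 1
  Lone := mode Y ω 2
  lie_zero_neg := by simpa using h 0 (-1)
  lie_zero_one := by simpa using h 0 1
  lie_neg_one := by
    have := h (-1) 1
    norm_num at this
    simpa using this

/-- The case `l = 0`, `m = k ≥ 0` of the Jacobi identity. -/
theorem JacobiIdentity.comm {YV : V →ₗ[ℂ] VertexOperator ℂ V} {YW : V →ₗ[ℂ] VertexOperator ℂ W}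
    (h : JacobiIdentity YV YW) (u v : V) (k : ℕ) (n : ℤ) :
    ⁅mode YW u k, mode YW v n⁆ =
      ∑ i ∈ Finset.range (k + 1), (k.choose i : ℂ) • mode YW (mode YV u i v) (k + n - i) := by
  ext w
  have h0 := h u v w 0 k n
  have e : ∀ (i : ℕ), i ≠ 0 → (Ring.choose (0 : ℤ) i) = 0 := fun i hi =>
    Ring.choose_zero_pos ℤ (Nat.pos_of_ne_zero hi)
  rw [finsum_eq_single _ 0 (fun i hi => by simp [e i hi]),
    finsum_eq_single _ 0 (fun i hi => by simp [e i hi]),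
    finsum_eq_sum_of_support_subset (s := Finset.range (k + 1))] at h0
  · simpa [Ring.lie_def, Ring.choose_natCast] using h0
  · intro i hi
    by_contra hc
    refine hi ?_
    have : k.choose i = 0 := Nat.choose_eq_zero_of_lt (by simpa using hc)
    simp [Ring.choose_natCast, this]

theorem JacobiIdentity.sl2_comm {YV : V →ₗ[ℂ] VertexOperator ℂ V}
    {YW : V →ₗ[ℂ] VertexOperator ℂ W} (h : JacobiIdentity YV YW) {ω : V} {c : ℂ}
    (hV : VirasoroRelations YV ω c) (hW : VirasoroRelations YW ω c) :
    Sl2Commutator YW hV.sl2 hW.sl2 := by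
  intro v n
  refine ⟨?_, ?_, ?_⟩
  · simpa [VirasoroRelations.sl2] using h.comm ω v 0 n
  · have := h.comm ω v 1 n
    simp [VirasoroRelations.sl2, Finset.sum_range_succ] at this ⊢
    rw [this, add_comm, add_comm 1 n]
  · have := h.comm ω v 2 n
    simp [VirasoroRelations.sl2, Finset.sum_range_succ] at this ⊢
    rw [this, add_comm 2 n, show n + 2 - 1 = n + 1 by ring]
    abel

/-- The Möbius vertex algebra underlying a conformal vertex algebra. -/
def ConformalVertexAlgebra.toMobius {A : Type*} [AddCommGroup A]
    (𝒱 : ConformalVertexAlgebra A V) : MobiusVertexAlgebra A V where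
  toGradedVertexAlgebra := 𝒱.toGradedVertexAlgebra
  sl2 := 𝒱.virasoro.sl2
  sl2_comm := 𝒱.jacobi.sl2_comm 𝒱.virasoro 𝒱.virasoro
  derivative := 𝒱.derivative
  L_zero := 𝒱.L_zero
  L_gr j α v hv := by
    have key : ∀ n, mode 𝒱.Y 𝒱.ω n v ∈ 𝒱.gr α := fun n => by
      simpa using 𝒱.mode_gr 0 α 𝒱.ω v n 𝒱.ω_mem.1 hv
    unfold Sl2Rep.L VirasoroRelations.sl2
    split_ifs <;> simp [key]

end Conformal

/-! ### Nilpotency of `L(1)` -/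

section Nilpotency

variable {A : Type*} [AddCommGroup A] {V : Type*} [AddCommGroup V] [Module ℂ V]
  (𝒱 : MobiusVertexAlgebra A V)

theorem MobiusVertexAlgebra.wt_eq_eigenspace (n : ℤ) :
    𝒱.wt n = 𝒱.sl2.Lzero.eigenspace (n : ℂ) := by
  have hle : 𝒱.wt ≤ fun n : ℤ => 𝒱.sl2.Lzero.eigenspace (n : ℂ) := fun n v hv =>
    Module.End.mem_eigenspace_iff.2 (𝒱.L_zero n v hv)
  have hind : iSupIndep fun n : ℤ => 𝒱.sl2.Lzero.eigenspace (n : ℂ) :=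
    (Module.End.eigenspaces_iSupIndep 𝒱.sl2.Lzero).comp (f := fun n : ℤ => (n : ℂ))
      Int.cast_injective
  exact congrFun ((hind.le_iff_eq_of_iSup_eq_top 𝒱.wt_span).1 hle) n

theorem MobiusVertexAlgebra.L_one_wt (n : ℤ) (v : V) (hv : v ∈ 𝒱.wt n) :
    𝒱.sl2.Lone v ∈ 𝒱.wt (n - 1) := by
  rw [wt_eq_eigenspace, Module.End.mem_eigenspace_iff]
  have h := LinearMap.congr_fun 𝒱.sl2.lie_zero_one v
  simp only [Ring.lie_def, LinearMap.sub_apply, Module.End.mul_apply, LinearMap.neg_apply,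
    𝒱.L_zero n v hv, map_smul] at h
  rw [sub_eq_iff_eq_add] at h
  rw [h]
  push_cast
  module

theorem MobiusVertexAlgebra.L_one_nilpotent (v : V) :
    ∃ N : ℕ, ∀ m ≥ N, (𝒱.sl2.Lone ^ m) v = 0 := by
  have key : (⊤ : Submodule ℂ V) ≤ 𝒱.sl2.Lone.maxGenEigenspace 0 := by
    rw [← 𝒱.gr_span]
    refine iSup_le fun α => ?_
    rw [𝒱.compatible α]
    refine iSup_le fun n v hv => ?_
    have hm : ∀ m : ℕ, (𝒱.sl2.Lone ^ m) v ∈ 𝒱.gr α ⊓ 𝒱.wt (n - m) := by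
      intro m
      induction m with
      | zero => simpa using hv
      | succ m ih =>
        rw [pow_succ', Module.End.mul_apply]
        refine ⟨?_, ?_⟩
        · simpa [Sl2Rep.L] using 𝒱.L_gr 1 α _ ih.1
        · have := 𝒱.L_one_wt _ _ ih.2
          rwa [show n - ((m + 1 : ℕ) : ℤ) = n - m - 1 by push_cast; ring]
    obtain ⟨N, hN⟩ := 𝒱.lower_bound α
    rw [Module.End.mem_maxGenEigenspace]
    refine ⟨(n - N).toNat, ?_⟩
    have := hm (n - N).toNat
    rw [hN _ (by omega)] at this
    simpa using this
  obtain ⟨N, hN⟩ := (Module.End.mem_maxGenEigenspace _ _ _).1 (key (Submodule.mem_top (x := v)))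
  refine ⟨N, fun m hm => ?_⟩
  rw [zero_smul, sub_zero] at hN
  obtain ⟨k, rfl⟩ := Nat.exists_eq_add_of_le' hm
  rw [pow_add, Module.End.mul_apply, hN, map_zero]

end Nilpotency

/-! ### The maps `τ_W` and `o` -/

section Tau

variable {V W : Type*} [AddCommGroup V] [Module ℂ V] [AddCommGroup W] [Module ℂ W]

theorem finite_support_tau (Y : V →ₗ[ℂ] VertexOperator ℂ W) (v : V) (f : LaurentSeries ℂ) (w : W) :
    (Function.support fun n : ℤ => f.coeff n • mode Y v n w).Finite := by
  refine (Set.finite_Icc f.order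
    (-1 - HahnSeries.order ((HahnModule.of ℂ).symm (Y v w)))).subset fun n hn => ?_
  rw [Function.mem_support] at hn
  refine ⟨?_, ?_⟩
  · by_contra h
    exact hn (by rw [HahnSeries.coeff_eq_zero_of_lt_order (not_le.1 h), zero_smul])
  · by_contra h
    have h0 : mode Y v n w = 0 :=
      VertexOperator.ncoeff_eq_zero_of_lt_order (Y v) n w (by omega)
    exact hn (by rw [h0, smul_zero])

theorem mode_add (Y : V →ₗ[ℂ] VertexOperator ℂ W) (u v : V) (n : ℤ) :
    mode Y (u + v) n = mode Y u n + mode Y v n := by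
  simp [mode, map_add]

theorem mode_smul (Y : V →ₗ[ℂ] VertexOperator ℂ W) (a : ℂ) (v : V) (n : ℤ) :
    mode Y (a • v) n = a • mode Y v n := by
  simp [mode, map_smul]

/-- The linear map `τ_W : V ⊗ ℂ((t)) → End W`, `v ⊗ ∑ aₙ tⁿ ↦ ∑ aₙ vₙ`. -/
def tauW (Y : V →ₗ[ℂ] VertexOperator ℂ W) : V ⊗[ℂ] LaurentSeries ℂ →ₗ[ℂ] Module.End ℂ W :=
  TensorProduct.lift <| LinearMap.mk₂ ℂ
    (fun v f =>
      { toFun := fun w => ∑ᶠ n : ℤ, f.coeff n • mode Y v n w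
        map_add' := fun w w' => by
          rw [← finsum_add_distrib (finite_support_tau Y v f w) (finite_support_tau Y v f w')]
          simp
        map_smul' := fun a w => by
          rw [RingHom.id_apply, smul_finsum]
          exact finsum_congr fun n => by rw [map_smul, smul_comm] })
    (fun v v' f => LinearMap.ext fun w => by
      simp only [LinearMap.coe_mk, AddHom.coe_mk, LinearMap.add_apply]
      rw [← finsum_add_distrib (finite_support_tau Y v f w) (finite_support_tau Y v' f w)]
      simp [mode_add])
    (fun a v f => LinearMap.ext fun w => by
      simp only [LinearMap.coe_mk, AddHom.coe_mk, LinearMap.smul_apply]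
      rw [smul_finsum]
      exact finsum_congr fun n => by rw [mode_smul, LinearMap.smul_apply, smul_comm])
    (fun v f f' => LinearMap.ext fun w => by
      simp only [LinearMap.coe_mk, AddHom.coe_mk, LinearMap.add_apply]
      rw [← finsum_add_distrib (finite_support_tau Y v f w) (finite_support_tau Y v f' w)]
      simp [add_smul])
    (fun a v f => LinearMap.ext fun w => by
      simp only [LinearMap.coe_mk, AddHom.coe_mk, LinearMap.smul_apply]
      rw [smul_finsum]
      exact finsum_congr fun n => by rw [HahnSeries.coeff_smul, smul_eq_mul, mul_smul])

theorem tauW_tmul (Y : V →ₗ[ℂ] VertexOperator ℂ W) (v : V) (f : LaurentSeries ℂ) (w : W) :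
    tauW Y (v ⊗ₜ f) w = ∑ᶠ n : ℤ, f.coeff n • mode Y v n w := rfl

variable {A : Type*} [AddCommGroup A] (𝒱 : MobiusVertexAlgebra A V)

theorem finite_support_opp (h : ℤ) (v : V) :
    (Function.support fun m : ℕ => ((-1 : ℂ) ^ h / (m.factorial : ℂ)) •
      ((𝒱.sl2.Lone ^ m) v ⊗ₜ[ℂ] (HahnSeries.single (2 * h - m - 2) 1 : LaurentSeries ℂ))).Finite := by
  obtain ⟨N, hN⟩ := 𝒱.L_one_nilpotent v
  refine (Set.finite_Iio N).subset fun m hm => ?_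
  by_contra hc
  exact hm (by simp [hN m (not_lt.1 hc)])

/-- For `v` of weight `h`, the element
`v^o = (-1)^h ∑_{m ≥ 0} (1/m!) L(1)^m v ⊗ t^{-m-2+2h}` of `V ⊗ ℂ[t,t⁻¹] ⊂ V ⊗ ℂ((t))`. -/
def oppHomogeneous (h : ℤ) : V →ₗ[ℂ] V ⊗[ℂ] LaurentSeries ℂ where
  toFun v := ∑ᶠ m : ℕ, ((-1 : ℂ) ^ h / (m.factorial : ℂ)) •
    ((𝒱.sl2.Lone ^ m) v ⊗ₜ[ℂ] (HahnSeries.single (2 * h - m - 2) 1 : LaurentSeries ℂ))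
  map_add' v v' := by
    rw [← finsum_add_distrib (finite_support_opp 𝒱 h v) (finite_support_opp 𝒱 h v')]
    simp [TensorProduct.add_tmul]
  map_smul' a v := by
    rw [RingHom.id_apply, smul_finsum]
    exact finsum_congr fun m => by rw [map_smul, ← TensorProduct.smul_tmul', smul_comm]

/-- `v ↦ v^o` on `V = ∐ V_(h)`: the linear extension of `oppHomogeneous h` on `V_(h)`. -/
def oppVector : V →ₗ[ℂ] V ⊗[ℂ] LaurentSeries ℂ :=
  (DFinsupp.lsum ℂ fun h : ℤ => (oppHomogeneous 𝒱 h).comp (𝒱.wt h).subtype).comp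
    (𝒱.wt_indep.linearEquiv 𝒱.wt_span).symm.toLinearMap

theorem oppVector_of_mem (h : ℤ) (v : V) (hv : v ∈ 𝒱.wt h) :
    oppVector 𝒱 v = oppHomogeneous 𝒱 h v := by
  unfold oppVector
  have : (𝒱.wt_indep.linearEquiv 𝒱.wt_span).symm v = DFinsupp.single h ⟨v, hv⟩ :=
    𝒱.wt_indep.linearEquiv_symm_apply 𝒱.wt_span hv
  simp [this]

/-- Multiplication of Laurent series as a bilinear map. -/
def mulSeries : LaurentSeries ℂ →ₗ[ℂ] LaurentSeries ℂ →ₗ[ℂ] LaurentSeries ℂ :=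
  LinearMap.mk₂ ℂ (fun f g => f * g) add_mul
    (fun a f g => by rw [← HahnSeries.C_mul_eq_smul, ← HahnSeries.C_mul_eq_smul, mul_assoc]) mul_add
    (fun a f g => by rw [← HahnSeries.C_mul_eq_smul, ← HahnSeries.C_mul_eq_smul, mul_left_comm])

/-- The opposite-operator map `o : V ⊗ ℂ((t⁻¹)) → V ⊗ ℂ((t))`, `v ⊗ f(t) ↦ v^o f(t⁻¹)`.
An element `f(t)` of `ℂ((t⁻¹))` is represented by the Laurent series `∑ aₙ sⁿ` in `s = t⁻¹`; the
series `f(t⁻¹) = ∑ aₙ tⁿ` then has the same coefficients. -/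
def oppMap : V ⊗[ℂ] LaurentSeries ℂ →ₗ[ℂ] V ⊗[ℂ] LaurentSeries ℂ :=
  TensorProduct.lift (((LinearMap.lTensorHom V).comp mulSeries).flip.comp (oppVector 𝒱))

theorem oppMap_tmul (v : V) (f : LaurentSeries ℂ) :
    oppMap 𝒱 (v ⊗ₜ f) = (mulSeries f).lTensor V (oppVector 𝒱 v) := rfl

end Tau

/-! ### Rational functions and their expansions -/

section Rational

open scoped nonZeroDivisors

/-- Evaluation of a polynomial at a Laurent series. -/
def evalSeries (g : LaurentSeries ℂ) : Polynomial ℂ →+* LaurentSeries ℂ :=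
  Polynomial.eval₂RingHom HahnSeries.C g

theorem evalSeries_coeff (k : ℤ) (hk : k ≠ 0) (p : Polynomial ℂ) (n : ℕ) :
    (evalSeries (HahnSeries.single k 1) p).coeff (k * n) = p.coeff n := by
  simp only [evalSeries, Polynomial.coe_eval₂RingHom]
  induction p using Polynomial.induction_on' with
  | add p q hp hq => simp [Polynomial.eval₂_add, hp, hq]
  | monomial m a =>
    rw [Polynomial.eval₂_monomial, HahnSeries.single_pow, HahnSeries.C_mul_eq_smul, one_pow,
      HahnSeries.coeff_smul, HahnSeries.coeff_single, Polynomial.coeff_monomial]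
    have : k * (n : ℤ) = m • k ↔ m = n := by
      rw [nsmul_eq_mul, mul_comm, mul_left_inj' hk]
      omega
    simp only [this, smul_eq_mul, mul_ite, mul_one, mul_zero]

theorem evalSeries_nonZeroDivisors (k : ℤ) (hk : k ≠ 0) :
    (Polynomial ℂ)⁰ ≤ ((LaurentSeries ℂ)⁰).comap (evalSeries (HahnSeries.single k 1)) := by
  refine nonZeroDivisors_le_comap_nonZeroDivisors_of_injective _ ?_
  rw [injective_iff_map_eq_zero]
  intro p hp
  ext n
  rw [← evalSeries_coeff k hk, hp]
  simp

/-- The expansion `ι₊ : ℂ(t) → ℂ((t))`. -/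
def iotaPlus : RatFunc ℂ →+* LaurentSeries ℂ :=
  RatFunc.liftRingHom (evalSeries (HahnSeries.single 1 1))
    (evalSeries_nonZeroDivisors 1 one_ne_zero)

/-- The expansion `ι₋ : ℂ(t) → ℂ((t⁻¹))`; elements of `ℂ((t⁻¹))` are written as Laurent series
in `s = t⁻¹`, so that `t ↦ s⁻¹`. -/
def iotaMinus : RatFunc ℂ →+* LaurentSeries ℂ :=
  RatFunc.liftRingHom (evalSeries (HahnSeries.single (-1) 1))
    (evalSeries_nonZeroDivisors (-1) (by decide))

theorem iotaPlus_smul (a : ℂ) (f : RatFunc ℂ) : iotaPlus (a • f) = a • iotaPlus f := by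
  rw [RatFunc.smul_eq_C_mul, map_mul, ← HahnSeries.C_mul_eq_smul, ← RatFunc.algebraMap_C]
  simp [iotaPlus, evalSeries]

theorem iotaMinus_smul (a : ℂ) (f : RatFunc ℂ) : iotaMinus (a • f) = a • iotaMinus f := by
  rw [RatFunc.smul_eq_C_mul, map_mul, ← HahnSeries.C_mul_eq_smul, ← RatFunc.algebraMap_C]
  simp [iotaMinus, evalSeries]

/-- The algebra `ℂ[t, t⁻¹, (z+t)⁻¹]` of rational functions. (It is identified with its image
`ι₊ ℂ[t, t⁻¹, (z+t)⁻¹]` under the injective expansion map.) -/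
def ratAlg (z : ℂ) : Subalgebra ℂ (RatFunc ℂ) :=
  Algebra.adjoin ℂ {RatFunc.X, RatFunc.X⁻¹, (RatFunc.C z + RatFunc.X)⁻¹}

theorem ratAlg_mem (z : ℂ) (m n : ℤ) :
    (RatFunc.C z + RatFunc.X) ^ m * (RatFunc.X : RatFunc ℂ) ^ n ∈ ratAlg z := by
  have hX : (RatFunc.X : RatFunc ℂ) ∈ ratAlg z := Algebra.subset_adjoin (by simp)
  have hXi : (RatFunc.X : RatFunc ℂ)⁻¹ ∈ ratAlg z := Algebra.subset_adjoin (by simp)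
  have hYi : (RatFunc.C z + RatFunc.X : RatFunc ℂ)⁻¹ ∈ ratAlg z :=
    Algebra.subset_adjoin (by simp)
  have hY : (RatFunc.C z + RatFunc.X : RatFunc ℂ) ∈ ratAlg z :=
    add_mem (by simpa using (ratAlg z).algebraMap_mem z) hX
  have key : ∀ (f : RatFunc ℂ), f ∈ ratAlg z → f⁻¹ ∈ ratAlg z → ∀ k : ℤ, f ^ k ∈ ratAlg z := by
    intro f hf hfi k
    obtain ⟨k, rfl | rfl⟩ := k.eq_nat_or_neg
    · simpa using pow_mem hf k
    · simpa using pow_mem hfi k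
  exact mul_mem (key _ hY hYi m) (key _ hX hXi n)

/-- The element `(z+t)^m t^n` of `ℂ[t, t⁻¹, (z+t)⁻¹]`. -/
def ratElt (z : ℂ) (m n : ℤ) : ratAlg z :=
  ⟨(RatFunc.C z + RatFunc.X) ^ m * RatFunc.X ^ n, ratAlg_mem z m n⟩

theorem laurent_smul (a z : ℂ) (f : RatFunc ℂ) :
    RatFunc.laurent z (a • f) = a • RatFunc.laurent z f := by
  rw [RatFunc.smul_eq_C_mul, map_mul, RatFunc.laurent_C, RatFunc.smul_eq_C_mul]

/-- `T⁺₋z : f(t) ↦ f(t - z)`, expanded in `ℂ((t))`. -/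
def Tplus (z : ℂ) : ratAlg z →ₗ[ℂ] LaurentSeries ℂ where
  toFun f := iotaPlus (RatFunc.laurent (-z) f)
  map_add' f g := by simp
  map_smul' a f := by simp [laurent_smul, iotaPlus_smul]

/-- `T⁻₋z : f(t) ↦ f(t - z)`, expanded in `ℂ((t⁻¹))`. -/
def Tminus (z : ℂ) : ratAlg z →ₗ[ℂ] LaurentSeries ℂ where
  toFun f := iotaMinus (RatFunc.laurent (-z) f)
  map_add' f g := by simp
  map_smul' a f := by simp [laurent_smul, iotaMinus_smul]

end Rational

/-! ### The action `τ_{Q(z)}` on `(W₁ ⊗ W₂)*` -/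

section TauQ

variable {B : Type*} [AddCommGroup B] {A : AddSubgroup B}
  {V W₁ W₂ : Type*} [AddCommGroup V] [Module ℂ V] [AddCommGroup W₁] [Module ℂ W₁]
  [AddCommGroup W₂] [Module ℂ W₂]

variable (W₁ W₂) in
/-- The full dual space `(W₁ ⊗ W₂)*`. -/
abbrev TensorDual : Type _ := Module.Dual ℂ (W₁ ⊗[ℂ] W₂)

variable (W₁ W₂) in
/-- For an operator `a` on `W₁`, the operator `λ ↦ λ(a · ⊗ ·)` on `(W₁ ⊗ W₂)*`. -/
def dualLeft : Module.End ℂ W₁ →ₗ[ℂ] Module.End ℂ (TensorDual W₁ W₂) :=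
  (Module.Dual.transpose (R := ℂ)).comp (LinearMap.rTensorHom W₂)

variable (W₁ W₂) in
/-- For an operator `a` on `W₂`, the operator `λ ↦ λ(· ⊗ a ·)` on `(W₁ ⊗ W₂)*`. -/
def dualRight : Module.End ℂ W₂ →ₗ[ℂ] Module.End ℂ (TensorDual W₁ W₂) :=
  (Module.Dual.transpose (R := ℂ)).comp (LinearMap.lTensorHom W₁)

theorem dualLeft_apply (a : Module.End ℂ W₁) (lam : TensorDual W₁ W₂) (w₁ : W₁) (w₂ : W₂) :
    dualLeft W₁ W₂ a lam (w₁ ⊗ₜ w₂) = lam (a w₁ ⊗ₜ w₂) := rfl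

theorem dualRight_apply (a : Module.End ℂ W₂) (lam : TensorDual W₁ W₂) (w₁ : W₁) (w₂ : W₂) :
    dualRight W₁ W₂ a lam (w₁ ⊗ₜ w₂) = lam (w₁ ⊗ₜ a w₂) := rfl

/-- The linear action `τ_{Q(z)}` of `V ⊗ ℂ[t, t⁻¹, (z+t)⁻¹]` on `(W₁ ⊗ W₂)*`:
`(τ(ξ)λ)(w₁ ⊗ w₂) = λ(τ_{W₁}(Tᵒ₋z ξ) w₁ ⊗ w₂) - λ(w₁ ⊗ τ_{W₂}(T⁺₋z ξ) w₂)`,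
where `Tᵒ₋z = o ∘ T⁻₋z`. -/
def tauQ (𝒱 : MobiusVertexAlgebra A V) (M₁ : GradedModule 𝒱.toGradedVertexAlgebra W₁)
    (M₂ : GradedModule 𝒱.toGradedVertexAlgebra W₂) (z : ℂ) :
    V ⊗[ℂ] ratAlg z →ₗ[ℂ] Module.End ℂ (TensorDual W₁ W₂) :=
  (dualLeft W₁ W₂).comp ((tauW M₁.Y).comp ((oppMap 𝒱).comp ((Tminus z).lTensor V)))
    - (dualRight W₁ W₂).comp ((tauW M₂.Y).comp ((Tplus z).lTensor V))

theorem tauQ_apply (𝒱 : MobiusVertexAlgebra A V) (M₁ : GradedModule 𝒱.toGradedVertexAlgebra W₁)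
    (M₂ : GradedModule 𝒱.toGradedVertexAlgebra W₂) (z : ℂ) (ξ : V ⊗[ℂ] ratAlg z)
    (lam : TensorDual W₁ W₂) (w₁ : W₁) (w₂ : W₂) :
    tauQ 𝒱 M₁ M₂ z ξ lam (w₁ ⊗ₜ w₂) =
      lam (tauW M₁.Y (oppMap 𝒱 ((Tminus z).lTensor V ξ)) w₁ ⊗ₜ w₂)
        - lam (w₁ ⊗ₜ tauW M₂.Y ((Tplus z).lTensor V ξ) w₂) := rfl

/-- The operator `τ_{Q(z)}(v ⊗ tⁿ)`, i.e. the coefficient of `x^{-n-1}` in `Y'_{Q(z)}(v, x)`. -/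
def modeQ (𝒱 : MobiusVertexAlgebra A V) (M₁ : GradedModule 𝒱.toGradedVertexAlgebra W₁)
    (M₂ : GradedModule 𝒱.toGradedVertexAlgebra W₂) (z : ℂ) (v : V) (n : ℤ) :
    Module.End ℂ (TensorDual W₁ W₂) :=
  tauQ 𝒱 M₁ M₂ z (v ⊗ₜ ratElt z 0 n)

/-- The operators `L'_{Q(z)}(j)`, `j = -1, 0, 1`, in the Möbius case:
`(L'(j)λ)(w₁ ⊗ w₂) = ∑_{i=0}^{j+1} binom(j+1,i) (-z)^i λ(L(i-j)w₁ ⊗ w₂)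
  - ∑_{i=0}^{j+1} binom(j+1,i) (-z)^i λ(w₁ ⊗ L(j-i)w₂)`. -/
def LQ (ρ₁ : Sl2Rep W₁) (ρ₂ : Sl2Rep W₂) (z : ℂ) (j : ℤ) : Module.End ℂ (TensorDual W₁ W₂) :=
  (∑ i ∈ Finset.range ((j + 1).toNat + 1),
      (((j + 1).toNat.choose i : ℂ) * (-z) ^ i) • dualLeft W₁ W₂ (ρ₁.L (i - j)))
    - ∑ i ∈ Finset.range ((j + 1).toNat + 1),
      (((j + 1).toNat.choose i : ℂ) * (-z) ^ i) • dualRight W₁ W₂ (ρ₂.L (j - i))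

/-- The space `COMP_{Q(z)}((W₁ ⊗ W₂)*)` of functionals `λ` satisfying the `Q(z)`-compatibility
condition: (a) for all `v`, `Y'_{Q(z)}(v, x)λ` involves only finitely many negative powers of `x`;
(b) `τ_{Q(z)}(z⁻¹δ((x₁-x₀)/z) Y_t(v,x₀))λ = z⁻¹δ((x₁-x₀)/z) Y'_{Q(z)}(v,x₀)λ` for all `v`.
By `z⁻¹δ((x₁-x₀)/z) = x₁⁻¹δ((z+x₀)/x₁) = ∑_m (z+x₀)^m x₁^{-m-1}` (expanded in nonnegative powers
of `x₀`), the coefficients of `x₀^{-n-1} x₁^{-m-1}` on the two sides of (b) are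
`τ_{Q(z)}(v ⊗ (z+t)^m t^n)λ` and `∑_{i ≥ 0} binom(m,i) z^{m-i} τ_{Q(z)}(v ⊗ t^{n+i})λ`, a finite
sum by (a). -/
def compQ (𝒱 : MobiusVertexAlgebra A V) (M₁ : GradedModule 𝒱.toGradedVertexAlgebra W₁)
    (M₂ : GradedModule 𝒱.toGradedVertexAlgebra W₂) (z : ℂ) :
    Submodule ℂ (TensorDual W₁ W₂) where
  carrier := {lam |
    (∀ v, ∃ N : ℤ, ∀ n ≥ N, modeQ 𝒱 M₁ M₂ z v n lam = 0) ∧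
    ∀ (v : V) (m n : ℤ), tauQ 𝒱 M₁ M₂ z (v ⊗ₜ ratElt z m n) lam =
      ∑ᶠ i : ℕ, (((Ring.choose m i : ℤ) : ℂ) * z ^ (m - i)) • modeQ 𝒱 M₁ M₂ z v (n + i) lam}
  zero_mem' := by simp
  add_mem' := by
    rintro lam mu ⟨ha, hb⟩ ⟨ha', hb'⟩
    refine ⟨fun v => ?_, fun v m n => ?_⟩
    · obtain ⟨N, hN⟩ := ha v
      obtain ⟨N', hN'⟩ := ha' v
      refine ⟨max N N', fun n hn => ?_⟩
      rw [map_add, hN n (le_trans (le_max_left _ _) hn), hN' n (le_trans (le_max_right _ _) hn),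
        add_zero]
    · have fin : ∀ nu : TensorDual W₁ W₂, (∀ v, ∃ N : ℤ, ∀ n ≥ N, modeQ 𝒱 M₁ M₂ z v n nu = 0) →
          (Function.support fun i : ℕ => (((Ring.choose m i : ℤ) : ℂ) * z ^ (m - i)) •
            modeQ 𝒱 M₁ M₂ z v (n + i) nu).Finite := by
        intro nu h
        obtain ⟨N, hN⟩ := h v
        refine (Set.finite_Iio (N - n).toNat).subset fun i hi => ?_
        by_contra hc
        refine hi ?_
        rw [Set.mem_Iio] at hc
        simp only [hN (n + i) (by omega), smul_zero]
      rw [map_add, hb, hb', ← finsum_add_distrib (fin lam ha) (fin mu ha')]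
      simp
  smul_mem' := by
    rintro a lam ⟨ha, hb⟩
    refine ⟨fun v => ?_, fun v m n => ?_⟩
    · obtain ⟨N, hN⟩ := ha v
      exact ⟨N, fun n hn => by rw [map_smul, hN n hn, smul_zero]⟩
    · rw [map_smul, hb, smul_finsum]
      exact finsum_congr fun i => by rw [map_smul, smul_comm]

end TauQ

/-! ### Doubly graded subspaces -/

section Pieces

variable {ι : Type*} {D : Type*} [AddCommGroup D] [Module ℂ D]

/-- A subspace `M` of `∐ Pᵢ` is graded if `M = ∐ (M ∩ Pᵢ)`. -/
def IsGradedSubspace (P : ι → Submodule ℂ D) (M : Submodule ℂ D) : Prop :=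
  M = ⨆ i, M ⊓ P i

theorem inf_piece {P : ι → Submodule ℂ D} (hP : iSupIndep P) {Q : ι → Submodule ℂ D}
    (hQ : Q ≤ P) (i : ι) : (⨆ j, Q j) ⊓ P i = Q i := by
  refine le_antisymm ?_ (le_inf (le_iSup Q i) (hQ i))
  rintro x ⟨hx, hxi⟩
  have hle : (⨆ j, Q j) ≤ Q i ⊔ ⨆ (j) (_ : j ≠ i), P j := by
    refine iSup_le fun j => ?_
    by_cases hj : j = i
    · subst hj; exact le_sup_left
    · exact le_sup_of_le_right (le_iSup₂_of_le j hj (hQ j))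
  obtain ⟨q, hq, r, hr, rfl⟩ := Submodule.mem_sup.1 (hle hx)
  have hrP : r ∈ P i := by simpa using sub_mem hxi (hQ i hq)
  have : r = 0 := Submodule.disjoint_def.1 (hP i) r hrP hr
  simpa [this] using hq

theorem IsGradedSubspace.sup_inf {P : ι → Submodule ℂ D} (hP : iSupIndep P)
    {M N : Submodule ℂ D} (hM : IsGradedSubspace P M) (hN : IsGradedSubspace P N) (i : ι) :
    (M ⊔ N) ⊓ P i = (M ⊓ P i) ⊔ (N ⊓ P i) := by
  have e : M ⊔ N = ⨆ j, (M ⊓ P j) ⊔ (N ⊓ P j) := by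
    rw [iSup_sup_eq, ← hM, ← hN]
  rw [e]
  exact inf_piece hP (fun j => sup_le inf_le_right inf_le_right) i

theorem IsGradedSubspace.sup {P : ι → Submodule ℂ D} {M N : Submodule ℂ D}
    (hM : IsGradedSubspace P M) (hN : IsGradedSubspace P N) : IsGradedSubspace P (M ⊔ N) := by
  refine le_antisymm ?_ (iSup_le fun i => inf_le_left)
  refine sup_le ?_ ?_
  · conv_lhs => rw [hM]
    exact iSup_mono fun i => inf_le_inf_right _ le_sup_left
  · conv_lhs => rw [hN]
    exact iSup_mono fun i => inf_le_inf_right _ le_sup_right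

theorem piece_unique {P : ι → Submodule ℂ D} (hP : iSupIndep P) {f g : ι →₀ D}
    (hf : ∀ i, f i ∈ P i) (hg : ∀ i, g i ∈ P i)
    (h : (f.sum fun _ x => x) = g.sum fun _ x => x) : f = g := by
  classical
  ext i
  have hs : ∀ k : ι →₀ D, k.support ⊆ f.support ∪ g.support →
      (k.sum fun _ x => x) = ∑ j ∈ f.support ∪ g.support, k j := fun k hk =>
    Finsupp.sum_of_support_subset k hk _ (fun _ _ => rfl)
  rw [hs f Finset.subset_union_left, hs g Finset.subset_union_right] at h
  by_cases hi : i ∈ f.support ∪ g.support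
  · exact (iSupIndep_iff_finsetSum_eq_imp_eq P).1 hP _ f g (fun j _ => ⟨hf j, hg j⟩) h i hi
  · simp only [Finset.mem_union, Finsupp.mem_support_iff, not_or, not_not] at hi
    rw [hi.1, hi.2]

theorem IsGradedSubspace.sInf_mem {P : ι → Submodule ℂ D} (hP : iSupIndep P)
    {F : Set (Submodule ℂ D)} (hne : F.Nonempty) (hF : ∀ M ∈ F, IsGradedSubspace P M) :
    IsGradedSubspace P (sInf F) := by
  refine le_antisymm ?_ (iSup_le fun i => inf_le_left)
  intro x hx
  have comp : ∀ M ∈ F, ∃ f : ι →₀ D, (∀ i, f i ∈ M ⊓ P i) ∧ (f.sum fun _ y => y) = x := by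
    intro M hM
    rw [← Submodule.mem_iSup_iff_exists_finsupp, ← hF M hM]
    exact Submodule.mem_sInf.1 hx M hM
  obtain ⟨M₀, hM₀⟩ := hne
  obtain ⟨f, hf, hfx⟩ := comp M₀ hM₀
  rw [Submodule.mem_iSup_iff_exists_finsupp]
  refine ⟨f, fun i => ⟨Submodule.mem_sInf.2 fun M hM => ?_, (hf i).2⟩, hfx⟩
  obtain ⟨g, hg, hgx⟩ := comp M hM
  rw [piece_unique hP (fun j => (hf j).2) (fun j => (hg j).2) (hfx.trans hgx.symm)]
  exact (hg i).1

/-- The family of graded subspaces of `∐ Pᵢ` that contain `x` and are stable under all operators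
in `S`. -/
def stableFamily (P : ι → Submodule ℂ D) (S : Set (Module.End ℂ D)) (x : D) :
    Set (Submodule ℂ D) :=
  {M | IsGradedSubspace P M ∧ x ∈ M ∧ ∀ T ∈ S, ∀ y ∈ M, T y ∈ M}

/-- The smallest graded subspace of `∐ Pᵢ` that contains `x` and is stable under all operators in
`S`. -/
def smallestStable (P : ι → Submodule ℂ D) (S : Set (Module.End ℂ D)) (x : D) : Submodule ℂ D :=
  sInf (stableFamily P S x)

theorem smallestStable_add {P : ι → Submodule ℂ D} (hP : iSupIndep P) (S : Set (Module.End ℂ D))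
    (x y : D) (i : ι) : smallestStable P S (x + y) ⊓ P i ≤
      (smallestStable P S x ⊓ P i) ⊔ (smallestStable P S y ⊓ P i) := by
  rcases (stableFamily P S x).eq_empty_or_nonempty with hx | hx
  · refine le_sup_of_le_left (inf_le_inf_right _ ?_)
    simp [smallestStable, hx]
  rcases (stableFamily P S y).eq_empty_or_nonempty with hy | hy
  · refine le_sup_of_le_right (inf_le_inf_right _ ?_)
    simp [smallestStable, hy]
  have gx : IsGradedSubspace P (smallestStable P S x) :=
    IsGradedSubspace.sInf_mem hP hx fun M hM => hM.1
  have gy : IsGradedSubspace P (smallestStable P S y) :=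
    IsGradedSubspace.sInf_mem hP hy fun M hM => hM.1
  rw [← gx.sup_inf hP gy]
  refine inf_le_inf_right _ (sInf_le ⟨gx.sup gy, ?_, ?_⟩)
  · exact Submodule.add_mem_sup (Submodule.mem_sInf.2 fun M hM => hM.2.1)
      (Submodule.mem_sInf.2 fun M hM => hM.2.1)
  · intro T hT u hu
    obtain ⟨a, ha, b, hb, rfl⟩ := Submodule.mem_sup.1 hu
    rw [map_add]
    exact Submodule.add_mem_sup
      (Submodule.mem_sInf.2 fun M hM => hM.2.2 T hT a (Submodule.mem_sInf.1 ha M hM))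
      (Submodule.mem_sInf.2 fun M hM => hM.2.2 T hT b (Submodule.mem_sInf.1 hb M hM))

/-- For a family `P` of independent subspaces indexed by `ℂ × B` and a set `S` of operators, the
space of all `x` such that (a) `x ∈ ∐ P(n,β)`, and (b) the smallest graded subspace `M` of
`∐ P(n,β)` containing `x` and stable under `S` satisfies `dim M ∩ P(n,β) < ∞` for all `n, β` and
`M ∩ P(n+k,β) = 0` for `k ∈ ℤ` sufficiently negative. -/
def gradingRestricted {B : Type*} (P : ℂ × B → Submodule ℂ D) (hP : iSupIndep P)
    (S : Set (Module.End ℂ D)) : Submodule ℂ D where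
  carrier := {x | x ∈ ⨆ i, P i ∧
    (∀ n β, FiniteDimensional ℂ ↥(smallestStable P S x ⊓ P (n, β))) ∧
    ∀ n β, ∃ K : ℤ, ∀ k ≤ K, smallestStable P S x ⊓ P (n + k, β) = ⊥}
  zero_mem' := by
    have h0 : smallestStable P S 0 = ⊥ :=
      le_bot_iff.1 (sInf_le ⟨by simp [IsGradedSubspace], by simp, fun T _ y hy => by simp_all⟩)
    refine ⟨zero_mem _, fun n β => ?_, fun n β => ⟨0, fun k _ => by rw [h0, bot_inf_eq]⟩⟩
    rw [h0, bot_inf_eq]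
    infer_instance
  add_mem' := by
    rintro x y ⟨hx, fx, bx⟩ ⟨hy, fy, by'⟩
    refine ⟨add_mem hx hy, fun n β => ?_, fun n β => ?_⟩
    · have := fx n β
      have := fy n β
      exact Submodule.finiteDimensional_of_le (smallestStable_add hP S x y (n, β))
    · obtain ⟨K, hK⟩ := bx n β
      obtain ⟨K', hK'⟩ := by' n β
      refine ⟨min K K', fun k hk => le_bot_iff.1 ?_⟩
      have h := smallestStable_add hP S x y (n + k, β)
      rwa [hK k (hk.trans (min_le_left _ _)), hK' k (hk.trans (min_le_right _ _)), sup_bot_eq] at h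
  smul_mem' := by
    rintro a x ⟨hx, fx, bx⟩
    have hle : smallestStable P S (a • x) ≤ smallestStable P S x :=
      sInf_le_sInf fun M hM => ⟨hM.1, M.smul_mem a hM.2.1, hM.2.2⟩
    refine ⟨Submodule.smul_mem _ a hx, fun n β => ?_, fun n β => ?_⟩
    · have := fx n β
      exact Submodule.finiteDimensional_of_le (inf_le_inf_right _ hle)
    · obtain ⟨K, hK⟩ := bx n β
      refine ⟨K, fun k hk => le_bot_iff.1 ?_⟩
      rw [← hK k hk]
      exact inf_le_inf_right _ hle

/-- If `H` and `E` are independent families of subspaces, so is `(n, β) ↦ E n ∩ H β`. -/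
theorem iSupIndep_inf {B : Type*} {E : ℂ → Submodule ℂ D} {H : B → Submodule ℂ D}
    (hE : iSupIndep E) (hH : iSupIndep H) : iSupIndep fun p : ℂ × B => H p.2 ⊓ E p.1 := by
  classical
  rw [iSupIndep_iff_finsetSum_eq_zero_imp_eq_zero]
  intro s v hv h0 p hp
  have h1 : ∀ β ∈ s.image Prod.snd, ∑ q ∈ s with q.2 = β, v q = 0 := by
    refine (iSupIndep_iff_finsetSum_eq_zero_imp_eq_zero H).1 hH _ _ (fun β _ => ?_) ?_
    · refine sum_mem fun q hq => ?_
      rw [Finset.mem_filter] at hq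
      rw [← hq.2]
      exact (hv q hq.1).1
    · rw [← h0]
      exact Finset.sum_fiberwise_of_maps_to (fun q hq => Finset.mem_image_of_mem _ hq) v
  have h2 := h1 p.2 (Finset.mem_image_of_mem _ hp)
  have h3 : ∑ n ∈ (s.filter fun q => q.2 = p.2).image Prod.fst, v (n, p.2) = 0 := by
    rw [Finset.sum_image, ← h2]
    · refine Finset.sum_congr rfl fun q hq => ?_
      rw [← (Finset.mem_filter.1 hq).2]
    · intro q hq q' hq' e
      simp only [Finset.coe_filter, Set.mem_ofPred_eq] at hq hq'
      exact Prod.ext e (hq.2.trans hq'.2.symm)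
  refine (iSupIndep_iff_finsetSum_eq_zero_imp_eq_zero E).1 hE _ (fun n => v (n, p.2)) ?_ h3 p.1
    (Finset.mem_image_of_mem _ (Finset.mem_filter.2 ⟨hp, rfl⟩))
  intro n hn
  obtain ⟨q, hq, rfl⟩ := Finset.mem_image.1 hn
  obtain ⟨hq, e⟩ := Finset.mem_filter.1 hq
  rw [← e]
  exact (hv q hq).2

end Pieces

/-! ### The grading of `(W₁ ⊗ W₂)*` and the local grading restriction conditions -/

section LGR

variable {B : Type*} [AddCommGroup B] {W₁ W₂ : Type*} [AddCommGroup W₁] [Module ℂ W₁]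
  [AddCommGroup W₂] [Module ℂ W₂]

/-- `(W₁ ⊗ W₂)^(γ)`, spanned by the `w₁ ⊗ w₂` with `w₁ ∈ W₁^(β₁)`, `w₂ ∈ W₂^(β₂)`,
`β₁ + β₂ = γ`. -/
def tensorGr (gr₁ : B → Submodule ℂ W₁) (gr₂ : B → Submodule ℂ W₂) (γ : B) :
    Submodule ℂ (W₁ ⊗[ℂ] W₂) :=
  Submodule.span ℂ {w | ∃ β₁ β₂ : B, β₁ + β₂ = γ ∧ ∃ w₁ ∈ gr₁ β₁, ∃ w₂ ∈ gr₂ β₂, w = w₁ ⊗ₜ w₂}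

/-- `((W₁ ⊗ W₂)*)^(β)`: the functionals vanishing on `(W₁ ⊗ W₂)^(γ)` for all `γ ≠ -β`. -/
def dualGr (gr₁ : B → Submodule ℂ W₁) (gr₂ : B → Submodule ℂ W₂) (β : B) :
    Submodule ℂ (TensorDual W₁ W₂) where
  carrier := {lam | ∀ γ ≠ -β, ∀ w ∈ tensorGr gr₁ gr₂ γ, lam w = 0}
  zero_mem' := by simp
  add_mem' ha hb γ hγ w hw := by simp [ha γ hγ w hw, hb γ hγ w hw]
  smul_mem' a lam h γ hγ w hw := by simp [h γ hγ w hw]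

theorem iSup_tensorGr {gr₁ : B → Submodule ℂ W₁} {gr₂ : B → Submodule ℂ W₂}
    (h₁ : ⨆ β, gr₁ β = ⊤) (h₂ : ⨆ β, gr₂ β = ⊤) : ⨆ γ, tensorGr gr₁ gr₂ γ = ⊤ := by
  rw [eq_top_iff]
  rintro w -
  induction w using TensorProduct.induction_on with
  | zero => exact zero_mem _
  | add x y hx hy => exact add_mem hx hy
  | tmul w₁ w₂ =>
    have a₁ : w₁ ∈ ⨆ β, gr₁ β := h₁ ▸ Submodule.mem_top
    have a₂ : w₂ ∈ ⨆ β, gr₂ β := h₂ ▸ Submodule.mem_top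
    induction a₁ using Submodule.iSup_induction' with
    | zero => simp
    | add x y _ _ hx hy => rw [TensorProduct.add_tmul]; exact add_mem hx hy
    | mem β₁ x hx =>
      induction a₂ using Submodule.iSup_induction' with
      | zero => simp
      | add u v _ _ hu hv => rw [TensorProduct.tmul_add]; exact add_mem hu hv
      | mem β₂ u hu =>
        exact Submodule.mem_iSup_of_mem (β₁ + β₂)
          (Submodule.subset_span ⟨β₁, β₂, rfl, x, hx, u, hu, rfl⟩)

theorem iSupIndep_dualGr {gr₁ : B → Submodule ℂ W₁} {gr₂ : B → Submodule ℂ W₂}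
    (h₁ : ⨆ β, gr₁ β = ⊤) (h₂ : ⨆ β, gr₂ β = ⊤) : iSupIndep (dualGr gr₁ gr₂) := by
  rw [iSupIndep_iff_finsetSum_eq_zero_imp_eq_zero]
  intro s v hv h0 β hβ
  have hker : (⊤ : Submodule ℂ (W₁ ⊗[ℂ] W₂)) ≤ LinearMap.ker (v β) := by
    rw [← iSup_tensorGr h₁ h₂]
    refine iSup_le fun γ w hw => ?_
    rw [LinearMap.mem_ker]
    by_cases hγ : γ = -β
    · have h := LinearMap.congr_fun h0 w
      rw [LinearMap.sum_apply, LinearMap.zero_apply, Finset.sum_eq_single β] at h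
      · exact h
      · intro β' hβ' hne
        exact hv β' hβ' γ (by rw [hγ]; exact fun e => hne (neg_injective e).symm) w hw
      · exact fun h => absurd hβ h
    · exact hv β hβ γ hγ w hw
  exact LinearMap.ext fun w => hker Submodule.mem_top

variable {A : AddSubgroup B} {V : Type*} [AddCommGroup V] [Module ℂ V]
  {𝒱 : GradedVertexAlgebra A V}

/-- The generalized eigenspaces `((W₁ ⊗ W₂)*)_[n]^(β)` of an operator `L₀` (which will be
`L'_{Q(z)}(0)`). -/
def genPiece (M₁ : GradedModule 𝒱 W₁) (M₂ : GradedModule 𝒱 W₂)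
    (L₀ : Module.End ℂ (TensorDual W₁ W₂)) (p : ℂ × B) : Submodule ℂ (TensorDual W₁ W₂) :=
  dualGr M₁.gr M₂.gr p.2 ⊓ L₀.maxGenEigenspace p.1

/-- The eigenspaces `((W₁ ⊗ W₂)*)_(n)^(β)` of an operator `L₀` (which will be `L'_{Q(z)}(0)`). -/
def ordPiece (M₁ : GradedModule 𝒱 W₁) (M₂ : GradedModule 𝒱 W₂)
    (L₀ : Module.End ℂ (TensorDual W₁ W₂)) (p : ℂ × B) : Submodule ℂ (TensorDual W₁ W₂) :=
  dualGr M₁.gr M₂.gr p.2 ⊓ L₀.eigenspace p.1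

theorem iSupIndep_genPiece (M₁ : GradedModule 𝒱 W₁) (M₂ : GradedModule 𝒱 W₂)
    (L₀ : Module.End ℂ (TensorDual W₁ W₂)) : iSupIndep (genPiece M₁ M₂ L₀) :=
  iSupIndep_inf L₀.independent_maxGenEigenspace (iSupIndep_dualGr M₁.gr_span M₂.gr_span)

theorem iSupIndep_ordPiece (M₁ : GradedModule 𝒱 W₁) (M₂ : GradedModule 𝒱 W₂)
    (L₀ : Module.End ℂ (TensorDual W₁ W₂)) : iSupIndep (ordPiece M₁ M₂ L₀) :=
  iSupIndep_inf L₀.eigenspaces_iSupIndep (iSupIndep_dualGr M₁.gr_span M₂.gr_span)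

end LGR

section LGRQ

variable {B : Type*} [AddCommGroup B] {A : AddSubgroup B}
  {V W₁ W₂ : Type*} [AddCommGroup V] [Module ℂ V] [AddCommGroup W₁] [Module ℂ W₁]
  [AddCommGroup W₂] [Module ℂ W₂]

/-- The operators `τ_{Q(z)}(v ⊗ t^m)`, `v ∈ V`, `m ∈ ℤ`, together with given operators `L'(j)`,
`j = -1, 0, 1`. -/
def operatorsQ (𝒱 : MobiusVertexAlgebra A V) (M₁ : GradedModule 𝒱.toGradedVertexAlgebra W₁)
    (M₂ : GradedModule 𝒱.toGradedVertexAlgebra W₂) (z : ℂ)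
    (L' : ℤ → Module.End ℂ (TensorDual W₁ W₂)) : Set (Module.End ℂ (TensorDual W₁ W₂)) :=
  {T | (∃ v m, T = modeQ 𝒱 M₁ M₂ z v m) ∨ T = L' (-1) ∨ T = L' 0 ∨ T = L' 1}

/-- `LGR_{[ℂ];Q(z)}((W₁ ⊗ W₂)*)`: the functionals satisfying the `Q(z)`-local grading restriction
condition, where `L'(j)` are the operators `L'_{Q(z)}(j)`. -/
def lgrGen (𝒱 : MobiusVertexAlgebra A V) (M₁ : GradedModule 𝒱.toGradedVertexAlgebra W₁)
    (M₂ : GradedModule 𝒱.toGradedVertexAlgebra W₂) (z : ℂ)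
    (L' : ℤ → Module.End ℂ (TensorDual W₁ W₂)) : Submodule ℂ (TensorDual W₁ W₂) :=
  gradingRestricted (genPiece M₁ M₂ (L' 0)) (iSupIndep_genPiece M₁ M₂ (L' 0))
    (operatorsQ 𝒱 M₁ M₂ z L')

/-- `LGR_{(ℂ);Q(z)}((W₁ ⊗ W₂)*)`: the functionals satisfying the `L(0)`-semisimple `Q(z)`-local
grading restriction condition, where `L'(j)` are the operators `L'_{Q(z)}(j)`. -/
def lgrOrd (𝒱 : MobiusVertexAlgebra A V) (M₁ : GradedModule 𝒱.toGradedVertexAlgebra W₁)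
    (M₂ : GradedModule 𝒱.toGradedVertexAlgebra W₂) (z : ℂ)
    (L' : ℤ → Module.End ℂ (TensorDual W₁ W₂)) : Submodule ℂ (TensorDual W₁ W₂) :=
  gradingRestricted (ordPiece M₁ M₂ (L' 0)) (iSupIndep_ordPiece M₁ M₂ (L' 0))
    (operatorsQ 𝒱 M₁ M₂ z L')

/-- The subspace `X` of `(W₁ ⊗ W₂)*` is stable under all `τ_{Q(z)}(v ⊗ tⁿ)`, `v ∈ V`, `n ∈ ℤ`,
and under `L'(-1)`, `L'(0)`, `L'(1)`. -/
def IsStableQ (𝒱 : MobiusVertexAlgebra A V) (M₁ : GradedModule 𝒱.toGradedVertexAlgebra W₁)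
    (M₂ : GradedModule 𝒱.toGradedVertexAlgebra W₂) (z : ℂ)
    (L' : ℤ → Module.End ℂ (TensorDual W₁ W₂)) (X : Submodule ℂ (TensorDual W₁ W₂)) : Prop :=
  (∀ (v : V) (n : ℤ), ∀ lam ∈ X, modeQ 𝒱 M₁ M₂ z v n lam ∈ X) ∧
  ∀ j ∈ ({-1, 0, 1} : Set ℤ), ∀ lam ∈ X, L' j lam ∈ X

/-- In the conformal case, `Y'_{Q(z)}(ω, x) = ∑ L'_{Q(z)}(j) x^{-j-2}`, that is,
`L'_{Q(z)}(j) = τ_{Q(z)}(ω ⊗ t^{j+1})`. -/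
def LQConformal (𝒱 : ConformalVertexAlgebra A V) (M₁ : GradedModule 𝒱.toGradedVertexAlgebra W₁)
    (M₂ : GradedModule 𝒱.toGradedVertexAlgebra W₂) (z : ℂ) (j : ℤ) :
    Module.End ℂ (TensorDual W₁ W₂) :=
  modeQ 𝒱.toMobius M₁ M₂ z 𝒱.ω (j + 1)

end LGRQ

end

end LogTensor

namespace LogTensor

noncomputable section

/-! ### Continuous linear maps on Laurent series -/

section Series

variable {W : Type*} [AddCommGroup W] [Module ℂ W]

/-! Everything follows from commutator formulas. The vertex operators on `W₂` make `V ⊗ ℂ((t))` act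
by `serPlus`, and the opposite ones on `W₁` make `V ⊗ ℂ((t⁻¹))` act by `serMinus`. In both cases the
bracket of `u ⊗ f` and `v ⊗ g` is `ε ∑ᵢ (uᵢv) ⊗ (Dᵢf) g`, with `Dᵢ` the Hasse derivatives and `ε =
1`, respectively `ε = -1`. For monomials on `W₂` this is the Jacobi identity. On `W₁` it is the main
computation (`serMinus_commutator_of_mem`): powers of `L(1)` are moved past modes, and the
coefficients match by Vandermonde's identity. Continuity extends both formulas to all Laurent
series, in particular to the expansions of `(t - z)^k`, where `Dᵢ (t - z)^k = binom(k,i) (t -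
z)^{k-i}` (`hasse_zpow`).

Passing to the dual turns the antihomomorphism on `W₁` and the homomorphism on `W₂` into a single
homomorphism (`dualDiff_lie`). Hence the bracket of `τ(u ⊗ t^k)` with `τ(v ⊗ g)` is the finite sum
of the `binom(k,i) τ(uᵢv ⊗ t^{k-i} g)`, for every rational `g` (`modeQ_lie_tauQ`). The brackets of
`L'(j)` with `τ(v ⊗ g)` have the same shape.

For `COMP`, the bracket of the given operator `T` with `τ(v ⊗ g)` is thus a sum of terms `τ(xᵢ ⊗
t^{eᵢ} g)` with `xᵢ`, `eᵢ` independent of `g`. Taking `g = (z+t)^m t^n` only shifts `n`, so both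
compatibility conditions pass from `λ` to `Tλ` (`compQ_stable`). For the two `LGR` spaces, the
subspace generated by `Tλ` lies in the one generated by `λ`, so only `Tλ ∈ ∐ P` needs proof. This
holds because the operators shift both the `L'(0)`-eigenvalue and the `B`-degree
(`operatorsQ_mem_iSup`).

In the conformal case `L(1)ω = 0`, so `ω` has a one-term opposite vector and `τ(ω ⊗ t^{j+1})` is the
Möbius `L'(j)` (`LQConformal_eq_LQ`). -/

theorem mul_smul_series (a : ℂ) (f g : LaurentSeries ℂ) : f * (a • g) = a • (f * g) := by
  rw [← HahnSeries.C_mul_eq_smul, ← HahnSeries.C_mul_eq_smul, mul_left_comm]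

/-- A linear map from `ℂ((t))` to `End W` that is continuous for the `t`-adic topology on `ℂ((t))`
and the topology of pointwise convergence on `End W`, where `W` is discrete. -/
structure IsSeriesMap (Φ : LaurentSeries ℂ → Module.End ℂ W) : Prop where
  map_add : ∀ f g, Φ (f + g) = Φ f + Φ g
  map_smul : ∀ (a : ℂ) f, Φ (a • f) = a • Φ f
  cont : ∀ w, ∃ N : ℤ, ∀ f : LaurentSeries ℂ, (∀ n < N, f.coeff n = 0) → Φ f w = 0

namespace IsSeriesMap

variable {Φ Ψ : LaurentSeries ℂ → Module.End ℂ W}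

theorem add (hΦ : IsSeriesMap Φ) (hΨ : IsSeriesMap Ψ) : IsSeriesMap fun f => Φ f + Ψ f where
  map_add f g := by rw [hΦ.map_add, hΨ.map_add]; abel
  map_smul a f := by rw [hΦ.map_smul, hΨ.map_smul, smul_add]
  cont w := by
    obtain ⟨N, hN⟩ := hΦ.cont w
    obtain ⟨N', hN'⟩ := hΨ.cont w
    refine ⟨max N N', fun f hf => ?_⟩
    rw [LinearMap.add_apply, hN f fun n hn => hf n (lt_max_of_lt_left hn),
      hN' f fun n hn => hf n (lt_max_of_lt_right hn), add_zero]

theorem smul (a : ℂ) (hΦ : IsSeriesMap Φ) : IsSeriesMap fun f => a • Φ f where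
  map_add f g := by rw [hΦ.map_add, smul_add]
  map_smul b f := by rw [hΦ.map_smul, smul_comm]
  cont w := by
    obtain ⟨N, hN⟩ := hΦ.cont w
    exact ⟨N, fun f hf => by rw [LinearMap.smul_apply, hN f hf, smul_zero]⟩

theorem zero : IsSeriesMap fun _ => (0 : Module.End ℂ W) where
  map_add _ _ := (add_zero 0).symm
  map_smul a _ := (smul_zero a).symm
  cont _ := ⟨0, fun _ _ => rfl⟩

theorem neg (hΦ : IsSeriesMap Φ) : IsSeriesMap fun f => -Φ f := by
  simpa using hΦ.smul (-1)

theorem sub (hΦ : IsSeriesMap Φ) (hΨ : IsSeriesMap Ψ) : IsSeriesMap fun f => Φ f - Ψ f := by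
  simpa [sub_eq_add_neg] using hΦ.add hΨ.neg

theorem sum {ι : Type*} (s : Finset ι) {Φ : ι → LaurentSeries ℂ → Module.End ℂ W}
    (hΦ : ∀ i ∈ s, IsSeriesMap (Φ i)) : IsSeriesMap fun f => ∑ i ∈ s, Φ i f := by
  classical
  induction s using Finset.induction_on with
  | empty => simpa using zero
  | insert i s hi ih =>
    simp only [Finset.sum_insert hi]
    exact (hΦ i (Finset.mem_insert_self _ _)).add
      (ih fun j hj => hΦ j (Finset.mem_insert_of_mem hj))

theorem mul_left (T : Module.End ℂ W) (hΦ : IsSeriesMap Φ) : IsSeriesMap fun f => T * Φ f where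
  map_add f g := by rw [hΦ.map_add, mul_add]
  map_smul a f := by rw [hΦ.map_smul, mul_smul_comm]
  cont w := by
    obtain ⟨N, hN⟩ := hΦ.cont w
    exact ⟨N, fun f hf => by rw [Module.End.mul_apply, hN f hf, map_zero]⟩

theorem mul_right (T : Module.End ℂ W) (hΦ : IsSeriesMap Φ) : IsSeriesMap fun f => Φ f * T where
  map_add f g := by rw [hΦ.map_add, add_mul]
  map_smul a f := by rw [hΦ.map_smul, smul_mul_assoc]
  cont w := by
    obtain ⟨N, hN⟩ := hΦ.cont (T w)
    exact ⟨N, fun f hf => by rw [Module.End.mul_apply, hN f hf]⟩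

theorem lie_left (T : Module.End ℂ W) (hΦ : IsSeriesMap Φ) : IsSeriesMap fun f => ⁅T, Φ f⁆ := by
  simpa only [Ring.lie_def] using (hΦ.mul_left T).sub (hΦ.mul_right T)

theorem lie_right (T : Module.End ℂ W) (hΦ : IsSeriesMap Φ) : IsSeriesMap fun f => ⁅Φ f, T⁆ := by
  simpa only [Ring.lie_def] using (hΦ.mul_right T).sub (hΦ.mul_left T)

/-- Composition with a linear map on Laurent series that shifts orders by a bounded amount. -/
theorem comp (hΦ : IsSeriesMap Φ) (D : LaurentSeries ℂ → LaurentSeries ℂ)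
    (hadd : ∀ f g, D (f + g) = D f + D g) (hsmul : ∀ (a : ℂ) f, D (a • f) = a • D f)
    (k : ℤ) (hD : ∀ (N : ℤ) f, (∀ n < N, f.coeff n = 0) → ∀ n < N + k, (D f).coeff n = 0) :
    IsSeriesMap fun f => Φ (D f) where
  map_add f g := by rw [hadd, hΦ.map_add]
  map_smul a f := by rw [hsmul, hΦ.map_smul]
  cont w := by
    obtain ⟨N, hN⟩ := hΦ.cont w
    exact ⟨N - k, fun f hf => hN _ fun n hn => hD (N - k) f hf n (by omega)⟩

theorem coeff_mul_eq_zero (g f : LaurentSeries ℂ) (N : ℤ) (hf : ∀ n < N, f.coeff n = 0)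
    (n : ℤ) (hn : n < N + g.order) : (g * f).coeff n = 0 := by
  rw [HahnSeries.coeff_mul]
  refine Finset.sum_eq_zero fun x hx => ?_
  rw [Finset.mem_antidiagonal] at hx
  by_cases h : x.1 < g.order
  · rw [HahnSeries.coeff_eq_zero_of_lt_order h, zero_mul]
  · rw [hf x.2 (by omega), mul_zero]

theorem comp_mul (hΦ : IsSeriesMap Φ) (g : LaurentSeries ℂ) : IsSeriesMap fun f => Φ (g * f) :=
  hΦ.comp (fun f => g * f) (mul_add g) (fun a f => mul_smul_series a g f) g.order
    fun N f hf n hn => coeff_mul_eq_zero g f N hf n hn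

theorem comp_mul' (hΦ : IsSeriesMap Φ) (g : LaurentSeries ℂ) :
    IsSeriesMap fun f => Φ (f * g) := by
  simpa only [mul_comm _ g] using hΦ.comp_mul g

theorem map_sum (hΦ : IsSeriesMap Φ) {ι : Type*} (s : Finset ι) (f : ι → LaurentSeries ℂ) :
    Φ (∑ i ∈ s, f i) = ∑ i ∈ s, Φ (f i) :=
  _root_.map_sum (LinearMap.mk ⟨Φ, hΦ.map_add⟩ hΦ.map_smul : LaurentSeries ℂ →ₗ[ℂ] Module.End ℂ W)
    f s

/-- Continuous linear maps agree if they agree on monomials. -/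
theorem ext (hΦ : IsSeriesMap Φ) (hΨ : IsSeriesMap Ψ)
    (h : ∀ n : ℤ, Φ (HahnSeries.single n 1) = Ψ (HahnSeries.single n 1))
    (f : LaurentSeries ℂ) : Φ f = Ψ f := by
  rw [← sub_eq_zero]
  have hd := hΦ.sub hΨ
  ext w
  obtain ⟨N, hN⟩ := hd.cont w
  -- `p` is the part of `f` below the bound `N` of continuity at `w`: the difference of the two maps
  -- kills `f - p` at `w`, and `p` is a finite combination of monomials.
  set p : LaurentSeries ℂ :=
    ∑ n ∈ Finset.Ico f.order N, f.coeff n • (HahnSeries.single n 1 : LaurentSeries ℂ) with hp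
  have hcoeff : ∀ n < N, (f - p).coeff n = 0 := by
    intro n hn
    rw [HahnSeries.coeff_sub, hp, HahnSeries.coeff_sum]
    by_cases ho : n < f.order
    · rw [HahnSeries.coeff_eq_zero_of_lt_order ho, Finset.sum_eq_zero, sub_zero]
      intro m hm
      rw [Finset.mem_Ico] at hm
      rw [HahnSeries.coeff_smul, HahnSeries.coeff_single_of_ne (by omega), smul_zero]
    · rw [Finset.sum_eq_single_of_mem n (Finset.mem_Ico.2 ⟨not_lt.1 ho, hn⟩)]
      · simp
      · intro m _ hm
        rw [HahnSeries.coeff_smul, HahnSeries.coeff_single_of_ne hm.symm, smul_zero]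
  have e : Φ f - Ψ f = (Φ (f - p) - Ψ (f - p)) + (Φ p - Ψ p) := by
    rw [← hd.map_add (f - p) p, sub_add_cancel]
  have e' : Φ p - Ψ p = 0 := by
    rw [hd.map_sum (Finset.Ico f.order N)]
    refine Finset.sum_eq_zero fun n _ => ?_
    rw [hd.map_smul (f.coeff n), h, sub_self, smul_zero]
  rw [e, e', add_zero, hN _ hcoeff, LinearMap.zero_apply]

end IsSeriesMap

/-! ### Hasse derivatives -/

/-- The `i`-th Hasse derivative `(1/i!) (d/dt)^i` on Laurent series in `s`, where `t = s` or
`t = s⁻¹` according to `ε = 1` or `ε = -1`. -/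
def hasse (ε : ℤ) (i : ℕ) (f : LaurentSeries ℂ) : LaurentSeries ℂ :=
  HahnSeries.ofSuppBddBelow
    (fun n => ((Ring.choose (ε * n + i) i : ℤ) : ℂ) * f.coeff (n + ε * i))
    ⟨f.order - ε * i, fun n hn => by
      by_contra h
      exact hn (by
        simp only [HahnSeries.coeff_eq_zero_of_lt_order (show n + ε * i < f.order by omega),
          mul_zero])⟩

theorem hasse_coeff (ε : ℤ) (i : ℕ) (f : LaurentSeries ℂ) (n : ℤ) :
    (hasse ε i f).coeff n =
      ((Ring.choose (ε * n + i) i : ℤ) : ℂ) * f.coeff (n + ε * i) := rfl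

theorem hasse_add (ε : ℤ) (i : ℕ) (f g : LaurentSeries ℂ) :
    hasse ε i (f + g) = hasse ε i f + hasse ε i g := by
  ext n; simp [hasse_coeff, mul_add]

theorem hasse_smul (ε : ℤ) (i : ℕ) (a : ℂ) (f : LaurentSeries ℂ) :
    hasse ε i (a • f) = a • hasse ε i f := by
  ext n; simp [hasse_coeff, mul_left_comm]

theorem hasse_zero (ε : ℤ) (f : LaurentSeries ℂ) : hasse ε 0 f = f := by
  ext n; simp [hasse_coeff]

theorem hasse_monomial {ε : ℤ} (hε : ε * ε = 1) (i : ℕ) (m : ℤ) :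
    hasse ε i (HahnSeries.single (ε * m) 1) =
      ((Ring.choose m i : ℤ) : ℂ) • (HahnSeries.single (ε * (m - i)) 1 : LaurentSeries ℂ) := by
  ext n
  rw [hasse_coeff, HahnSeries.coeff_smul, HahnSeries.coeff_single, HahnSeries.coeff_single]
  by_cases h : n = ε * (m - i)
  · have e : ε * n + i = m := by rw [h, ← mul_assoc, hε]; ring
    rw [if_pos (by rw [h]; ring), if_pos h, e, smul_eq_mul]
  · rw [if_neg fun h' => h (by linarith), if_neg h, mul_zero, smul_zero]

theorem IsSeriesMap.comp_hasse {Φ : LaurentSeries ℂ → Module.End ℂ W} (hΦ : IsSeriesMap Φ)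
    (ε : ℤ) (i : ℕ) : IsSeriesMap fun f => Φ (hasse ε i f) :=
  hΦ.comp _ (hasse_add ε i) (hasse_smul ε i) (-(ε * i)) fun N f hf n hn => by
    rw [hasse_coeff, hf _ (by omega), mul_zero]

/-- `D_{i+1}((t - z) f) = (t - z) D_{i+1} f + D_i f`. -/
theorem hasse_succ_mul {ε : ℤ} (hε : ε * ε = 1) (z : ℂ) (i : ℕ) (f : LaurentSeries ℂ) :
    hasse ε (i + 1) ((HahnSeries.single ε 1 - HahnSeries.C z) * f) =
      (HahnSeries.single ε 1 - HahnSeries.C z) * hasse ε (i + 1) f + hasse ε i f := by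
  ext n
  simp only [sub_mul, HahnSeries.C_mul_eq_smul, hasse_coeff, HahnSeries.coeff_sub,
    HahnSeries.coeff_add, HahnSeries.coeff_smul, HahnSeries.coeff_single_mul, one_mul, smul_eq_mul]
  have e1 : n + ε * ((i + 1 : ℕ) : ℤ) - ε = n + ε * i := by push_cast; ring
  have e2 : n - ε + ε * ((i + 1 : ℕ) : ℤ) = n + ε * i := by push_cast; ring
  have e3 : ε * (n - ε) + ((i + 1 : ℕ) : ℤ) = ε * n + i := by
    push_cast; rw [mul_sub, hε]; ring
  have e4 : ε * n + ((i + 1 : ℕ) : ℤ) = ε * n + i + 1 := by push_cast; ring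
  rw [e1, e2, e3, e4, Ring.choose_succ_succ]
  push_cast
  ring

theorem single_sub_C_ne_zero {ε : ℤ} (hε : ε * ε = 1) (z : ℂ) :
    (HahnSeries.single ε 1 - HahnSeries.C z : LaurentSeries ℂ) ≠ 0 := by
  intro h
  have h1 := congrArg (fun f : LaurentSeries ℂ => f.coeff ε) h
  have : ε ≠ 0 := by rintro rfl; simp at hε
  simp [HahnSeries.C_apply, HahnSeries.coeff_single_of_ne this] at h1

/-- Since `t - z` is linear in `t`, the Leibniz rule `hasse_succ_mul` has only two terms. It and
Pascal's rule give the two sides the same recursion in `k`, which starts at `k = 0` and runs in both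
directions because `t - z` is invertible. -/
theorem hasse_zpow {ε : ℤ} (hε : ε * ε = 1) (z : ℂ) (i : ℕ) (k : ℤ) :
    hasse ε i ((HahnSeries.single ε 1 - HahnSeries.C z) ^ k) =
      ((Ring.choose k i : ℤ) : ℂ) • (HahnSeries.single ε 1 - HahnSeries.C z) ^ (k - i) := by
  set p : LaurentSeries ℂ := HahnSeries.single ε 1 - HahnSeries.C z with hp
  have hp0 : p ≠ 0 := single_sub_C_ne_zero hε z
  induction i generalizing k with
  | zero => simp [hasse_zero]
  | succ i ih =>
    have step : ∀ k : ℤ, hasse ε (i + 1) (p ^ (k + 1)) =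
        p * hasse ε (i + 1) (p ^ k) + ((Ring.choose k i : ℤ) : ℂ) • p ^ (k - i) := by
      intro k
      rw [← ih, ← hasse_succ_mul hε, ← hp, zpow_add_one₀ hp0, mul_comm]
    have pas : ∀ k : ℤ, ((Ring.choose (k + 1) (i + 1) : ℤ) : ℂ) • p ^ (k + 1 - (i + 1 : ℕ)) =
        p * (((Ring.choose k (i + 1) : ℤ) : ℂ) • p ^ (k - (i + 1 : ℕ))) +
          ((Ring.choose k i : ℤ) : ℂ) • p ^ (k - i) := by
      intro k
      have e : p * p ^ (k - (i + 1 : ℕ)) = p ^ (k - i) := by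
        rw [← zpow_one_add₀ hp0]; congr 1; push_cast; ring
      rw [mul_smul_series, e, Ring.choose_succ_succ,
        show k + 1 - ((i + 1 : ℕ) : ℤ) = k - i by push_cast; ring]
      push_cast
      module
    induction k using Int.induction_on with
    | zero =>
      have h1 : (p ^ (0 : ℤ)) = HahnSeries.single (ε * 0) 1 := by simp
      rw [h1, hasse_monomial hε]
      rw [Ring.choose_zero_succ, Int.cast_zero, zero_smul, ← HahnSeries.C_mul_eq_smul,
        HahnSeries.C_zero, zero_mul]
    | succ k ihk => rw [step, ihk, pas]
    -- Downwards, the recursion at `-k - 1` is solved for its lower term by cancelling the factor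
    -- `p`.
    | pred k ihk =>
      have s := step (-k - 1)
      have q := pas (-k - 1)
      rw [sub_add_cancel] at s q
      rw [ihk, q] at s
      exact (mul_left_cancel₀ hp0 (add_right_cancel s)).symm

end Series

/-! ### Actions of `V ⊗ ℂ((t^{±1}))` -/

section Action

/-! ### Bracket identities for endomorphisms. -/

section EndLie

variable {W : Type*} [AddCommGroup W] [Module ℂ W]

theorem end_add_lie (a b c : Module.End ℂ W) : ⁅a + b, c⁆ = ⁅a, c⁆ + ⁅b, c⁆ := by
  simp only [Ring.lie_def, add_mul, mul_add]; abel

theorem end_lie_add (a b c : Module.End ℂ W) : ⁅a, b + c⁆ = ⁅a, b⁆ + ⁅a, c⁆ := by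
  simp only [Ring.lie_def, add_mul, mul_add]; abel

theorem end_sub_lie (a b c : Module.End ℂ W) : ⁅a - b, c⁆ = ⁅a, c⁆ - ⁅b, c⁆ := by
  simp only [Ring.lie_def, sub_mul, mul_sub]; abel

theorem end_lie_sub (a b c : Module.End ℂ W) : ⁅a, b - c⁆ = ⁅a, b⁆ - ⁅a, c⁆ := by
  simp only [Ring.lie_def, sub_mul, mul_sub]; abel

theorem end_smul_lie (x : ℂ) (a b : Module.End ℂ W) : ⁅x • a, b⁆ = x • ⁅a, b⁆ := by
  simp only [Ring.lie_def, smul_mul_assoc, mul_smul_comm, smul_sub]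

theorem end_lie_smul (x : ℂ) (a b : Module.End ℂ W) : ⁅a, x • b⁆ = x • ⁅a, b⁆ := by
  simp only [Ring.lie_def, smul_mul_assoc, mul_smul_comm, smul_sub]

theorem end_lie_sum {ι : Type*} (s : Finset ι) (a : Module.End ℂ W) (b : ι → Module.End ℂ W) :
    ⁅a, ∑ i ∈ s, b i⁆ = ∑ i ∈ s, ⁅a, b i⁆ := by
  simp only [Ring.lie_def, Finset.mul_sum, Finset.sum_mul, Finset.sum_sub_distrib]

theorem end_sum_lie {ι : Type*} (s : Finset ι) (a : ι → Module.End ℂ W) (b : Module.End ℂ W) :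
    ⁅∑ i ∈ s, a i, b⁆ = ∑ i ∈ s, ⁅a i, b⁆ := by
  simp only [Ring.lie_def, Finset.mul_sum, Finset.sum_mul, Finset.sum_sub_distrib]

theorem end_lie_skew (a b : Module.End ℂ W) : -⁅a, b⁆ = ⁅b, a⁆ := by
  simp only [Ring.lie_def, neg_sub]

end EndLie

/-- The monomial `t^n`, where `t = s` or `t = s⁻¹` according to `ε = 1` or `ε = -1`. -/
def tpow (ε n : ℤ) : LaurentSeries ℂ := HahnSeries.single (ε * n) 1

theorem tpow_mul (ε m n : ℤ) : tpow ε m * tpow ε n = tpow ε (m + n) := by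
  rw [tpow, tpow, tpow, HahnSeries.single_mul_single, one_mul, mul_add]

theorem hasse_tpow {ε : ℤ} (hε : ε * ε = 1) (i : ℕ) (m : ℤ) :
    hasse ε i (tpow ε m) = ((Ring.choose m i : ℤ) : ℂ) • tpow ε (m - i) :=
  hasse_monomial hε i m

theorem exists_eq_tpow {ε : ℤ} (hε : ε * ε = 1) (n : ℤ) :
    (HahnSeries.single n 1 : LaurentSeries ℂ) = tpow ε (ε * n) := by
  rw [tpow, ← mul_assoc, hε, one_mul]

theorem IsSeriesMap.ext_tpow {W : Type*} [AddCommGroup W] [Module ℂ W]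
    {Φ Ψ : LaurentSeries ℂ → Module.End ℂ W} {ε : ℤ} (hε : ε * ε = 1) (hΦ : IsSeriesMap Φ)
    (hΨ : IsSeriesMap Ψ) (h : ∀ n : ℤ, Φ (tpow ε n) = Ψ (tpow ε n)) (f : LaurentSeries ℂ) :
    Φ f = Ψ f :=
  hΦ.ext hΨ (fun n => by rw [exists_eq_tpow hε]; exact h _) f

/-- The series `(t - z)^k`. -/
def tsubPow (ε : ℤ) (z : ℂ) (k : ℤ) : LaurentSeries ℂ :=
  (HahnSeries.single ε 1 - HahnSeries.C z) ^ k

variable {A : Type*} [AddCommGroup A] {V W : Type*} [AddCommGroup V] [Module ℂ V]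
  [AddCommGroup W] [Module ℂ W]

/-- A continuous action of `V ⊗ ℂ((t^ε))` on `W`, where `ε = ±1`, which is a homomorphism
(`ε = 1`) or an antihomomorphism (`ε = -1`) for the bracket given by the commutator formula,
compatible with the `𝔰𝔩(2)`-action on `V` by means of the operators `Tneg`, `Tzero`, `Tone`. -/
structure IsSeriesAction (𝒱 : MobiusVertexAlgebra A V)
    (E : V →ₗ[ℂ] LaurentSeries ℂ →ₗ[ℂ] Module.End ℂ W) (ε : ℤ)
    (Tneg Tzero Tone : Module.End ℂ W) : Prop where
  sq : ε * ε = 1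
  series : ∀ v, IsSeriesMap fun f => E v f
  comm : ∀ u v, ∃ N₀ : ℕ, ∀ N ≥ N₀, ∀ m n : ℤ, ⁅E u (tpow ε m), E v (tpow ε n)⁆ =
    (ε : ℂ) • ∑ i ∈ Finset.range N, ((Ring.choose m i : ℤ) : ℂ) •
      E (mode 𝒱.Y u i v) (tpow ε (m + n - i))
  deriv : ∀ v n, E (𝒱.sl2.Lneg v) (tpow ε n) = -(n : ℂ) • E v (tpow ε (n - 1))
  neg : ∀ v n, ⁅Tneg, E v (tpow ε n)⁆ = (ε : ℂ) • E (𝒱.sl2.Lneg v) (tpow ε n)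
  zero : ∀ v n, ⁅Tzero, E v (tpow ε n)⁆ = (ε : ℂ) • (E (𝒱.sl2.Lzero v) (tpow ε n) +
    E (𝒱.sl2.Lneg v) (tpow ε (n + 1)))
  one : ∀ v n, ⁅Tone, E v (tpow ε n)⁆ = (ε : ℂ) • (E (𝒱.sl2.Lone v) (tpow ε n) +
    (2 : ℂ) • E (𝒱.sl2.Lzero v) (tpow ε (n + 1)) + E (𝒱.sl2.Lneg v) (tpow ε (n + 2)))

namespace IsSeriesAction

variable {𝒱 : MobiusVertexAlgebra A V} {E : V →ₗ[ℂ] LaurentSeries ℂ →ₗ[ℂ] Module.End ℂ W}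
  {ε : ℤ} {Tneg Tzero Tone : Module.End ℂ W}

/-- Both sides are linear and continuous in each series separately, so monomials suffice, and there
`hasse_tpow` gives the axiom `comm`. The bound on the number of terms is uniform in `f` and `g`. -/
theorem comm_hasse (h : IsSeriesAction 𝒱 E ε Tneg Tzero Tone) (u v : V) :
    ∃ N₀ : ℕ, ∀ N ≥ N₀, ∀ f g : LaurentSeries ℂ, ⁅E u f, E v g⁆ =
      (ε : ℂ) • ∑ i ∈ Finset.range N, E (mode 𝒱.Y u i v) (hasse ε i f * g) := by
  obtain ⟨N₀, hN₀⟩ := h.comm u v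
  refine ⟨N₀, fun N hN f g => ?_⟩
  refine IsSeriesMap.ext_tpow (Φ := fun g => ⁅E u f, E v g⁆)
    (Ψ := fun g => (ε : ℂ) • ∑ i ∈ Finset.range N, E (mode 𝒱.Y u i v) (hasse ε i f * g))
    h.sq ((h.series v).lie_left _)
    (IsSeriesMap.smul _ (IsSeriesMap.sum _ fun i _ => (h.series _).comp_mul _)) (fun n => ?_) g
  -- The second series has become a monomial; the same argument is now applied to the first.
  refine IsSeriesMap.ext_tpow (Φ := fun f => ⁅E u f, E v (tpow ε n)⁆)
    (Ψ := fun f => (ε : ℂ) • ∑ i ∈ Finset.range N, E (mode 𝒱.Y u i v) (hasse ε i f * tpow ε n))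
    h.sq ((h.series u).lie_right _)
    (IsSeriesMap.smul _ (IsSeriesMap.sum _ fun i _ =>
      ((h.series _).comp_mul' (tpow ε n)).comp_hasse ε i)) (fun m => ?_) f
  rw [hN₀ N hN]
  congr 1
  refine Finset.sum_congr rfl fun i _ => ?_
  rw [hasse_tpow h.sq, mul_comm, mul_smul_series, LinearMap.map_smul, tpow_mul,
    show n + (m - i) = m + n - i by ring]

/-- The powers of `t - z` are closed under Hasse derivatives up to scalars. So the commutator
formula survives the substitution of `t - z` for `t`, in either direction of expansion. -/
theorem comm_tsubPow (h : IsSeriesAction 𝒱 E ε Tneg Tzero Tone) (z : ℂ) (u v : V) :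
    ∃ N₀ : ℕ, ∀ N ≥ N₀, ∀ (k : ℤ) (g : LaurentSeries ℂ), ⁅E u (tsubPow ε z k), E v g⁆ =
      (ε : ℂ) • ∑ i ∈ Finset.range N, ((Ring.choose k i : ℤ) : ℂ) •
        E (mode 𝒱.Y u i v) (tsubPow ε z (k - i) * g) := by
  obtain ⟨N₀, hN₀⟩ := h.comm_hasse u v
  refine ⟨N₀, fun N hN k g => ?_⟩
  rw [hN₀ N hN]
  congr 1
  refine Finset.sum_congr rfl fun i _ => ?_
  rw [tsubPow, hasse_zpow h.sq, mul_comm, mul_smul_series, LinearMap.map_smul, mul_comm]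
  rfl

theorem deriv_tsubPow (h : IsSeriesAction 𝒱 E ε Tneg Tzero Tone) (z : ℂ) (v : V) (k : ℤ) :
    E (𝒱.sl2.Lneg v) (tsubPow ε z k) = -(k : ℂ) • E v (tsubPow ε z (k - 1)) := by
  have key := IsSeriesMap.ext_tpow (Φ := fun f => E (𝒱.sl2.Lneg v) f)
    (Ψ := fun f => -E v (hasse ε 1 f)) h.sq (h.series _) ((h.series v).comp_hasse ε 1).neg
    (fun n => by
      rw [h.deriv, hasse_tpow h.sq, LinearMap.map_smul, neg_smul,
        Ring.choose_one_right, Nat.cast_one])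
    (tsubPow ε z k)
  rw [key, tsubPow, hasse_zpow h.sq, LinearMap.map_smul, neg_smul, Ring.choose_one_right,
    Nat.cast_one]
  rfl

theorem neg_series (h : IsSeriesAction 𝒱 E ε Tneg Tzero Tone) (v : V) (g : LaurentSeries ℂ) :
    ⁅Tneg, E v g⁆ = (ε : ℂ) • E (𝒱.sl2.Lneg v) g :=
  IsSeriesMap.ext_tpow (Φ := fun f => ⁅Tneg, E v f⁆) h.sq ((h.series v).lie_left _)
    ((h.series _).smul _) (h.neg v) g

theorem zero_series (h : IsSeriesAction 𝒱 E ε Tneg Tzero Tone) (v : V) (g : LaurentSeries ℂ) :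
    ⁅Tzero, E v g⁆ = (ε : ℂ) • (E (𝒱.sl2.Lzero v) g + E (𝒱.sl2.Lneg v) (tpow ε 1 * g)) :=
  IsSeriesMap.ext_tpow (Φ := fun f => ⁅Tzero, E v f⁆)
    (Ψ := fun g => (ε : ℂ) • (E (𝒱.sl2.Lzero v) g + E (𝒱.sl2.Lneg v) (tpow ε 1 * g)))
    h.sq ((h.series v).lie_left _)
    (((h.series _).add ((h.series _).comp_mul _)).smul _)
    (fun n => by
      rw [h.zero, tpow_mul, add_comm 1 n]) g

theorem one_series (h : IsSeriesAction 𝒱 E ε Tneg Tzero Tone) (v : V) (g : LaurentSeries ℂ) :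
    ⁅Tone, E v g⁆ = (ε : ℂ) • (E (𝒱.sl2.Lone v) g +
      (2 : ℂ) • E (𝒱.sl2.Lzero v) (tpow ε 1 * g) + E (𝒱.sl2.Lneg v) (tpow ε 2 * g)) :=
  IsSeriesMap.ext_tpow (Φ := fun f => ⁅Tone, E v f⁆)
    (Ψ := fun g => (ε : ℂ) • (E (𝒱.sl2.Lone v) g +
      (2 : ℂ) • E (𝒱.sl2.Lzero v) (tpow ε 1 * g) + E (𝒱.sl2.Lneg v) (tpow ε 2 * g)))
    h.sq ((h.series v).lie_left _)
    ((((h.series _).add (((h.series _).comp_mul _).smul _)).add ((h.series _).comp_mul _)).smul _)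
    (fun n => by
      rw [h.one, tpow_mul, tpow_mul, add_comm 1 n, add_comm 2 n]) g

end IsSeriesAction

/-- Taylor expansion of `t` at `z`. With the one for `t²`, it shows that suitable combinations of
the `T`'s have brackets involving only powers of `t - z`. -/
theorem tpow_one_eq (ε : ℤ) (z : ℂ) : tpow ε 1 = tsubPow ε z 1 + HahnSeries.C z := by
  simp [tpow, tsubPow]

theorem tpow_two_eq (ε : ℤ) (z : ℂ) : tpow ε 2 =
    tsubPow ε z 2 + HahnSeries.C (2 * z) * tsubPow ε z 1 + HahnSeries.C (z ^ 2) := by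
  have h : tpow ε 2 = tpow ε 1 ^ 2 := by rw [sq, tpow_mul]; rfl
  rw [h, tpow_one_eq ε z]
  simp only [tsubPow, zpow_one, map_mul, map_pow, map_ofNat]
  rw [show (2 : ℤ) = ((2 : ℕ) : ℤ) from rfl, zpow_natCast]
  ring

namespace IsSeriesAction

variable {𝒱 : MobiusVertexAlgebra A V} {E : V →ₗ[ℂ] LaurentSeries ℂ →ₗ[ℂ] Module.End ℂ W}
  {ε : ℤ} {Tneg Tzero Tone : Module.End ℂ W}

/-- The commutator of `T(0) - z T(-1)` with the action. -/
theorem zero_tsubPow (h : IsSeriesAction 𝒱 E ε Tneg Tzero Tone) (z : ℂ) (v : V)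
    (g : LaurentSeries ℂ) : ⁅Tzero - z • Tneg, E v g⁆ =
      (ε : ℂ) • (E (𝒱.sl2.Lzero v) g + E (𝒱.sl2.Lneg v) (tsubPow ε z 1 * g)) := by
  rw [end_sub_lie, end_smul_lie, h.zero_series, h.neg_series, tpow_one_eq ε z, add_mul,
    HahnSeries.C_mul_eq_smul, LinearMap.map_add, LinearMap.map_smul]
  module

/-- The commutator of `T(1) - 2 z T(0) + z² T(-1)` with the action. -/
theorem one_tsubPow (h : IsSeriesAction 𝒱 E ε Tneg Tzero Tone) (z : ℂ) (v : V)
    (g : LaurentSeries ℂ) : ⁅Tone - (2 * z) • Tzero + z ^ 2 • Tneg, E v g⁆ =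
      (ε : ℂ) • (E (𝒱.sl2.Lone v) g + (2 : ℂ) • E (𝒱.sl2.Lzero v) (tsubPow ε z 1 * g) +
        E (𝒱.sl2.Lneg v) (tsubPow ε z 2 * g)) := by
  rw [end_add_lie, end_sub_lie, end_smul_lie, end_smul_lie, h.zero_series, h.neg_series,
    h.one_series, tpow_two_eq ε z, tpow_one_eq ε z]
  simp only [add_mul, mul_assoc]
  simp only [HahnSeries.C_mul_eq_smul, LinearMap.map_add, LinearMap.map_smul]
  module

end IsSeriesAction

end Action

/-! ### Modes of vertex operators and the action of `V ⊗ ℂ((t))`. -/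

section Modes

variable {V W : Type*} [AddCommGroup V] [Module ℂ V] [AddCommGroup W] [Module ℂ W]

theorem mode_zero (Y : V →ₗ[ℂ] VertexOperator ℂ W) (n : ℤ) : mode Y 0 n = 0 := by
  simpa using mode_smul Y 0 0 n

theorem mode_sum {ι : Type*} (Y : V →ₗ[ℂ] VertexOperator ℂ W) (s : Finset ι) (v : ι → V)
    (n : ℤ) : mode Y (∑ i ∈ s, v i) n = ∑ i ∈ s, mode Y (v i) n := by
  classical
  induction s using Finset.induction_on with
  | empty => simpa using mode_zero Y n
  | insert i s hi ih => rw [Finset.sum_insert hi, Finset.sum_insert hi, mode_add, ih]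

theorem exists_mode_eq_zero (Y : V →ₗ[ℂ] VertexOperator ℂ W) (v : V) (w : W) :
    ∃ N : ℕ, ∀ n : ℤ, (N : ℤ) ≤ n → mode Y v n w = 0 := by
  refine ⟨(-HahnSeries.order ((HahnModule.of ℂ).symm (Y v w))).toNat, fun n hn => ?_⟩
  exact VertexOperator.ncoeff_eq_zero_of_lt_order (Y v) n w (by omega)

/-- The commutator formula, the case `l = 0` of the Jacobi identity. -/
theorem JacobiIdentity.commutator {YV : V →ₗ[ℂ] VertexOperator ℂ V}
    {YW : V →ₗ[ℂ] VertexOperator ℂ W} (h : JacobiIdentity YV YW) (u v : V) (N : ℕ)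
    (hN : ∀ i : ℕ, N ≤ i → mode YV u i v = 0) (m n : ℤ) :
    ⁅mode YW u m, mode YW v n⁆ = ∑ i ∈ Finset.range N, ((Ring.choose m i : ℤ) : ℂ) •
      mode YW (mode YV u i v) (m + n - i) := by
  ext w
  have h0 := h u v w 0 m n
  have e : ∀ (i : ℕ), i ≠ 0 → (Ring.choose (0 : ℤ) i) = 0 := fun i hi =>
    Ring.choose_zero_pos ℤ (Nat.pos_of_ne_zero hi)
  rw [finsum_eq_single _ 0 (fun i hi => by simp [e i hi]),
    finsum_eq_single _ 0 (fun i hi => by simp [e i hi]),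
    finsum_eq_sum_of_support_subset (s := Finset.range N)] at h0
  · simpa [Ring.lie_def] using h0
  · intro i hi
    by_contra hc
    refine hi ?_
    simp only [zero_add, hN i (by simpa using hc), mode_zero, LinearMap.zero_apply, smul_zero]

theorem tauW_single (Y : V →ₗ[ℂ] VertexOperator ℂ W) (v : V) (n : ℤ) :
    tauW Y (v ⊗ₜ (HahnSeries.single n 1 : LaurentSeries ℂ)) = mode Y v n := by
  ext w
  rw [tauW_tmul, finsum_eq_single _ n]
  · simp
  · intro m hm
    rw [HahnSeries.coeff_single_of_ne hm, zero_smul]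

/-- Continuity is lower truncation: if `vₙ w = 0` for `n ≥ N`, a series starting at `N` or later
annihilates `w`. -/
theorem isSeriesMap_tauW (Y : V →ₗ[ℂ] VertexOperator ℂ W) (v : V) :
    IsSeriesMap fun f : LaurentSeries ℂ => tauW Y (v ⊗ₜ f) where
  map_add f g := by rw [TensorProduct.tmul_add, map_add]
  map_smul a f := by rw [TensorProduct.tmul_smul, map_smul]
  cont w := by
    obtain ⟨N, hN⟩ := exists_mode_eq_zero Y v w
    refine ⟨N, fun f hf => ?_⟩
    rw [tauW_tmul]
    refine (finsum_congr fun n => ?_).trans finsum_zero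
    by_cases hn : n < N
    · rw [hf n hn, zero_smul]
    · rw [hN n (not_lt.1 hn), smul_zero]

/-- `τ_W` as a bilinear map. -/
def serPlus (Y : V →ₗ[ℂ] VertexOperator ℂ W) :
    V →ₗ[ℂ] LaurentSeries ℂ →ₗ[ℂ] Module.End ℂ W :=
  TensorProduct.curry (tauW Y)

variable {A : Type*} [AddCommGroup A]

/-- The case `ε = 1`. On monomials each condition is one of the hypotheses on `Y` or the commutator
formula drawn from the Jacobi identity. -/
theorem isSeriesAction_serPlus (𝒱 : MobiusVertexAlgebra A V) (Y : V →ₗ[ℂ] VertexOperator ℂ W)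
    (ρ : Sl2Rep W) (hJ : JacobiIdentity 𝒱.Y Y) (hρ : Sl2Commutator Y 𝒱.sl2 ρ)
    (hD : DerivativeProperty Y 𝒱.sl2.Lneg) :
    IsSeriesAction 𝒱 (serPlus Y) 1 ρ.Lneg ρ.Lzero ρ.Lone := by
  have e : ∀ v n, serPlus Y v (tpow 1 n) = mode Y v n := fun v n => by
    rw [tpow, one_mul]; exact tauW_single Y v n
  refine ⟨one_mul 1, isSeriesMap_tauW Y, fun u v => ?_, fun v n => ?_, fun v n => ?_,
    fun v n => ?_, fun v n => ?_⟩
  · obtain ⟨N₀, hN₀⟩ := exists_mode_eq_zero 𝒱.Y u v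
    refine ⟨N₀, fun N hN m n => ?_⟩
    simp only [e, Int.cast_one, one_smul]
    exact hJ.commutator u v N (fun i hi => hN₀ i (by omega)) m n
  · rw [e, e, hD]
  · rw [e, e, (hρ v n).1, Int.cast_one, one_smul]
  · rw [e, e, e, (hρ v n).2.1, Int.cast_one, one_smul]
  · rw [e, e, e, e, (hρ v n).2.2, Int.cast_one, one_smul]

end Modes

/-! ### Binomial identities -/

section Binomial

/-- Vandermonde: `∑_{j+r=i} (-1)^j binom(m,j) binom(M-j,r) = binom(M-m,i)`. -/
theorem sum_antidiagonal_choose (m M : ℤ) (i : ℕ) :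
    ∑ x ∈ Finset.HasAntidiagonal.antidiagonal i,
        (-1 : ℤ) ^ x.1 * Ring.choose m x.1 * Ring.choose (M - x.1) x.2 =
      Ring.choose (M - m) i := by
  -- Upper negation `binom(r,n) = (-1)^n binom(n-r-1,n)`, applied to the right side and to the
  -- second factor on the left, reduces the claim to Chu–Vandermonde for the pair `m`, `i - M - 1`.
  have h := Ring.add_choose_eq (r := m) (s := (i : ℤ) - M - 1) i (Commute.all _ _)
  have e : ∀ (r : ℤ) (n : ℕ), Ring.choose r n = (-1) ^ n * Ring.choose (n - r - 1) n := by
    intro r n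
    have := Ring.choose_neg (-r) n
    rw [neg_neg] at this
    rw [this, Int.negOnePow_def]
    rw [show -r + (n : ℤ) - 1 = n - r - 1 by ring]
    simp [Units.smul_def]
  rw [e, show (i : ℤ) - (M - m) - 1 = m + (i - M - 1) by ring, h, Finset.mul_sum]
  refine Finset.sum_congr rfl fun x hx => ?_
  rw [Finset.HasAntidiagonal.mem_antidiagonal] at hx
  rw [e (M - x.1) x.2, show (x.2 : ℤ) - (M - x.1) - 1 = i - M - 1 by rw [← hx]; push_cast; ring,
    ← hx, pow_add]
  ring

theorem choose_succ_mul (M : ℤ) (r : ℕ) :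
    ((r : ℤ) + 1) * Ring.choose M (r + 1) = (M - r) * Ring.choose M r := by
  have h := Ring.choose_smul_choose M (n := r + 1) (k := r) (by omega)
  rw [Nat.choose_succ_self_right, Nat.add_sub_cancel_left, Ring.choose_one_right] at h
  simp only [nsmul_eq_mul] at h
  push_cast at h
  linarith

end Binomial

/-! ### Divided powers -/

section DividedPowers

variable {M : Type*} [AddCommGroup M] [Module ℂ M]

/-- The divided power `T^a / a!`. -/
def dpow (T : Module.End ℂ M) (a : ℕ) : Module.End ℂ M := ((a.factorial : ℂ)⁻¹) • T ^ a

theorem dpow_zero (T : Module.End ℂ M) : dpow T 0 = 1 := by simp [dpow]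

theorem apply_dpow (T : Module.End ℂ M) (a : ℕ) (x : M) :
    T (dpow T a x) = ((a : ℂ) + 1) • dpow T (a + 1) x := by
  have h : (a.factorial : ℂ) ≠ 0 := Nat.cast_ne_zero.2 a.factorial_ne_zero
  have h' : (a : ℂ) + 1 ≠ 0 := by exact_mod_cast a.succ_ne_zero
  rw [dpow, dpow, LinearMap.smul_apply, LinearMap.smul_apply, map_smul, pow_succ',
    Module.End.mul_apply, smul_smul, Nat.factorial_succ]
  congr 1
  push_cast
  field_simp

theorem dpow_apply (T : Module.End ℂ M) (a : ℕ) (x : M) :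
    dpow T a (T x) = ((a : ℂ) + 1) • dpow T (a + 1) x := by
  rw [← apply_dpow, dpow, LinearMap.smul_apply, LinearMap.smul_apply, map_smul,
    ← Module.End.mul_apply, ← Module.End.mul_apply, pow_mul_comm']

theorem dpow_eq_zero_iff (T : Module.End ℂ M) (a : ℕ) (x : M) :
    dpow T a x = 0 ↔ (T ^ a) x = 0 := by
  rw [dpow, LinearMap.smul_apply, smul_eq_zero,
    or_iff_right (inv_ne_zero (Nat.cast_ne_zero.2 a.factorial_ne_zero))]

/-- The commutator with `T` as an operator on `End M`. -/
def adEnd (T : Module.End ℂ M) : Module.End ℂ (Module.End ℂ M) :=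
  LinearMap.mulLeft ℂ T - LinearMap.mulRight ℂ T

theorem adEnd_apply (T X : Module.End ℂ M) : adEnd T X = ⁅T, X⁆ := rfl

/-- `(T^c / c!) X = ∑_{b+x=c} ((ad T)^x / x!)(X) T^b / b!`. -/
theorem dpow_mul (T X : Module.End ℂ M) (c : ℕ) :
    dpow T c * X = ∑ y ∈ Finset.HasAntidiagonal.antidiagonal c,
      dpow (adEnd T) y.2 X * dpow T y.1 := by
  -- Left multiplication by `T` is right multiplication plus `ad T`. These two commute, so the
  -- binomial theorem applies to their sum.
  have hc : Commute (LinearMap.mulRight ℂ T) (adEnd T) := by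
    refine Commute.sub_right ?_ (Commute.refl _)
    exact LinearMap.ext fun Y => (mul_assoc T Y T)
  have h := hc.add_pow' c
  rw [show LinearMap.mulRight ℂ T + adEnd T = LinearMap.mulLeft ℂ T by
    rw [adEnd]; abel, LinearMap.pow_mulLeft] at h
  have h1 := LinearMap.congr_fun h X
  rw [LinearMap.mulLeft_apply, LinearMap.sum_apply] at h1
  rw [dpow, smul_mul_assoc, h1, Finset.smul_sum]
  refine Finset.sum_congr rfl fun y hy => ?_
  rw [Finset.HasAntidiagonal.mem_antidiagonal] at hy
  rw [LinearMap.smul_apply, Module.End.mul_apply, LinearMap.pow_mulRight,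
    LinearMap.mulRight_apply, dpow, dpow, LinearMap.smul_apply, smul_mul_assoc, mul_smul_comm,
    smul_smul, ← Nat.cast_smul_eq_nsmul ℂ, smul_smul]
  congr 1
  have hf : ∀ a : ℕ, (a.factorial : ℂ) ≠ 0 := fun a => Nat.cast_ne_zero.2 a.factorial_ne_zero
  have e : (c.choose y.1 : ℂ) * y.1.factorial * y.2.factorial = c.factorial := by
    have := Nat.choose_mul_factorial_mul_factorial (show y.1 ≤ c by omega)
    rw [show c - y.1 = y.2 by omega] at this
    exact_mod_cast this
  have := hf c
  have := hf y.1
  have := hf y.2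
  field_simp
  rw [← e]
  ring

end DividedPowers

/-! ### Rearrangement of finite double sums. -/

section Sums

variable {M : Type*} [AddCommGroup M]

/-- Grouping a box by the value of `a + b`: every such value is below `A + B`, and the antidiagonal
points outside the box contribute zero. -/
theorem sum_range_antidiagonal {A B K : ℕ} (f : ℕ → ℕ → M) (hA : ∀ a b, A ≤ a → f a b = 0)
    (hB : ∀ a b, B ≤ b → f a b = 0) (hK : A + B ≤ K) :
    ∑ c ∈ Finset.range K, ∑ y ∈ Finset.HasAntidiagonal.antidiagonal c, f y.1 y.2 =
      ∑ a ∈ Finset.range A, ∑ b ∈ Finset.range B, f a b := by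
  classical
  rw [← Finset.sum_product' (Finset.range A) (Finset.range B) f,
    ← Finset.sum_fiberwise_of_maps_to (t := Finset.range K) (g := fun y : ℕ × ℕ => y.1 + y.2)]
  · refine Finset.sum_congr rfl fun c _ => (Finset.sum_subset ?_ ?_).symm
    · intro y hy
      exact Finset.HasAntidiagonal.mem_antidiagonal.2 (Finset.mem_filter.1 hy).2
    · intro y hy hy'
      rw [Finset.HasAntidiagonal.mem_antidiagonal] at hy
      by_cases h1 : A ≤ y.1
      · exact hA _ _ h1
      by_cases h2 : B ≤ y.2
      · exact hB _ _ h2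
      · exact absurd (Finset.mem_filter.2 ⟨Finset.mem_product.2
          ⟨Finset.mem_range.2 (not_le.1 h1), Finset.mem_range.2 (not_le.1 h2)⟩, hy⟩) hy'
  · intro y hy
    rw [Finset.mem_product, Finset.mem_range, Finset.mem_range] at hy
    exact Finset.mem_range.2 (by omega)

/-- The vanishing hypothesis confines the square to the triangle `a + b < N`, which is the union of
the first `N` antidiagonals. -/
theorem sum_range_range_eq_antidiagonal {N : ℕ} (f : ℕ → ℕ → M)
    (h : ∀ a b, N ≤ a + b → f a b = 0) :
    ∑ a ∈ Finset.range N, ∑ b ∈ Finset.range N, f a b =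
      ∑ c ∈ Finset.range N, ∑ y ∈ Finset.HasAntidiagonal.antidiagonal c, f y.1 y.2 := by
  rw [← sum_range_antidiagonal (K := N + N) f (fun a b ha => h a b (by omega))
    (fun a b hb => h a b (by omega)) le_rfl]
  refine (Finset.sum_subset (Finset.range_mono (by omega)) fun c _ hc => ?_).symm
  refine Finset.sum_eq_zero fun y hy => h _ _ ?_
  rw [Finset.HasAntidiagonal.mem_antidiagonal] at hy
  rw [Finset.mem_range] at hc
  omega

theorem sum_range_shift {K : ℕ} (f : ℕ → M) (h0 : f 0 = 0) (hK : f K = 0) :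
    ∑ a ∈ Finset.range K, f (a + 1) = ∑ a ∈ Finset.range K, f a := by
  have h1 := Finset.sum_range_succ f K
  rw [Finset.sum_range_succ', h0, hK, add_zero, add_zero] at h1
  exact h1

end Sums

/-! ### Commutators of the modes of homogeneous vectors -/

section Homogeneous

variable {A : Type*} [AddCommGroup A] {V W : Type*} [AddCommGroup V] [Module ℂ V]
  [AddCommGroup W] [Module ℂ W] {𝒱 : MobiusVertexAlgebra A V}
  {Y : V →ₗ[ℂ] VertexOperator ℂ W} {ρ : Sl2Rep W}

/-- Eliminating `L(-1)v` by the derivative property. In this form and the next two, the `𝔰𝔩(2)`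
brackets with modes of a homogeneous vector involve only `v` and `L(1)v`. -/
theorem lie_neg_mode (hρ : Sl2Commutator Y 𝒱.sl2 ρ) (hD : DerivativeProperty Y 𝒱.sl2.Lneg)
    (v : V) (n : ℤ) : ⁅ρ.Lneg, mode Y v n⁆ = -(n : ℂ) • mode Y v (n - 1) := by
  rw [(hρ v n).1, hD]

theorem lie_zero_mode (hρ : Sl2Commutator Y 𝒱.sl2 ρ) (hD : DerivativeProperty Y 𝒱.sl2.Lneg)
    {v : V} {h : ℤ} (hv : v ∈ 𝒱.wt h) (n : ℤ) :
    ⁅ρ.Lzero, mode Y v n⁆ = ((h : ℂ) - n - 1) • mode Y v n := by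
  rw [(hρ v n).2.1, hD, 𝒱.L_zero h v hv, mode_smul, add_sub_cancel_right]
  push_cast
  module

theorem lie_one_mode (hρ : Sl2Commutator Y 𝒱.sl2 ρ) (hD : DerivativeProperty Y 𝒱.sl2.Lneg)
    {v : V} {h : ℤ} (hv : v ∈ 𝒱.wt h) (n : ℤ) :
    ⁅ρ.Lone, mode Y v n⁆ =
      mode Y (𝒱.sl2.Lone v) n + (2 * (h : ℂ) - n - 2) • mode Y v (n + 1) := by
  rw [(hρ v n).2.2, hD, 𝒱.L_zero h v hv, mode_smul, show n + 2 - 1 = n + 1 by ring]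
  push_cast
  module

theorem dpow_mem_wt {v : V} {h : ℤ} (hv : v ∈ 𝒱.wt h) (a : ℕ) :
    dpow 𝒱.sl2.Lone a v ∈ 𝒱.wt (h - a) := by
  refine Submodule.smul_mem _ _ ?_
  induction a with
  | zero => simpa using hv
  | succ a ih =>
    rw [pow_succ', Module.End.mul_apply]
    have := 𝒱.L_one_wt _ _ ih
    rwa [show h - ((a + 1 : ℕ) : ℤ) = h - a - 1 by push_cast; ring]

theorem mode_mem_wt {u v : V} {p q : ℤ} (hu : u ∈ 𝒱.wt p) (hv : v ∈ 𝒱.wt q) (n : ℤ) :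
    mode 𝒱.Y u n v ∈ 𝒱.wt (p + q - n - 1) := by
  rw [𝒱.wt_eq_eigenspace, Module.End.mem_eigenspace_iff]
  have h := LinearMap.congr_fun (lie_zero_mode 𝒱.sl2_comm 𝒱.derivative hu n) v
  rw [Ring.lie_def, LinearMap.sub_apply, Module.End.mul_apply, Module.End.mul_apply,
    𝒱.L_zero q v hv, map_smul, LinearMap.smul_apply, sub_eq_iff_eq_add] at h
  rw [h]
  push_cast
  module

/-- `((ad L(1))^x / x!)(u_j) = ∑_{a+r=x} binom(2 p - a - j - 2, r) (L(1)^a u / a!)_{j+r}` for `u` of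
weight `p`. -/
theorem dpow_adEnd_mode {u : V} {p : ℤ} (hu : u ∈ 𝒱.wt p) (j : ℤ) (x : ℕ) :
    dpow (adEnd 𝒱.sl2.Lone) x (mode 𝒱.Y u j) =
      ∑ y ∈ Finset.HasAntidiagonal.antidiagonal x,
        ((Ring.choose (2 * p - y.1 - j - 2) y.2 : ℤ) : ℂ) •
          mode 𝒱.Y (dpow 𝒱.sl2.Lone y.1 u) (j + y.2) := by
  induction x with
  | zero => simp [dpow_zero]
  | succ x ih =>
    have hx : (x : ℂ) + 1 ≠ 0 := by exact_mod_cast x.succ_ne_zero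
    have h := apply_dpow (adEnd 𝒱.sl2.Lone) x (mode 𝒱.Y u j)
    rw [ih, map_sum] at h
    -- Multiplying by `x + 1` replaces the next divided power by one application of `ad L(1)` to the
    -- formula for `x`.
    refine smul_right_injective _ hx ?_
    dsimp only
    rw [← h]
    set F : ℕ → ℕ → Module.End ℂ V := fun a r => mode 𝒱.Y (dpow 𝒱.sl2.Lone a u) (j + r) with hF
    set M : ℕ → ℤ := fun a => 2 * p - a - j - 2 with hM
    -- Each application of `ad L(1)` raises either `a` or `r` by one. The coefficients are written
    -- as functions of the raised indices, so that they match the splitting of the target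
    -- coefficient in `e2`; here `M (a + 1) + 1 = M a`.
    have e1 : ∀ y : ℕ × ℕ, adEnd 𝒱.sl2.Lone (((Ring.choose (M y.1) y.2 : ℤ) : ℂ) • F y.1 y.2) =
        (((y.1 + 1 : ℕ) : ℂ) * ((Ring.choose (M (y.1 + 1) + 1) y.2 : ℤ) : ℂ)) • F (y.1 + 1) y.2 +
        ((((y.1 + (y.2 + 1) : ℕ) : ℂ) * ((Ring.choose (M y.1) (y.2 + 1) : ℤ) : ℂ) -
          (y.1 : ℂ) * ((Ring.choose (M y.1 + 1) (y.2 + 1) : ℤ) : ℂ))) • F y.1 (y.2 + 1) := by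
      rintro ⟨a, r⟩
      have k1 : (((r : ℤ) + 1 : ℤ) : ℂ) * ((Ring.choose (M a) (r + 1) : ℤ) : ℂ) =
          (((M a) - r : ℤ) : ℂ) * ((Ring.choose (M a) r : ℤ) : ℂ) := by
        exact_mod_cast choose_succ_mul (M a) r
      have k2 : M (a + 1) + 1 = M a := by simp only [hM]; push_cast; ring
      have k3 : ((M a : ℤ) : ℂ) = 2 * p - a - j - 2 := by simp only [hM]; push_cast; ring
      simp only [k2, Ring.choose_succ_succ]
      rw [map_smul, adEnd_apply, hF]
      dsimp only
      rw [lie_one_mode 𝒱.sl2_comm 𝒱.derivative (dpow_mem_wt hu a), apply_dpow, mode_smul,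
        show j + (r : ℤ) + 1 = j + ((r + 1 : ℕ) : ℤ) by push_cast; ring]
      rw [smul_add, smul_smul, smul_smul]
      congr 1
      · congr 1; push_cast; ring
      · congr 1
        push_cast at k1 k3 ⊢
        rw [k3] at k1
        linear_combination -k1
    have e2 : ∀ y ∈ Finset.HasAntidiagonal.antidiagonal (x + 1),
        ((x : ℂ) + 1) • (((Ring.choose (M y.1) y.2 : ℤ) : ℂ) • F y.1 y.2) =
        ((y.1 : ℂ) * ((Ring.choose (M y.1 + 1) y.2 : ℤ) : ℂ)) • F y.1 y.2 +
        ((((y.1 + y.2 : ℕ) : ℂ) * ((Ring.choose (M y.1) y.2 : ℤ) : ℂ) -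
          (y.1 : ℂ) * ((Ring.choose (M y.1 + 1) y.2 : ℤ) : ℂ))) • F y.1 y.2 := by
      intro y hy
      rw [Finset.HasAntidiagonal.mem_antidiagonal] at hy
      rw [hy]
      push_cast
      module
    rw [Finset.sum_congr rfl fun y _ => e1 y, Finset.smul_sum, Finset.sum_congr rfl e2,
      Finset.sum_add_distrib, Finset.sum_add_distrib]
    congr 1
    -- The extra endpoint of the longer antidiagonal drops out: its coefficient is zero at `a = 0`
    -- here, and at `r = 0` in the second sum.
    · rw [Finset.Nat.sum_antidiagonal_succ (f := fun y : ℕ × ℕ =>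
        ((y.1 : ℂ) * ((Ring.choose (M y.1 + 1) y.2 : ℤ) : ℂ)) • F y.1 y.2)]
      simp
    · rw [Finset.Nat.sum_antidiagonal_succ' (f := fun y : ℕ × ℕ =>
        ((((y.1 + y.2 : ℕ) : ℂ) * ((Ring.choose (M y.1) y.2 : ℤ) : ℂ) -
          (y.1 : ℂ) * ((Ring.choose (M y.1 + 1) y.2 : ℤ) : ℂ))) • F y.1 y.2)]
      simp

/-- The noncommutative Leibniz rule `dpow_mul` moves the divided power of `L(1)` past the mode;
`dpow_adEnd_mode` evaluates the resulting powers of `ad L(1)`. -/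
theorem dpow_mode {u : V} {p : ℤ} (hu : u ∈ 𝒱.wt p) (v : V) (j : ℤ) (c : ℕ) :
    dpow 𝒱.sl2.Lone c (mode 𝒱.Y u j v) =
      ∑ y ∈ Finset.HasAntidiagonal.antidiagonal c,
        ∑ x ∈ Finset.HasAntidiagonal.antidiagonal y.2,
        ((Ring.choose (2 * p - x.1 - j - 2) x.2 : ℤ) : ℂ) •
          mode 𝒱.Y (dpow 𝒱.sl2.Lone x.1 u) (j + x.2) (dpow 𝒱.sl2.Lone y.1 v) := by
  have h := LinearMap.congr_fun (dpow_mul 𝒱.sl2.Lone (mode 𝒱.Y u j) c) v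
  rw [Module.End.mul_apply] at h
  rw [h, LinearMap.sum_apply]
  refine Finset.sum_congr rfl fun y _ => ?_
  rw [dpow_adEnd_mode hu, Module.End.mul_apply, LinearMap.sum_apply]
  rfl

end Homogeneous

/-! ### The opposite action -/

section Opposite

variable {A : Type*} [AddCommGroup A] {V W : Type*} [AddCommGroup V] [Module ℂ V]
  [AddCommGroup W] [Module ℂ W]

/-- `τ_W ∘ o` as a bilinear map. -/
def serMinus (𝒱 : MobiusVertexAlgebra A V) (Y : V →ₗ[ℂ] VertexOperator ℂ W) :
    V →ₗ[ℂ] LaurentSeries ℂ →ₗ[ℂ] Module.End ℂ W :=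
  TensorProduct.curry ((tauW Y).comp (oppMap 𝒱))

variable {𝒱 : MobiusVertexAlgebra A V} {Y : V →ₗ[ℂ] VertexOperator ℂ W} {ρ : Sl2Rep W}

theorem exists_dpow_eq_zero (v : V) : ∃ K : ℕ, ∀ a ≥ K, dpow 𝒱.sl2.Lone a v = 0 := by
  obtain ⟨K, hK⟩ := 𝒱.L_one_nilpotent v
  exact ⟨K, fun a ha => (dpow_eq_zero_iff _ _ _).2 (hK a ha)⟩

/-- Nilpotency of `L(1)` makes the series defining `v^o` finite. The cutoff `K` is left free so that
several vectors can share one. -/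
theorem serMinus_apply {v : V} {h : ℤ} (hv : v ∈ 𝒱.wt h) {K : ℕ}
    (hK : ∀ a ≥ K, dpow 𝒱.sl2.Lone a v = 0) (f : LaurentSeries ℂ) :
    serMinus 𝒱 Y v f = (-1 : ℂ) ^ h • ∑ a ∈ Finset.range K,
      tauW Y (dpow 𝒱.sl2.Lone a v ⊗ₜ (f * HahnSeries.single (2 * h - a - 2) 1)) := by
  have e : oppVector 𝒱 v = ∑ a ∈ Finset.range K, (-1 : ℂ) ^ h •
      (dpow 𝒱.sl2.Lone a v ⊗ₜ (HahnSeries.single (2 * h - a - 2) 1 : LaurentSeries ℂ)) := by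
    rw [oppVector_of_mem 𝒱 h v hv]
    change ∑ᶠ m : ℕ, _ = _
    rw [finsum_eq_sum_of_support_subset (s := Finset.range K)]
    · refine Finset.sum_congr rfl fun a _ => ?_
      rw [dpow, LinearMap.smul_apply, ← TensorProduct.smul_tmul', smul_smul, div_eq_mul_inv]
    · intro a ha
      by_contra hc
      refine ha ?_
      have := (dpow_eq_zero_iff _ _ _).1 (hK a (by simpa using hc))
      simp only [this, TensorProduct.zero_tmul, smul_zero]
  change tauW Y (oppMap 𝒱 (v ⊗ₜ f)) = _
  rw [oppMap_tmul, e, map_sum, map_sum, Finset.smul_sum]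
  refine Finset.sum_congr rfl fun a _ => ?_
  rw [map_smul, map_smul]
  rfl

/-- The map `o` turns `t^n` into `t^{-n}`, whose exponent is added to those occurring in `v^o`. -/
theorem serMinus_tpow {v : V} {h : ℤ} (hv : v ∈ 𝒱.wt h) {K : ℕ}
    (hK : ∀ a ≥ K, dpow 𝒱.sl2.Lone a v = 0) (n : ℤ) :
    serMinus 𝒱 Y v (tpow (-1) n) = (-1 : ℂ) ^ h • ∑ a ∈ Finset.range K,
      mode Y (dpow 𝒱.sl2.Lone a v) (2 * h - a - 2 - n) := by
  rw [serMinus_apply hv hK]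
  congr 1
  refine Finset.sum_congr rfl fun a _ => ?_
  rw [tpow, HahnSeries.single_mul_single, one_mul, tauW_single]
  congr 1
  ring

/-- To prove a statement for all vectors, it suffices to consider homogeneous ones. -/
theorem MobiusVertexAlgebra.wt_induction {p : V → Prop} (h0 : p 0)
    (hadd : ∀ u v, p u → p v → p (u + v)) (hwt : ∀ h, ∀ v ∈ 𝒱.wt h, p v) (v : V) : p v := by
  have hv : v ∈ ⨆ n, 𝒱.wt n := 𝒱.wt_span ▸ Submodule.mem_top
  induction hv using Submodule.iSup_induction' with
  | zero => exact h0
  | add x y _ _ hx hy => exact hadd x y hx hy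
  | mem h x hx => exact hwt h x hx

theorem isSeriesMap_serMinus (v : V) : IsSeriesMap fun f => serMinus 𝒱 Y v f := by
  induction v using 𝒱.wt_induction with
  | h0 => simpa using IsSeriesMap.zero
  | hadd u v hu hv => simpa using hu.add hv
  | hwt h v hv =>
    obtain ⟨K, hK⟩ := exists_dpow_eq_zero (𝒱 := 𝒱) v
    simp only [serMinus_apply hv hK]
    exact IsSeriesMap.smul _ (IsSeriesMap.sum _ fun a _ => (isSeriesMap_tauW Y _).comp_mul' _)

/-- For `v` of weight `h`, moving `L(-1)` to the left of the powers of `L(1)` produces two families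
of modes. After the derivative property and an index shift their coefficients `-(2h - a - n)` and
`2h - a` add up to `n`; the remaining sign comes from `L(-1)v` having weight `h + 1`. -/
theorem serMinus_deriv (hD : DerivativeProperty Y 𝒱.sl2.Lneg) (v : V) (n : ℤ) :
    serMinus 𝒱 Y (𝒱.sl2.Lneg v) (tpow (-1) n) =
      -(n : ℂ) • serMinus 𝒱 Y v (tpow (-1) (n - 1)) := by
  induction v using 𝒱.wt_induction with
  | h0 => simp
  | hadd u v hu hv => rw [map_add, map_add, map_add, LinearMap.add_apply, LinearMap.add_apply,
      hu, hv, smul_add]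
  | hwt h v hv =>
    have hL : 𝒱.sl2.Lneg v ∈ 𝒱.wt (h + 1) := by
      rw [𝒱.wt_eq_eigenspace, Module.End.mem_eigenspace_iff]
      have h1 := LinearMap.congr_fun 𝒱.sl2.lie_zero_neg v
      rw [Ring.lie_def, LinearMap.sub_apply, Module.End.mul_apply, Module.End.mul_apply,
        𝒱.L_zero h v hv, map_smul, sub_eq_iff_eq_add] at h1
      rw [h1]
      push_cast
      module
    -- The standard `𝔰𝔩(2)` formula, by induction from `[L(1), L(-1)] = 2L(0)` and the weights of
    -- the vectors `L(1)^a v`.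
    have key : ∀ a : ℕ, dpow 𝒱.sl2.Lone (a + 1) (𝒱.sl2.Lneg v) =
        𝒱.sl2.Lneg (dpow 𝒱.sl2.Lone (a + 1) v) +
          (2 * (h : ℂ) - a) • dpow 𝒱.sl2.Lone a v := by
      intro a
      have br : ∀ x, 𝒱.sl2.Lone (𝒱.sl2.Lneg x) =
          𝒱.sl2.Lneg (𝒱.sl2.Lone x) + (2 : ℂ) • 𝒱.sl2.Lzero x := by
        intro x
        have h1 := LinearMap.congr_fun 𝒱.sl2.lie_neg_one x
        rw [Ring.lie_def, LinearMap.sub_apply, Module.End.mul_apply, Module.End.mul_apply,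
          sub_eq_iff_eq_add] at h1
        rw [h1, LinearMap.smul_apply]
        module
      induction a with
      | zero =>
        have h1 := apply_dpow 𝒱.sl2.Lone 0 v
        have h2 := apply_dpow 𝒱.sl2.Lone 0 (𝒱.sl2.Lneg v)
        simp only [dpow_zero, Module.End.one_apply, Nat.cast_zero, zero_add, one_smul] at h1 h2
        rw [← h2, br, h1, 𝒱.L_zero h v hv, dpow_zero, Module.End.one_apply]
        module
      | succ a ih =>
        have h0 : ((a + 1 : ℕ) : ℂ) + 1 ≠ 0 := by exact_mod_cast (a + 1).succ_ne_zero
        refine smul_right_injective _ h0 ?_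
        dsimp only
        rw [← apply_dpow, ih, map_add, map_smul, apply_dpow, br, apply_dpow,
          𝒱.L_zero _ _ (dpow_mem_wt hv (a + 1)), map_smul]
        push_cast
        module
    obtain ⟨K, hK⟩ := exists_dpow_eq_zero (𝒱 := 𝒱) v
    -- The cutoff grows by one because `key` at `a + 1` still involves `L(1)^a v`.
    have hK' : ∀ a ≥ K + 1, dpow 𝒱.sl2.Lone a (𝒱.sl2.Lneg v) = 0 := by
      intro a ha
      obtain ⟨b, rfl⟩ := Nat.exists_eq_add_of_le' (show 1 ≤ a by omega)
      rw [key, hK _ (by omega), hK _ (by omega), map_zero, smul_zero, add_zero]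
    rw [serMinus_tpow hL hK', serMinus_tpow hv hK, Finset.sum_range_succ', smul_comm,
      zpow_add_one₀ (by norm_num), mul_neg_one, neg_smul, ← smul_neg]
    congr 1
    have e1 : ∀ a : ℕ, mode Y (dpow 𝒱.sl2.Lone (a + 1) (𝒱.sl2.Lneg v))
        (2 * (h + 1) - (a + 1 : ℕ) - 2 - n) =
        (-(2 * (h : ℂ) - (a + 1 : ℕ) - n)) • mode Y (dpow 𝒱.sl2.Lone (a + 1) v)
          (2 * h - (a + 1 : ℕ) - 1 - n) +
        (2 * (h : ℂ) - a) • mode Y (dpow 𝒱.sl2.Lone a v) (2 * h - a - 1 - n) := by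
      intro a
      rw [key, mode_add, hD, mode_smul,
        show 2 * (h + 1) - ((a + 1 : ℕ) : ℤ) - 2 - n = 2 * h - a - 1 - n by push_cast; ring,
        show 2 * h - (a : ℤ) - 1 - n - 1 = 2 * h - (a + 1 : ℕ) - 1 - n by push_cast; ring]
      push_cast
      congr 1
      congr 1
      ring
    have e2 : mode Y (dpow 𝒱.sl2.Lone 0 (𝒱.sl2.Lneg v)) (2 * (h + 1) - (0 : ℕ) - 2 - n) =
        (-(2 * (h : ℂ) - (0 : ℕ) - n)) • mode Y (dpow 𝒱.sl2.Lone 0 v)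
          (2 * h - (0 : ℕ) - 1 - n) := by
      rw [dpow_zero, Module.End.one_apply, Module.End.one_apply, hD]
      congr 1
      · push_cast; ring
      · congr 1; push_cast; ring
    -- The split-off term `a = 0` joins the first family to form a sum over `range (K + 1)`, whose
    -- last term vanishes.
    rw [Finset.sum_congr rfl fun a _ => e1 a, e2, Finset.sum_add_distrib, add_right_comm,
      ← Finset.sum_range_succ' (fun a : ℕ => (-(2 * (h : ℂ) - a - n)) •
        mode Y (dpow 𝒱.sl2.Lone a v) (2 * h - a - 1 - n)), Finset.sum_range_succ,
      hK K le_rfl, mode_zero, smul_zero, add_zero, ← Finset.sum_add_distrib, Finset.smul_sum,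
      ← Finset.sum_neg_distrib]
    refine Finset.sum_congr rfl fun a _ => ?_
    rw [show 2 * h - (a : ℤ) - 2 - (n - 1) = 2 * h - a - 1 - n by ring]
    module

/-- All modes in the opposite operator of a vector of weight `h` have the same `L(0)`-degree: `(h -
a) - (2h - a - 2 - n) - 1 = n + 1 - h` is independent of `a`. -/
theorem lie_zero_serMinus (hρ : Sl2Commutator Y 𝒱.sl2 ρ)
    (hD : DerivativeProperty Y 𝒱.sl2.Lneg) (v : V) (n : ℤ) :
    ⁅ρ.Lzero, serMinus 𝒱 Y v (tpow (-1) n)⁆ =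
    -(serMinus 𝒱 Y (𝒱.sl2.Lzero v) (tpow (-1) n) +
      serMinus 𝒱 Y (𝒱.sl2.Lneg v) (tpow (-1) (n + 1))) := by
  rw [serMinus_deriv hD, add_sub_cancel_right]
  induction v using 𝒱.wt_induction with
  | h0 => simp [Ring.lie_def]
  | hadd u v hu hv =>
    simp only [map_add, LinearMap.add_apply, end_lie_add, hu, hv, smul_add]
    abel
  | hwt h v hv =>
    obtain ⟨K, hK⟩ := exists_dpow_eq_zero (𝒱 := 𝒱) v
    rw [𝒱.L_zero h v hv, map_smul, LinearMap.smul_apply, serMinus_tpow hv hK, end_lie_smul,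
      end_lie_sum, ← add_smul, ← neg_smul, smul_comm _ ((-1 : ℂ) ^ h)]
    congr 1
    rw [Finset.smul_sum]
    refine Finset.sum_congr rfl fun a _ => ?_
    rw [lie_zero_mode hρ hD (dpow_mem_wt hv a)]
    congr 1
    push_cast
    ring

/-- `L(1)` acts on the opposite modes as `L(-1)` does on the modes. -/
theorem lie_one_serMinus (hρ : Sl2Commutator Y 𝒱.sl2 ρ)
    (hD : DerivativeProperty Y 𝒱.sl2.Lneg) (v : V) (n : ℤ) :
    ⁅ρ.Lone, serMinus 𝒱 Y v (tpow (-1) n)⁆ =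
    -serMinus 𝒱 Y (𝒱.sl2.Lneg v) (tpow (-1) n) := by
  rw [serMinus_deriv hD]
  induction v using 𝒱.wt_induction with
  | h0 => simp [Ring.lie_def]
  | hadd u v hu hv =>
    simp only [map_add, LinearMap.add_apply, end_lie_add, hu, hv, smul_add]
    abel
  | hwt h v hv =>
    obtain ⟨K, hK⟩ := exists_dpow_eq_zero (𝒱 := 𝒱) v
    rw [serMinus_tpow hv hK, serMinus_tpow hv hK, end_lie_smul, end_lie_sum, neg_smul, neg_neg,
      smul_comm _ ((-1 : ℂ) ^ h)]
    congr 1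
    have e : ∀ a : ℕ, ⁅ρ.Lone, mode Y (dpow 𝒱.sl2.Lone a v) (2 * h - a - 2 - n)⁆ =
        ((a + 1 : ℕ) : ℂ) • mode Y (dpow 𝒱.sl2.Lone (a + 1) v) (2 * h - (a + 1 : ℕ) - 1 - n) +
        ((n : ℂ) - a) • mode Y (dpow 𝒱.sl2.Lone a v) (2 * h - a - 1 - n) := by
      intro a
      rw [lie_one_mode hρ hD (dpow_mem_wt hv a), apply_dpow, mode_smul,
        show 2 * h - (a : ℤ) - 2 - n + 1 = 2 * h - a - 1 - n by ring,
        show 2 * h - (a : ℤ) - 2 - n = 2 * h - (a + 1 : ℕ) - 1 - n by push_cast; ring]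
      push_cast
      congr 2
      ring
    -- Shifting the index turns the coefficient `a + 1` into `a`, which cancels against `n - a` and
    -- leaves `n`.
    rw [Finset.sum_congr rfl fun a _ => e a, Finset.sum_add_distrib,
      sum_range_shift (fun a : ℕ => (a : ℂ) • mode Y (dpow 𝒱.sl2.Lone a v) (2 * h - a - 1 - n))
        (by simp) (by rw [hK K le_rfl, mode_zero, smul_zero]),
      ← Finset.sum_add_distrib, Finset.smul_sum]
    refine Finset.sum_congr rfl fun a _ => ?_
    rw [show 2 * h - (a : ℤ) - 2 - (n - 1) = 2 * h - a - 1 - n by ring]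
    module

/-- `L(-1)` acts on the opposite modes as `L(1)` does on the modes. -/
theorem lie_neg_serMinus (hρ : Sl2Commutator Y 𝒱.sl2 ρ)
    (hD : DerivativeProperty Y 𝒱.sl2.Lneg) (v : V) (n : ℤ) :
    ⁅ρ.Lneg, serMinus 𝒱 Y v (tpow (-1) n)⁆ =
    -(serMinus 𝒱 Y (𝒱.sl2.Lone v) (tpow (-1) n) +
      (2 : ℂ) • serMinus 𝒱 Y (𝒱.sl2.Lzero v) (tpow (-1) (n + 1)) +
      serMinus 𝒱 Y (𝒱.sl2.Lneg v) (tpow (-1) (n + 2))) := by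
  rw [serMinus_deriv hD, show n + 2 - 1 = n + 1 by ring]
  induction v using 𝒱.wt_induction with
  | h0 => simp [Ring.lie_def]
  | hadd u v hu hv =>
    simp only [map_add, LinearMap.add_apply, end_lie_add, hu, hv, smul_add]
    abel
  | hwt h v hv =>
    obtain ⟨K, hK⟩ := exists_dpow_eq_zero (𝒱 := 𝒱) v
    have hK' : ∀ a ≥ K, dpow 𝒱.sl2.Lone a (𝒱.sl2.Lone v) = 0 := fun a ha => by
      rw [dpow_apply, hK _ (by omega), smul_zero]
    rw [𝒱.L_zero h v hv, map_smul, LinearMap.smul_apply, serMinus_tpow hv hK,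
      serMinus_tpow hv hK, serMinus_tpow (𝒱.L_one_wt h v hv) hK', end_lie_smul, end_lie_sum,
      zpow_sub_one₀ (by norm_num)]
    have e : ∀ a : ℕ, mode Y (dpow 𝒱.sl2.Lone a (𝒱.sl2.Lone v)) (2 * (h - 1) - a - 2 - n) =
        ((a + 1 : ℕ) : ℂ) •
          mode Y (dpow 𝒱.sl2.Lone (a + 1) v) (2 * h - (a + 1 : ℕ) - 2 - (n + 1)) := by
      intro a
      rw [dpow_apply, mode_smul, show 2 * (h - 1) - (a : ℤ) - 2 - n =
        2 * h - (a + 1 : ℕ) - 2 - (n + 1) by push_cast; ring]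
      push_cast
      rfl
    -- The shifted sum now has coefficients `a`. They match the `a`-dependent part of the bracket on
    -- the left, since the weight `h - 1` of `L(1)v` contributes the opposite sign.
    rw [Finset.sum_congr rfl fun a _ => e a,
      sum_range_shift (fun a : ℕ => (a : ℂ) •
        mode Y (dpow 𝒱.sl2.Lone a v) (2 * h - a - 2 - (n + 1)))
        (by simp) (by rw [hK K le_rfl, mode_zero, smul_zero])]
    have e' : ∀ a : ℕ, ⁅ρ.Lneg, mode Y (dpow 𝒱.sl2.Lone a v) (2 * h - a - 2 - n)⁆ =
        (a : ℂ) • mode Y (dpow 𝒱.sl2.Lone a v) (2 * h - a - 2 - (n + 1)) -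
        (2 * (h : ℂ) - n - 2) • mode Y (dpow 𝒱.sl2.Lone a v) (2 * h - a - 2 - (n + 1)) := by
      intro a
      rw [lie_neg_mode hρ hD, show 2 * h - (a : ℤ) - 2 - n - 1 = 2 * h - a - 2 - (n + 1) by ring]
      push_cast
      module
    rw [Finset.sum_congr rfl fun a _ => e' a, Finset.sum_sub_distrib, ← Finset.smul_sum]
    push_cast
    module

end Opposite

/-! ### The opposite action is an antihomomorphism. -/

section OppositeCommutator

variable {A : Type*} [AddCommGroup A] {V W : Type*} [AddCommGroup V] [Module ℂ V]
  [AddCommGroup W] [Module ℂ W] {𝒱 : MobiusVertexAlgebra A V}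
  {Y : V →ₗ[ℂ] VertexOperator ℂ W} {ρ : Sl2Rep W}

/-- The opposite mode of `u_j v` in terms of the modes of the vectors `(L(1)^a u)_i L(1)^b v`. -/
theorem serMinus_mode {u v : V} {p q : ℤ} (hu : u ∈ 𝒱.wt p) (hv : v ∈ 𝒱.wt q) {K N : ℕ}
    (hKu : ∀ a ≥ K, dpow 𝒱.sl2.Lone a u = 0) (hKv : ∀ a ≥ K, dpow 𝒱.sl2.Lone a v = 0)
    (hN : ∀ a b : ℕ, ∀ i : ℤ, (N : ℤ) ≤ i →
      mode 𝒱.Y (dpow 𝒱.sl2.Lone a u) i (dpow 𝒱.sl2.Lone b v) = 0) (j : ℕ) (n : ℤ) :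
    serMinus 𝒱 Y (mode 𝒱.Y u j v) (tpow (-1) n) = (-1 : ℂ) ^ (p + q - j - 1) •
      ∑ b ∈ Finset.range K, ∑ a ∈ Finset.range K, ∑ r ∈ Finset.range N,
        ((Ring.choose (2 * p - a - j - 2) r : ℤ) : ℂ) •
        mode Y (mode 𝒱.Y (dpow 𝒱.sl2.Lone a u) (j + r) (dpow 𝒱.sl2.Lone b v))
          (2 * (p + q - j - 1) - (a + b + r) - 2 - n) := by
  set G : ℕ → ℕ → ℕ → V := fun b a r => ((Ring.choose (2 * p - a - j - 2) r : ℤ) : ℂ) •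
    mode 𝒱.Y (dpow 𝒱.sl2.Lone a u) (j + r) (dpow 𝒱.sl2.Lone b v) with hG
  have hGb : ∀ b a r, K ≤ b → G b a r = 0 := fun b a r hb => by
    simp only [hG, hKv b hb, map_zero, smul_zero]
  have hGa : ∀ b a r, K ≤ a → G b a r = 0 := fun b a r ha => by
    simp only [hG, hKu a ha, mode_zero, LinearMap.zero_apply, smul_zero]
  have hGr : ∀ b a r, N ≤ r → G b a r = 0 := fun b a r hr => by
    simp only [hG, hN a b (j + r) (by omega), smul_zero]
  have hd : ∀ c, dpow 𝒱.sl2.Lone c (mode 𝒱.Y u j v) =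
      ∑ y ∈ Finset.HasAntidiagonal.antidiagonal c,
        ∑ x ∈ Finset.HasAntidiagonal.antidiagonal y.2, G y.1 x.1 x.2 :=
    fun c => dpow_mode hu v j c
  -- If `b + a + r` reaches this bound, then `b ≥ K`, `a ≥ K` or `r ≥ N`, and each of these kills
  -- the term.
  have hK : ∀ c ≥ K + (K + N), dpow 𝒱.sl2.Lone c (mode 𝒱.Y u j v) = 0 := by
    intro c hc
    rw [hd]
    refine Finset.sum_eq_zero fun y hy => Finset.sum_eq_zero fun x hx => ?_
    rw [Finset.HasAntidiagonal.mem_antidiagonal] at hx hy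
    by_cases h1 : K ≤ y.1
    · exact hGb _ _ _ h1
    by_cases h2 : K ≤ x.1
    · exact hGa _ _ _ h2
    · exact hGr _ _ _ (by omega)
  rw [serMinus_tpow (mode_mem_wt hu hv j) hK]
  congr 1
  set S : ℤ := 2 * (p + q - j - 1) - 2 - n with hS
  set H : ℕ → ℕ → ℕ → Module.End ℂ W := fun b a r => mode Y (G b a r) (S - (a + b + r)) with hH
  have e : ∀ c : ℕ, mode Y (dpow 𝒱.sl2.Lone c (mode 𝒱.Y u j v))
      (2 * (p + q - j - 1) - c - 2 - n) =
      ∑ y ∈ Finset.HasAntidiagonal.antidiagonal c,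
        ∑ x ∈ Finset.HasAntidiagonal.antidiagonal y.2, H y.1 x.1 x.2 := by
    intro c
    rw [hd, mode_sum]
    refine Finset.sum_congr rfl fun y hy => ?_
    rw [mode_sum]
    refine Finset.sum_congr rfl fun x hx => ?_
    rw [Finset.HasAntidiagonal.mem_antidiagonal] at hx hy
    simp only [hH]
    congr 1
    rw [hS, ← hy, ← hx]
    push_cast
    ring
  have hHb : ∀ b a r, K ≤ b → H b a r = 0 := fun b a r hb => by
    simp only [hH, hGb b a r hb, mode_zero]
  have hHa : ∀ b a r, K ≤ a → H b a r = 0 := fun b a r ha => by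
    simp only [hH, hGa b a r ha, mode_zero]
  have hHr : ∀ b a r, N ≤ r → H b a r = 0 := fun b a r hr => by
    simp only [hH, hGr b a r hr, mode_zero]
  rw [Finset.sum_congr rfl fun c _ => e c,
    sum_range_antidiagonal (A := K) (B := K + N)
      (fun b y => ∑ x ∈ Finset.HasAntidiagonal.antidiagonal y, H b x.1 x.2)
      (fun b y hb => Finset.sum_eq_zero fun x _ => hHb _ _ _ hb)
      (fun b y hy => Finset.sum_eq_zero fun x hx => ?_) le_rfl]
  · refine Finset.sum_congr rfl fun b _ => ?_
    rw [sum_range_antidiagonal (A := K) (B := N) (fun a r => H b a r) (hHa b) (hHr b) le_rfl]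
    refine Finset.sum_congr rfl fun a _ => Finset.sum_congr rfl fun r _ => ?_
    simp only [hH, hG, mode_smul]
    rw [show S - ((a : ℤ) + b + r) = 2 * (p + q - j - 1) - (a + b + r) - 2 - n by rw [hS]; ring]
  · rw [Finset.HasAntidiagonal.mem_antidiagonal] at hx
    by_cases h2 : K ≤ x.1
    · exact hHa _ _ _ h2
    · exact hHr _ _ _ (by omega)

/-- Collecting the terms with `j + r = i` leaves the convolution evaluated in
`sum_antidiagonal_choose`; the vanishing of `H` from `N` on removes the rest of the square. -/
theorem sum_choose_smul {M : Type*} [AddCommGroup M] [Module ℂ M] (m k : ℤ) {N : ℕ} (H : ℕ → M)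
    (hH : ∀ i, N ≤ i → H i = 0) :
    ∑ j ∈ Finset.range N, ∑ r ∈ Finset.range N, ((-1 : ℂ) ^ j * ((Ring.choose m j : ℤ) : ℂ) *
      ((Ring.choose (k - j) r : ℤ) : ℂ)) • H (j + r) =
    ∑ i ∈ Finset.range N, ((Ring.choose (k - m) i : ℤ) : ℂ) • H i := by
  rw [sum_range_range_eq_antidiagonal (fun j r => ((-1 : ℂ) ^ j * ((Ring.choose m j : ℤ) : ℂ) *
      ((Ring.choose (k - j) r : ℤ) : ℂ)) • H (j + r))
    fun a b hab => (congrArg _ (hH _ hab)).trans (smul_zero _)]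
  refine Finset.sum_congr rfl fun i _ => ?_
  rw [← sum_antidiagonal_choose, Int.cast_sum, Finset.sum_smul]
  refine Finset.sum_congr rfl fun y hy => ?_
  rw [Finset.HasAntidiagonal.mem_antidiagonal] at hy
  rw [hy]
  push_cast
  rfl

/-- Both sides are combinations of the same operators, the modes of `(L(1)^a u)_i L(1)^b v`. The
commutator formula gives the coefficient `binom(2p-a-2-m, i)` on the left. On the right
`serMinus_mode` gives the sum over `j + r = i` of `(-1)^j binom(m,j) binom(2p-a-2-j, r)`, which is
the same by Vandermonde. The overall minus sign comes from `u_j v` having weight `p + q - j - 1`. -/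
theorem serMinus_commutator_of_mem (hJ : JacobiIdentity 𝒱.Y Y) {u v : V} {p q : ℤ}
    (hu : u ∈ 𝒱.wt p) (hv : v ∈ 𝒱.wt q) : ∃ N₀ : ℕ, ∀ N ≥ N₀, ∀ m n : ℤ,
    ⁅serMinus 𝒱 Y u (tpow (-1) m), serMinus 𝒱 Y v (tpow (-1) n)⁆ =
      -∑ i ∈ Finset.range N, ((Ring.choose m i : ℤ) : ℂ) •
        serMinus 𝒱 Y (mode 𝒱.Y u i v) (tpow (-1) (m + n - i)) := by
  obtain ⟨K₁, hK₁⟩ := exists_dpow_eq_zero (𝒱 := 𝒱) u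
  obtain ⟨K₂, hK₂⟩ := exists_dpow_eq_zero (𝒱 := 𝒱) v
  obtain ⟨K, hKu, hKv⟩ : ∃ K : ℕ, (∀ a ≥ K, dpow 𝒱.sl2.Lone a u = 0) ∧
      ∀ a ≥ K, dpow 𝒱.sl2.Lone a v = 0 :=
    ⟨max K₁ K₂, fun a ha => hK₁ a (le_trans (le_max_left _ _) ha),
      fun a ha => hK₂ a (le_trans (le_max_right _ _) ha)⟩
  choose f hf using fun a b : ℕ =>
    exists_mode_eq_zero 𝒱.Y (dpow 𝒱.sl2.Lone a u) (dpow 𝒱.sl2.Lone b v)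
  -- One truncation bound for the finitely many pairs `a, b < K`; for all other pairs one of the two
  -- vectors is zero.
  refine ⟨(Finset.range K ×ˢ Finset.range K).sup fun y => f y.1 y.2, fun N hN m n => ?_⟩
  have hN' : ∀ a b : ℕ, ∀ i : ℤ, (N : ℤ) ≤ i →
      mode 𝒱.Y (dpow 𝒱.sl2.Lone a u) i (dpow 𝒱.sl2.Lone b v) = 0 := by
    intro a b i hi
    by_cases ha : K ≤ a
    · rw [hKu a ha, mode_zero, LinearMap.zero_apply]
    by_cases hb : K ≤ b
    · rw [hKv b hb, map_zero]
    refine hf a b i (le_trans (Int.ofNat_le.2 (le_trans ?_ hN)) hi)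
    exact Finset.le_sup (f := fun y : ℕ × ℕ => f y.1 y.2) (Finset.mem_product.2
      ⟨Finset.mem_range.2 (not_le.1 ha), Finset.mem_range.2 (not_le.1 hb)⟩ : (a, b) ∈ _)
  -- The mode index in the expansion of the right side depends on `j` and `r` only through `i = j +
  -- r`, so `H` serves both sides.
  set H : ℕ → ℕ → ℕ → Module.End ℂ W := fun b a i =>
    mode Y (mode 𝒱.Y (dpow 𝒱.sl2.Lone a u) i (dpow 𝒱.sl2.Lone b v))
      (2 * p + 2 * q - 4 - m - n - a - b - i) with hH
  have hH0 : ∀ b a i, N ≤ i → H b a i = 0 := fun b a i hi => by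
    simp only [hH, hN' a b i (by omega), mode_zero]
  have hsign : ∀ k : ℤ, (-1 : ℂ) ^ (k - 1) = -(-1 : ℂ) ^ k := fun k => by
    rw [zpow_sub_one₀ (by norm_num)]; norm_num
  have lhs : ⁅serMinus 𝒱 Y u (tpow (-1) m), serMinus 𝒱 Y v (tpow (-1) n)⁆ =
      (-1 : ℂ) ^ (p + q) • ∑ b ∈ Finset.range K, ∑ a ∈ Finset.range K, ∑ i ∈ Finset.range N,
        ((Ring.choose (2 * p - a - 2 - m) i : ℤ) : ℂ) • H b a i := by
    rw [serMinus_tpow hu hKu, serMinus_tpow hv hKv, end_smul_lie, end_lie_smul, smul_smul,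
      ← zpow_add₀ (by norm_num), end_lie_sum]
    congr 1
    refine Finset.sum_congr rfl fun b _ => ?_
    rw [end_sum_lie]
    refine Finset.sum_congr rfl fun a _ => ?_
    rw [hJ.commutator _ _ N fun i hi => hN' a b i (by omega)]
    refine Finset.sum_congr rfl fun i _ => ?_
    simp only [hH]
    congr 2
    ring
  have rhs : ∀ j ∈ Finset.range N, ((Ring.choose m j : ℤ) : ℂ) •
      serMinus 𝒱 Y (mode 𝒱.Y u j v) (tpow (-1) (m + n - j)) =
      -((-1 : ℂ) ^ (p + q) • ∑ b ∈ Finset.range K, ∑ a ∈ Finset.range K, ∑ r ∈ Finset.range N,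
        ((-1 : ℂ) ^ j * ((Ring.choose m j : ℤ) : ℂ) *
          ((Ring.choose (2 * p - a - 2 - j) r : ℤ) : ℂ)) • H b a (j + r)) := by
    intro j _
    rw [serMinus_mode hu hv hKu hKv hN', hsign, neg_smul, smul_neg, zpow_sub₀ (by norm_num),
      smul_smul, show ((Ring.choose m j : ℤ) : ℂ) * ((-1 : ℂ) ^ (p + q) / (-1 : ℂ) ^ (j : ℤ)) =
        (-1 : ℂ) ^ (p + q) * ((-1 : ℂ) ^ j * ((Ring.choose m j : ℤ) : ℂ)) by
          rw [zpow_natCast, div_eq_mul_inv, ← inv_pow, show ((-1 : ℂ))⁻¹ = -1 by norm_num]; ring,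
      mul_smul, Finset.smul_sum (s := Finset.range K)]
    congr 2
    refine Finset.sum_congr rfl fun b _ => ?_
    rw [Finset.smul_sum]
    refine Finset.sum_congr rfl fun a _ => ?_
    rw [Finset.smul_sum]
    refine Finset.sum_congr rfl fun r _ => ?_
    rw [smul_smul, show 2 * p - (a : ℤ) - j - 2 = 2 * p - a - 2 - j by ring]
    simp only [hH]
    push_cast
    congr 2
    ring
  rw [lhs, Finset.sum_congr rfl rhs, Finset.sum_neg_distrib, neg_neg, ← Finset.smul_sum,
    Finset.sum_comm (s := Finset.range N)]
  congr 1
  refine Finset.sum_congr rfl fun b _ => ?_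
  rw [Finset.sum_comm (s := Finset.range N)]
  refine Finset.sum_congr rfl fun a _ => ?_
  rw [sum_choose_smul m (2 * p - a - 2) (H b a) (hH0 b a)]

theorem serMinus_commutator (hJ : JacobiIdentity 𝒱.Y Y) (u v : V) : ∃ N₀ : ℕ, ∀ N ≥ N₀,
    ∀ m n : ℤ, ⁅serMinus 𝒱 Y u (tpow (-1) m), serMinus 𝒱 Y v (tpow (-1) n)⁆ =
      -∑ i ∈ Finset.range N, ((Ring.choose m i : ℤ) : ℂ) •
        serMinus 𝒱 Y (mode 𝒱.Y u i v) (tpow (-1) (m + n - i)) := by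
  induction u using 𝒱.wt_induction with
  | h0 => exact ⟨0, fun N _ m n => by simp [Ring.lie_def, mode_zero]⟩
  | hadd u u' hu hu' =>
    obtain ⟨N₁, h₁⟩ := hu
    obtain ⟨N₂, h₂⟩ := hu'
    refine ⟨max N₁ N₂, fun N hN m n => ?_⟩
    rw [map_add, LinearMap.add_apply, end_add_lie, h₁ N (le_trans (le_max_left _ _) hN),
      h₂ N (le_trans (le_max_right _ _) hN), ← neg_add, ← Finset.sum_add_distrib]
    simp only [mode_add, LinearMap.add_apply, map_add, smul_add]
  | hwt p u hu =>
    induction v using 𝒱.wt_induction with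
    | h0 => exact ⟨0, fun N _ m n => by simp [Ring.lie_def]⟩
    | hadd v v' hv hv' =>
      obtain ⟨N₁, h₁⟩ := hv
      obtain ⟨N₂, h₂⟩ := hv'
      refine ⟨max N₁ N₂, fun N hN m n => ?_⟩
      rw [map_add, LinearMap.add_apply, end_lie_add, h₁ N (le_trans (le_max_left _ _) hN),
        h₂ N (le_trans (le_max_right _ _) hN), ← neg_add, ← Finset.sum_add_distrib]
      simp only [map_add, LinearMap.add_apply, smul_add]
    | hwt q v hv => exact serMinus_commutator_of_mem hJ hu hv

/-- The case `ε = -1`. Passing to opposite operators exchanges the roles of `L(1)` and `L(-1)`. -/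
theorem isSeriesAction_serMinus (hJ : JacobiIdentity 𝒱.Y Y) (hρ : Sl2Commutator Y 𝒱.sl2 ρ)
    (hD : DerivativeProperty Y 𝒱.sl2.Lneg) :
    IsSeriesAction 𝒱 (serMinus 𝒱 Y) (-1) ρ.Lone ρ.Lzero ρ.Lneg := by
  refine ⟨by norm_num, isSeriesMap_serMinus, fun u v => ?_, serMinus_deriv hD, fun v n => ?_,
    fun v n => ?_, fun v n => ?_⟩
  · simpa only [Int.cast_neg, Int.cast_one, neg_smul, one_smul] using serMinus_commutator hJ u v
  · rw [lie_one_serMinus hρ hD, Int.cast_neg, Int.cast_one, neg_smul, one_smul]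
  · rw [lie_zero_serMinus hρ hD, Int.cast_neg, Int.cast_one, neg_smul, one_smul]
  · rw [lie_neg_serMinus hρ hD, Int.cast_neg, Int.cast_one, neg_smul, one_smul]

end OppositeCommutator

/-! ### Commutators on the dual space -/

section Dual

variable {W₁ W₂ : Type*} [AddCommGroup W₁] [Module ℂ W₁] [AddCommGroup W₂] [Module ℂ W₂]

theorem dualLeft_mul (a b : Module.End ℂ W₁) :
    dualLeft W₁ W₂ (a * b) = dualLeft W₁ W₂ b * dualLeft W₁ W₂ a :=
  LinearMap.ext fun _ => TensorProduct.ext' fun _ _ => rfl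

theorem dualRight_mul (a b : Module.End ℂ W₂) :
    dualRight W₁ W₂ (a * b) = dualRight W₁ W₂ b * dualRight W₁ W₂ a :=
  LinearMap.ext fun _ => TensorProduct.ext' fun _ _ => rfl

theorem dualLeft_mul_dualRight (a : Module.End ℂ W₁) (c : Module.End ℂ W₂) :
    dualLeft W₁ W₂ a * dualRight W₁ W₂ c = dualRight W₁ W₂ c * dualLeft W₁ W₂ a :=
  LinearMap.ext fun _ => TensorProduct.ext' fun _ _ => rfl

/-- The operator `λ ↦ λ(a · ⊗ ·) - λ(· ⊗ c ·)`. -/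
def dualDiff (a : Module.End ℂ W₁) (c : Module.End ℂ W₂) : Module.End ℂ (TensorDual W₁ W₂) :=
  dualLeft W₁ W₂ a - dualRight W₁ W₂ c

/-- Transposition reverses products on both factors. On the second one the minus sign of `dualDiff`
undoes the reversal of the bracket, and the mixed terms cancel because operators on different tensor
factors commute. -/
theorem dualDiff_lie (a b : Module.End ℂ W₁) (c d : Module.End ℂ W₂) :
    ⁅dualDiff a c, dualDiff b d⁆ = dualDiff (-⁅a, b⁆) ⁅c, d⁆ := by
  simp only [dualDiff, Ring.lie_def, map_neg, map_sub, dualLeft_mul, dualRight_mul, mul_sub,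
    sub_mul, dualLeft_mul_dualRight]
  abel

theorem dualDiff_add (a b : Module.End ℂ W₁) (c d : Module.End ℂ W₂) :
    dualDiff (a + b) (c + d) = dualDiff a c + dualDiff b d := by
  simp only [dualDiff, map_add]; abel

theorem dualDiff_smul (x : ℂ) (a : Module.End ℂ W₁) (c : Module.End ℂ W₂) :
    dualDiff (x • a) (x • c) = x • dualDiff a c := by
  simp only [dualDiff, map_smul, smul_sub]

theorem dualDiff_neg (a : Module.End ℂ W₁) (c : Module.End ℂ W₂) :
    dualDiff (-a) (-c) = -dualDiff a c := by
  simp only [dualDiff, map_neg]; abel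

theorem dualDiff_sum {ι : Type*} (s : Finset ι) (a : ι → Module.End ℂ W₁)
    (c : ι → Module.End ℂ W₂) :
    dualDiff (∑ i ∈ s, a i) (∑ i ∈ s, c i) = ∑ i ∈ s, dualDiff (a i) (c i) := by
  simp only [dualDiff, map_sum, Finset.sum_sub_distrib]

end Dual

/-! ### Expansions -/

section Expansion

/-- Translation and expansion are ring homomorphisms, and their composite takes `t^k` to the
expanded power of `t - z`. -/
theorem Tplus_mul (z : ℂ) (k : ℤ) (g : ratAlg z) :
    Tplus z (ratElt z 0 k * g) = tsubPow 1 z k * Tplus z g := by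
  change iotaPlus (RatFunc.laurent (-z) (((RatFunc.C z + RatFunc.X) ^ (0 : ℤ) * RatFunc.X ^ k) *
    (g : RatFunc ℂ))) = _ * iotaPlus (RatFunc.laurent (-z) g)
  rw [zpow_zero, one_mul, map_mul, map_mul, map_zpow₀, map_zpow₀, RatFunc.laurent_X, map_add,
    map_neg, map_neg]
  congr 2
  rw [← RatFunc.algebraMap_X, ← RatFunc.algebraMap_C]
  simp [iotaPlus, evalSeries, sub_eq_add_neg]

theorem Tminus_mul (z : ℂ) (k : ℤ) (g : ratAlg z) :
    Tminus z (ratElt z 0 k * g) = tsubPow (-1) z k * Tminus z g := by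
  change iotaMinus (RatFunc.laurent (-z) (((RatFunc.C z + RatFunc.X) ^ (0 : ℤ) * RatFunc.X ^ k) *
    (g : RatFunc ℂ))) = _ * iotaMinus (RatFunc.laurent (-z) g)
  rw [zpow_zero, one_mul, map_mul, map_mul, map_zpow₀, map_zpow₀, RatFunc.laurent_X, map_add,
    map_neg, map_neg]
  congr 2
  rw [← RatFunc.algebraMap_X, ← RatFunc.algebraMap_C]
  simp [iotaMinus, evalSeries, sub_eq_add_neg]

theorem ratElt_zero_zero (z : ℂ) : ratElt z 0 0 = 1 := by
  ext; simp [ratElt]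

theorem ratElt_mul (z : ℂ) (k m n : ℤ) : ratElt z 0 k * ratElt z m n = ratElt z m (k + n) := by
  refine Subtype.ext ?_
  change (RatFunc.C z + RatFunc.X) ^ (0 : ℤ) * RatFunc.X ^ k *
    ((RatFunc.C z + RatFunc.X) ^ m * RatFunc.X ^ n) = (RatFunc.C z + RatFunc.X) ^ m *
      RatFunc.X ^ (k + n)
  rw [zpow_zero, one_mul, zpow_add₀ RatFunc.X_ne_zero]
  ring

theorem Tplus_ratElt (z : ℂ) (k : ℤ) : Tplus z (ratElt z 0 k) = tsubPow 1 z k := by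
  have h := Tplus_mul z k 1
  rwa [mul_one, show Tplus z 1 = 1 by
    change iotaPlus (RatFunc.laurent (-z) 1) = 1; rw [map_one, map_one], mul_one] at h

theorem Tminus_ratElt (z : ℂ) (k : ℤ) : Tminus z (ratElt z 0 k) = tsubPow (-1) z k := by
  have h := Tminus_mul z k 1
  rwa [mul_one, show Tminus z 1 = 1 by
    change iotaMinus (RatFunc.laurent (-z) 1) = 1; rw [map_one, map_one], mul_one] at h

end Expansion

/-! ### Commutators of the `Q(z)`-operators. -/

section CommutatorQ

variable {B : Type*} [AddCommGroup B] {A : AddSubgroup B}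
  {V W₁ W₂ : Type*} [AddCommGroup V] [Module ℂ V] [AddCommGroup W₁] [Module ℂ W₁]
  [AddCommGroup W₂] [Module ℂ W₂] {𝒱 : MobiusVertexAlgebra A V}

theorem tauQ_tmul (M₁ : GradedModule 𝒱.toGradedVertexAlgebra W₁)
    (M₂ : GradedModule 𝒱.toGradedVertexAlgebra W₂) (z : ℂ) (v : V) (g : ratAlg z) :
    tauQ 𝒱 M₁ M₂ z (v ⊗ₜ g) =
      dualDiff (serMinus 𝒱 M₁.Y v (Tminus z g)) (serPlus M₂.Y v (Tplus z g)) := rfl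

theorem modeQ_eq (M₁ : GradedModule 𝒱.toGradedVertexAlgebra W₁)
    (M₂ : GradedModule 𝒱.toGradedVertexAlgebra W₂) (z : ℂ) (v : V) (k : ℤ) :
    modeQ 𝒱 M₁ M₂ z v k =
      dualDiff (serMinus 𝒱 M₁.Y v (tsubPow (-1) z k)) (serPlus M₂.Y v (tsubPow 1 z k)) := by
  rw [modeQ, tauQ_tmul, Tminus_ratElt, Tplus_ratElt]

/-- In each of the three cases `L'(j)` is the `dualDiff` of the recentred `𝔰𝔩(2)` operators, with
`L(1)` and `L(-1)` exchanged on `W₁`. This is the form for which `zero_tsubPow` and `one_tsubPow`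
compute brackets. -/
theorem LQ_neg (ρ₁ : Sl2Rep W₁) (ρ₂ : Sl2Rep W₂) (z : ℂ) :
    LQ ρ₁ ρ₂ z (-1) = dualDiff ρ₁.Lone ρ₂.Lneg := by
  simp [LQ, dualDiff, Sl2Rep.L]

theorem LQ_zero (ρ₁ : Sl2Rep W₁) (ρ₂ : Sl2Rep W₂) (z : ℂ) :
    LQ ρ₁ ρ₂ z 0 = dualDiff (ρ₁.Lzero - z • ρ₁.Lone) (ρ₂.Lzero - z • ρ₂.Lneg) := by
  simp only [LQ, dualDiff, Sl2Rep.L, zero_add, Int.toNat_one, Finset.sum_range_succ,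
    Finset.sum_range_zero]
  simp [sub_eq_add_neg]
  module

theorem LQ_one (ρ₁ : Sl2Rep W₁) (ρ₂ : Sl2Rep W₂) (z : ℂ) :
    LQ ρ₁ ρ₂ z 1 = dualDiff (ρ₁.Lneg - (2 * z) • ρ₁.Lzero + z ^ 2 • ρ₁.Lone)
      (ρ₂.Lone - (2 * z) • ρ₂.Lzero + z ^ 2 • ρ₂.Lneg) := by
  have h : ((1 : ℤ) + 1).toNat = 2 := rfl
  simp only [LQ, dualDiff, Sl2Rep.L, h, Finset.sum_range_succ, Finset.sum_range_zero]
  simp [sub_eq_add_neg]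
  module

variable (M₁ : 𝒱.GenModule W₁) (M₂ : 𝒱.GenModule W₂) (z : ℂ)

theorem MobiusVertexAlgebra.GenModule.plus (M : 𝒱.GenModule W₂) :
    IsSeriesAction 𝒱 (serPlus M.Y) 1 M.sl2.Lneg M.sl2.Lzero M.sl2.Lone :=
  isSeriesAction_serPlus 𝒱 M.Y M.sl2 M.jacobi M.sl2_comm M.derivative

theorem MobiusVertexAlgebra.GenModule.minus (M : 𝒱.GenModule W₁) :
    IsSeriesAction 𝒱 (serMinus 𝒱 M.Y) (-1) M.sl2.Lone M.sl2.Lzero M.sl2.Lneg :=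
  isSeriesAction_serMinus M.jacobi M.sl2_comm M.derivative

/-- The commutator formula for `τ_{Q(z)}`. -/
theorem modeQ_lie_tauQ (u v : V) : ∃ N : ℕ, ∀ (k : ℤ) (g : ratAlg z),
    ⁅modeQ 𝒱 M₁.toGradedModule M₂.toGradedModule z u k,
      tauQ 𝒱 M₁.toGradedModule M₂.toGradedModule z (v ⊗ₜ g)⁆ =
      ∑ i ∈ Finset.range N, ((Ring.choose k i : ℤ) : ℂ) •
        tauQ 𝒱 M₁.toGradedModule M₂.toGradedModule z
          (mode 𝒱.Y u i v ⊗ₜ (ratElt z 0 (k - i) * g)) := by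
  obtain ⟨N₁, h₁⟩ := M₁.minus.comm_tsubPow z u v
  obtain ⟨N₂, h₂⟩ := M₂.plus.comm_tsubPow z u v
  refine ⟨max N₁ N₂, fun k g => ?_⟩
  -- The sign `ε = -1` of the opposite action cancels the one introduced by `dualDiff_lie`, so both
  -- components carry the same sum.
  rw [modeQ_eq, tauQ_tmul, dualDiff_lie, h₁ _ (le_max_left _ _), h₂ _ (le_max_right _ _),
    Int.cast_neg, Int.cast_one, neg_smul, one_smul, one_smul, neg_neg, dualDiff_sum]
  refine Finset.sum_congr rfl fun i _ => ?_
  rw [dualDiff_smul, tauQ_tmul, Tminus_mul, Tplus_mul]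

theorem modeQ_deriv (v : V) (k : ℤ) :
    modeQ 𝒱 M₁.toGradedModule M₂.toGradedModule z (𝒱.sl2.Lneg v) k =
      -(k : ℂ) • modeQ 𝒱 M₁.toGradedModule M₂.toGradedModule z v (k - 1) := by
  rw [modeQ_eq, modeQ_eq, M₁.minus.deriv_tsubPow, M₂.plus.deriv_tsubPow, dualDiff_smul]

theorem LQ_neg_lie_tauQ (v : V) (g : ratAlg z) : ⁅LQ M₁.sl2 M₂.sl2 z (-1),
    tauQ 𝒱 M₁.toGradedModule M₂.toGradedModule z (v ⊗ₜ g)⁆ =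
      tauQ 𝒱 M₁.toGradedModule M₂.toGradedModule z (𝒱.sl2.Lneg v ⊗ₜ g) := by
  rw [LQ_neg, tauQ_tmul, dualDiff_lie, M₁.minus.neg_series, M₂.plus.neg_series,
    Int.cast_neg, Int.cast_one, neg_smul, one_smul, one_smul, neg_neg, tauQ_tmul]

theorem LQ_zero_lie_tauQ (v : V) (g : ratAlg z) : ⁅LQ M₁.sl2 M₂.sl2 z 0,
    tauQ 𝒱 M₁.toGradedModule M₂.toGradedModule z (v ⊗ₜ g)⁆ =
      tauQ 𝒱 M₁.toGradedModule M₂.toGradedModule z (𝒱.sl2.Lzero v ⊗ₜ g) +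
      tauQ 𝒱 M₁.toGradedModule M₂.toGradedModule z (𝒱.sl2.Lneg v ⊗ₜ (ratElt z 0 1 * g)) := by
  rw [LQ_zero, tauQ_tmul, dualDiff_lie, M₁.minus.zero_tsubPow, M₂.plus.zero_tsubPow,
    Int.cast_neg, Int.cast_one, neg_smul, one_smul, one_smul, neg_neg, dualDiff_add, tauQ_tmul,
    tauQ_tmul, Tminus_mul, Tplus_mul]

theorem LQ_one_lie_tauQ (v : V) (g : ratAlg z) : ⁅LQ M₁.sl2 M₂.sl2 z 1,
    tauQ 𝒱 M₁.toGradedModule M₂.toGradedModule z (v ⊗ₜ g)⁆ =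
      tauQ 𝒱 M₁.toGradedModule M₂.toGradedModule z (𝒱.sl2.Lone v ⊗ₜ g) +
      (2 : ℂ) •
        tauQ 𝒱 M₁.toGradedModule M₂.toGradedModule z (𝒱.sl2.Lzero v ⊗ₜ (ratElt z 0 1 * g)) +
      tauQ 𝒱 M₁.toGradedModule M₂.toGradedModule z (𝒱.sl2.Lneg v ⊗ₜ (ratElt z 0 2 * g)) := by
  rw [LQ_one, tauQ_tmul, dualDiff_lie, M₁.minus.one_tsubPow, M₂.plus.one_tsubPow,
    Int.cast_neg, Int.cast_one, neg_smul, one_smul, one_smul, neg_neg, dualDiff_add, dualDiff_add,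
    dualDiff_smul, tauQ_tmul, tauQ_tmul, tauQ_tmul, Tminus_mul, Tplus_mul, Tminus_mul, Tplus_mul]

/-- With the next lemma, this says that `L'(-1)` and `L'(1)` shift the `L'(0)`-eigenvalue by `1` and
`-1`. -/
theorem LQ_zero_lie_neg (ρ₁ : Sl2Rep W₁) (ρ₂ : Sl2Rep W₂) :
    ⁅LQ ρ₁ ρ₂ z 0, LQ ρ₁ ρ₂ z (-1)⁆ = LQ ρ₁ ρ₂ z (-1) := by
  rw [LQ_zero, LQ_neg, dualDiff_lie, end_sub_lie, end_sub_lie, end_smul_lie, end_smul_lie,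
    ρ₁.lie_zero_one, ρ₂.lie_zero_neg]
  simp [Ring.lie_def]

theorem LQ_zero_lie_one (ρ₁ : Sl2Rep W₁) (ρ₂ : Sl2Rep W₂) :
    ⁅LQ ρ₁ ρ₂ z 0, LQ ρ₁ ρ₂ z 1⁆ = -LQ ρ₁ ρ₂ z 1 := by
  rw [LQ_zero, LQ_one, dualDiff_lie, ← dualDiff_neg]
  have h₁ : ⁅ρ₁.Lone, ρ₁.Lneg⁆ = (2 : ℂ) • ρ₁.Lzero := by
    rw [← end_lie_skew, ρ₁.lie_neg_one]; module
  have h₁' : ⁅ρ₁.Lone, ρ₁.Lzero⁆ = ρ₁.Lone := by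
    rw [← end_lie_skew, ρ₁.lie_zero_one, neg_neg]
  have h₂' : ⁅ρ₂.Lneg, ρ₂.Lzero⁆ = -ρ₂.Lneg := by
    rw [← end_lie_skew, ρ₂.lie_zero_neg]
  have s₁ : ∀ a : Module.End ℂ W₁, ⁅a, a⁆ = 0 := fun a => by rw [Ring.lie_def, sub_self]
  have s₂ : ∀ a : Module.End ℂ W₂, ⁅a, a⁆ = 0 := fun a => by rw [Ring.lie_def, sub_self]
  congr 1
  · simp only [end_sub_lie, end_lie_sub, end_lie_add, end_smul_lie, end_lie_smul,
      ρ₁.lie_zero_neg, ρ₁.lie_zero_one, h₁, h₁', s₁]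
    module
  · simp only [end_sub_lie, end_lie_sub, end_lie_add, end_smul_lie, end_lie_smul,
      ρ₂.lie_zero_neg, ρ₂.lie_zero_one, ρ₂.lie_neg_one, h₂', s₂]
    module

end CommutatorQ

/-! ### Stability of the compatibility condition -/

section Compatibility

variable {B : Type*} [AddCommGroup B] {A : AddSubgroup B}
  {V W₁ W₂ : Type*} [AddCommGroup V] [Module ℂ V] [AddCommGroup W₁] [Module ℂ W₁]
  [AddCommGroup W₂] [Module ℂ W₂] {𝒱 : MobiusVertexAlgebra A V}

/-- An operator whose commutators with the operators `τ_{Q(z)}(v ⊗ g)` are finite sums of operators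
`τ_{Q(z)}(x ⊗ t^e g)`, with `x` and `e` independent of `g`, preserves the compatibility
condition. -/
theorem compQ_stable (M₁ : GradedModule 𝒱.toGradedVertexAlgebra W₁)
    (M₂ : GradedModule 𝒱.toGradedVertexAlgebra W₂) (z : ℂ) (T : Module.End ℂ (TensorDual W₁ W₂))
    (hT : ∀ v : V, ∃ (N : ℕ) (x : ℕ → V) (e : ℕ → ℤ), ∀ g : ratAlg z,
      ⁅T, tauQ 𝒱 M₁ M₂ z (v ⊗ₜ g)⁆ =
        ∑ i ∈ Finset.range N, tauQ 𝒱 M₁ M₂ z (x i ⊗ₜ (ratElt z 0 (e i) * g)))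
    {lam : TensorDual W₁ W₂} (h : lam ∈ compQ 𝒱 M₁ M₂ z) : T lam ∈ compQ 𝒱 M₁ M₂ z := by
  obtain ⟨ha, hb⟩ := h
  -- The hypothesis at `g = (z+t)^m t^n`: multiplication by `t^{eᵢ}` leaves `m` alone and only
  -- shifts `n`.
  have key : ∀ v : V, ∃ (N : ℕ) (x : ℕ → V) (e : ℕ → ℤ), ∀ m n : ℤ,
      tauQ 𝒱 M₁ M₂ z (v ⊗ₜ ratElt z m n) (T lam) = T (tauQ 𝒱 M₁ M₂ z (v ⊗ₜ ratElt z m n) lam) -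
        ∑ i ∈ Finset.range N, tauQ 𝒱 M₁ M₂ z (x i ⊗ₜ ratElt z m (e i + n)) lam := by
    intro v
    obtain ⟨N, x, e, hx⟩ := hT v
    refine ⟨N, x, e, fun m n => ?_⟩
    have h1 := LinearMap.congr_fun (hx (ratElt z m n)) lam
    rw [Ring.lie_def, LinearMap.sub_apply, Module.End.mul_apply, Module.End.mul_apply,
      LinearMap.sum_apply] at h1
    simp only [ratElt_mul] at h1
    rw [← h1]
    abel
  -- Only finitely many vectors and shifts occur, so one bound serves them all.
  have bound : ∀ v : V, ∀ (N : ℕ) (x : ℕ → V) (e : ℕ → ℤ), ∃ M : ℤ, ∀ n ≥ M,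
      modeQ 𝒱 M₁ M₂ z v n lam = 0 ∧
        ∀ i ∈ Finset.range N, modeQ 𝒱 M₁ M₂ z (x i) (e i + n) lam = 0 := by
    intro v N x e
    have ev : ∀ u : V, ∀ᶠ n : ℤ in Filter.atTop, modeQ 𝒱 M₁ M₂ z u n lam = 0 := fun u =>
      Filter.eventually_atTop.2 (ha u)
    refine Filter.eventually_atTop.1 ((ev v).and ((Filter.eventually_all_finset _).2 fun i _ => ?_))
    exact (Filter.tendsto_atTop_add_const_left _ (e i) Filter.tendsto_id).eventually (ev (x i))
  refine ⟨fun v => ?_, fun v m n => ?_⟩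
  · obtain ⟨N, x, e, hx⟩ := key v
    obtain ⟨M, hM⟩ := bound v N x e
    refine ⟨M, fun n hn => ?_⟩
    rw [modeQ, hx]
    change T (modeQ 𝒱 M₁ M₂ z v n lam) -
      ∑ i ∈ Finset.range N, modeQ 𝒱 M₁ M₂ z (x i) (e i + n) lam = 0
    rw [(hM n hn).1, map_zero, Finset.sum_eq_zero (hM n hn).2, sub_zero]
  · obtain ⟨N, x, e, hx⟩ := key v
    obtain ⟨M, hM⟩ := bound v N x e
    set c : ℕ → ℂ := fun i => ((Ring.choose m i : ℤ) : ℂ) * z ^ (m - i) with hc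
    -- The common bound turns all the series in question into sums over one finite range, which
    -- commute with `T` and with the sum over `i`.
    have fin : ∀ f : ℕ → TensorDual W₁ W₂, (∀ i : ℕ, M ≤ n + i → f i = 0) →
        ∑ᶠ i : ℕ, c i • f i = ∑ i ∈ Finset.range (M - n).toNat, c i • f i := by
      intro f hf
      refine finsum_eq_sum_of_support_subset _ fun i hi => ?_
      by_contra h0
      refine hi ?_
      simp only [hf i (by simp at h0; omega), smul_zero]
    have hx' : ∀ k : ℤ, modeQ 𝒱 M₁ M₂ z v k (T lam) = T (modeQ 𝒱 M₁ M₂ z v k lam) -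
        ∑ i ∈ Finset.range N, modeQ 𝒱 M₁ M₂ z (x i) (e i + k) lam := fun k => hx 0 k
    have hv0 : ∀ i : ℕ, M ≤ n + i → modeQ 𝒱 M₁ M₂ z v (n + i) (T lam) = 0 := fun i hi => by
      rw [hx', (hM _ hi).1, map_zero, Finset.sum_eq_zero (hM _ hi).2, sub_zero]
    have s1 : tauQ 𝒱 M₁ M₂ z (v ⊗ₜ ratElt z m n) lam = ∑ i ∈ Finset.range (M - n).toNat,
        c i • modeQ 𝒱 M₁ M₂ z v (n + i) lam := by
      rw [hb]; exact fin _ fun i hi => (hM _ hi).1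
    have s2 : ∀ i ∈ Finset.range N, tauQ 𝒱 M₁ M₂ z (x i ⊗ₜ ratElt z m (e i + n)) lam =
        ∑ k ∈ Finset.range (M - n).toNat, c k • modeQ 𝒱 M₁ M₂ z (x i) (e i + (n + k)) lam := by
      intro i hi
      rw [hb, ← fin _ fun k hk => (hM _ hk).2 i hi]
      exact finsum_congr fun k => by rw [add_assoc]
    refine Eq.trans ?_ (fin _ hv0).symm
    rw [hx, s1, Finset.sum_congr rfl s2, Finset.sum_comm, map_sum, ← Finset.sum_sub_distrib]
    refine Finset.sum_congr rfl fun k _ => ?_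
    rw [hx', map_smul, ← Finset.smul_sum, smul_sub]

variable (M₁ : 𝒱.GenModule W₁) (M₂ : 𝒱.GenModule W₂) (z : ℂ)

theorem compQ_modeQ (u : V) (k : ℤ) {lam : TensorDual W₁ W₂}
    (h : lam ∈ compQ 𝒱 M₁.toGradedModule M₂.toGradedModule z) :
    modeQ 𝒱 M₁.toGradedModule M₂.toGradedModule z u k lam ∈
      compQ 𝒱 M₁.toGradedModule M₂.toGradedModule z := by
  refine compQ_stable _ _ z _ (fun v => ?_) h
  obtain ⟨N, hN⟩ := modeQ_lie_tauQ M₁ M₂ z u v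
  refine ⟨N, fun i => ((Ring.choose k i : ℤ) : ℂ) • mode 𝒱.Y u i v, fun i => k - i, fun g => ?_⟩
  rw [hN]
  refine Finset.sum_congr rfl fun i _ => ?_
  rw [← map_smul, TensorProduct.smul_tmul']

theorem compQ_LQ {j : ℤ} (hj : j ∈ ({-1, 0, 1} : Set ℤ)) {lam : TensorDual W₁ W₂}
    (h : lam ∈ compQ 𝒱 M₁.toGradedModule M₂.toGradedModule z) :
    LQ M₁.sl2 M₂.sl2 z j lam ∈ compQ 𝒱 M₁.toGradedModule M₂.toGradedModule z := by
  refine compQ_stable _ _ z _ (fun v => ?_) h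
  rcases hj with rfl | rfl | rfl
  · refine ⟨1, fun _ => 𝒱.sl2.Lneg v, fun _ => 0, fun g => ?_⟩
    rw [LQ_neg_lie_tauQ, Finset.sum_range_one, ratElt_zero_zero, one_mul]
  · refine ⟨2, fun i => if i = 0 then 𝒱.sl2.Lzero v else 𝒱.sl2.Lneg v, fun i => i, fun g => ?_⟩
    rw [LQ_zero_lie_tauQ, Finset.sum_range_succ, Finset.sum_range_one]
    simp [ratElt_zero_zero]
  · refine ⟨3, fun i => if i = 0 then 𝒱.sl2.Lone v else if i = 1 then (2 : ℂ) • 𝒱.sl2.Lzero v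
      else 𝒱.sl2.Lneg v, fun i => i, fun g => ?_⟩
    rw [LQ_one_lie_tauQ, Finset.sum_range_succ, Finset.sum_range_succ, Finset.sum_range_one,
      ← map_smul, TensorProduct.smul_tmul']
    simp [ratElt_zero_zero]

end Compatibility

/-! ### Stability of the local grading restriction conditions -/

section Grading

variable {D : Type*} [AddCommGroup D] [Module ℂ D]

/-- Every graded stable subspace containing `x` contains `T x`, so the subspace generated by `T x`
inherits finiteness and truncation. The hypothesis on the pieces is needed only for membership in
their sum. -/
theorem gradingRestricted_stable {B : Type*} {P : ℂ × B → Submodule ℂ D} (hP : iSupIndep P)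
    {S : Set (Module.End ℂ D)} {T : Module.End ℂ D} (hT : T ∈ S)
    (hTP : ∀ i, ∀ x ∈ P i, T x ∈ ⨆ j, P j) {x : D} (hx : x ∈ gradingRestricted P hP S) :
    T x ∈ gradingRestricted P hP S := by
  obtain ⟨h1, h2, h3⟩ := hx
  have hle : smallestStable P S (T x) ≤ smallestStable P S x :=
    sInf_le_sInf fun M hM => ⟨hM.1, hM.2.2 T hT x hM.2.1, hM.2.2⟩
  have hsup : (⨆ j, P j) ≤ (⨆ j, P j).comap T := iSup_le hTP
  refine ⟨hsup h1, fun n β => ?_, fun n β => ?_⟩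
  · have := h2 n β
    exact Submodule.finiteDimensional_of_le (inf_le_inf_right _ hle)
  · obtain ⟨K, hK⟩ := h3 n β
    refine ⟨K, fun k hk => le_bot_iff.1 ?_⟩
    rw [← hK k hk]
    exact inf_le_inf_right _ hle

/-- An operator `T` with `[L₀, T] = cT` shifts the eigenvalues of `L₀` by `c`. -/
theorem semiconjBy_of_lie {L₀ T : Module.End ℂ D} {c : ℂ} (h : ⁅L₀, T⁆ = c • T) (n : ℂ) :
    SemiconjBy T (L₀ - n • 1) (L₀ - (n + c) • 1) := by
  rw [Ring.lie_def, sub_eq_iff_eq_add] at h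
  rw [SemiconjBy, mul_sub, sub_mul, h, mul_smul_comm, mul_one, smul_mul_assoc, one_mul, add_smul]
  abel

/-- `T` intertwines the `k`-th powers of `L₀ - n` and `L₀ - (n + c)`. -/
theorem maxGenEigenspace_shift {L₀ T : Module.End ℂ D} {c : ℂ} (h : ⁅L₀, T⁆ = c • T) (n : ℂ)
    {x : D} (hx : x ∈ L₀.maxGenEigenspace n) : T x ∈ L₀.maxGenEigenspace (n + c) := by
  rw [Module.End.mem_maxGenEigenspace] at hx ⊢
  obtain ⟨k, hk⟩ := hx
  refine ⟨k, ?_⟩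
  have h1 := LinearMap.congr_fun ((semiconjBy_of_lie h n).pow_right k) x
  rw [Module.End.mul_apply, Module.End.mul_apply, hk, map_zero] at h1
  exact h1.symm

theorem eigenspace_shift {L₀ T : Module.End ℂ D} {c : ℂ} (h : ⁅L₀, T⁆ = c • T) (n : ℂ)
    {x : D} (hx : x ∈ L₀.eigenspace n) : T x ∈ L₀.eigenspace (n + c) := by
  rw [Module.End.mem_eigenspace_iff] at hx ⊢
  have h1 := LinearMap.congr_fun h x
  rw [Ring.lie_def, LinearMap.sub_apply, Module.End.mul_apply, Module.End.mul_apply, hx,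
    map_smul, LinearMap.smul_apply, sub_eq_iff_eq_add] at h1
  rw [h1]
  module

variable {B : Type*} [AddCommGroup B] {V W W₁ W₂ : Type*} [AddCommGroup V] [Module ℂ V]
  [AddCommGroup W] [Module ℂ W] [AddCommGroup W₁] [Module ℂ W₁] [AddCommGroup W₂] [Module ℂ W₂]

/-- On vectors of degree `γ` the new functional evaluates `λ` on vectors of degree `α + γ`. These
values vanish unless `α + γ = -β`, that is, `γ = -(α + β)`. -/
theorem dualDiff_mem_dualGr {gr₁ : B → Submodule ℂ W₁} {gr₂ : B → Submodule ℂ W₂} {α : B}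
    {a : Module.End ℂ W₁} {c : Module.End ℂ W₂} (ha : ∀ β, ∀ w ∈ gr₁ β, a w ∈ gr₁ (α + β))
    (hc : ∀ β, ∀ w ∈ gr₂ β, c w ∈ gr₂ (α + β)) {β : B} {lam : TensorDual W₁ W₂}
    (h : lam ∈ dualGr gr₁ gr₂ β) : dualDiff a c lam ∈ dualGr gr₁ gr₂ (α + β) := by
  intro γ hγ w hw
  have hne : α + γ ≠ -β := fun e => hγ (by rw [neg_add, ← e]; abel)
  induction hw using Submodule.span_induction with
  | zero => exact map_zero _
  | add x y _ _ hx hy => rw [map_add, hx, hy, add_zero]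
  | smul r x _ hx => rw [map_smul, hx, smul_zero]
  | mem x hx =>
    obtain ⟨β₁, β₂, rfl, w₁, hw₁, w₂, hw₂, rfl⟩ := hx
    rw [dualDiff, LinearMap.sub_apply, LinearMap.sub_apply, dualLeft_apply, dualRight_apply,
      h _ hne _ (Submodule.subset_span
        ⟨α + β₁, β₂, add_assoc _ _ _, _, ha _ _ hw₁, _, hw₂, rfl⟩),
      h _ hne _ (Submodule.subset_span
        ⟨β₁, α + β₂, add_left_comm _ _ _, _, hw₁, _, hc _ _ hw₂, rfl⟩), sub_zero]

variable {A : AddSubgroup B} {𝒱 : MobiusVertexAlgebra A V}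

theorem GradedModule.tauW_mem_gr (M : GradedModule 𝒱.toGradedVertexAlgebra W) {α : A} {v : V}
    (hv : v ∈ 𝒱.gr α) (f : LaurentSeries ℂ) (β : B) (w : W) (hw : w ∈ M.gr β) :
    tauW M.Y (v ⊗ₜ f) w ∈ M.gr (α + β) := by
  rw [tauW_tmul]
  exact finsum_induction (· ∈ M.gr (α + β)) (zero_mem _) (fun _ _ => add_mem)
    fun n => Submodule.smul_mem _ _ (M.mode_gr α β v w n hv hw)

theorem dpow_mem_gr {α : A} {v : V} (hv : v ∈ 𝒱.gr α) (a : ℕ) :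
    dpow 𝒱.sl2.Lone a v ∈ 𝒱.gr α := by
  refine Submodule.smul_mem _ _ ?_
  induction a with
  | zero => simpa using hv
  | succ a ih =>
    rw [pow_succ', Module.End.mul_apply]
    simpa [Sl2Rep.L] using 𝒱.L_gr 1 α _ ih

theorem GradedModule.serMinus_mem_gr (M : GradedModule 𝒱.toGradedVertexAlgebra W) {α : A} {v : V}
    {h : ℤ} (hv : v ∈ 𝒱.gr α ⊓ 𝒱.wt h) (f : LaurentSeries ℂ) (β : B) (w : W) (hw : w ∈ M.gr β) :
    serMinus 𝒱 M.Y v f w ∈ M.gr (α + β) := by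
  obtain ⟨K, hK⟩ := exists_dpow_eq_zero (𝒱 := 𝒱) v
  rw [serMinus_apply hv.2 hK, LinearMap.smul_apply, LinearMap.sum_apply]
  exact Submodule.smul_mem _ _ (sum_mem fun a _ => M.tauW_mem_gr (dpow_mem_gr hv.1 a) _ β w hw)

/-- Both degrees are needed at once: the weight determines the shift of the `L'(0)`-eigenvalue, the
`A`-degree that of the `B`-degree. -/
theorem MobiusVertexAlgebra.doublyHomogeneous_induction {p : V → Prop} (h0 : p 0)
    (hadd : ∀ u v, p u → p v → p (u + v)) (hgr : ∀ α n, ∀ v ∈ 𝒱.gr α ⊓ 𝒱.wt n, p v) (v : V) :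
    p v := by
  have hv : v ∈ ⨆ α, 𝒱.gr α := 𝒱.gr_span ▸ Submodule.mem_top
  induction hv using Submodule.iSup_induction' with
  | zero => exact h0
  | add x y _ _ hx hy => exact hadd x y hx hy
  | mem α x hx =>
    rw [𝒱.compatible α] at hx
    induction hx using Submodule.iSup_induction' with
    | zero => exact h0
    | add x y _ _ hx hy => exact hadd x y hx hy
    | mem h x hx => exact hgr α h x hx

variable (M₁ : 𝒱.GenModule W₁) (M₂ : 𝒱.GenModule W₂) (z : ℂ)

theorem modeQ_mem_dualGr {α : A} {v : V} {h : ℤ} (hv : v ∈ 𝒱.gr α ⊓ 𝒱.wt h) (m : ℤ) {β : B}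
    {lam : TensorDual W₁ W₂} (hl : lam ∈ dualGr M₁.gr M₂.gr β) :
    modeQ 𝒱 M₁.toGradedModule M₂.toGradedModule z v m lam ∈ dualGr M₁.gr M₂.gr (α + β) := by
  rw [modeQ_eq]
  exact dualDiff_mem_dualGr (M₁.serMinus_mem_gr hv _) (M₂.tauW_mem_gr hv.1 _) hl

theorem LQ_mem_dualGr (j : ℤ) {β : B} {lam : TensorDual W₁ W₂}
    (hl : lam ∈ dualGr M₁.gr M₂.gr β) : LQ M₁.sl2 M₂.sl2 z j lam ∈ dualGr M₁.gr M₂.gr β := by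
  have e : dualGr M₁.gr M₂.gr β = dualGr M₁.gr M₂.gr (0 + β) := by rw [zero_add]
  have hL : LQ M₁.sl2 M₂.sl2 z j = ∑ i ∈ Finset.range ((j + 1).toNat + 1),
      (((j + 1).toNat.choose i : ℂ) * (-z) ^ i) •
        dualDiff (M₁.sl2.L (i - j)) (M₂.sl2.L (j - i)) := by
    simp only [LQ, dualDiff, smul_sub, Finset.sum_sub_distrib]
  rw [hL, LinearMap.sum_apply]
  refine sum_mem fun i _ => Submodule.smul_mem _ _ ?_
  rw [e]
  exact dualDiff_mem_dualGr
    (fun β w hw => by rw [zero_add]; exact M₁.L_gr _ β w hw)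
    (fun β w hw => by rw [zero_add]; exact M₂.L_gr _ β w hw) hl

/-- `[L'(0), τ_{Q(z)}(v ⊗ t^m)] = (h - m - 1) τ_{Q(z)}(v ⊗ t^m)` for `v` of weight `h`. -/
theorem LQ_zero_lie_modeQ {v : V} {h : ℤ} (hv : v ∈ 𝒱.wt h) (m : ℤ) :
    ⁅LQ M₁.sl2 M₂.sl2 z 0, modeQ 𝒱 M₁.toGradedModule M₂.toGradedModule z v m⁆ =
      ((h : ℂ) - m - 1) • modeQ 𝒱 M₁.toGradedModule M₂.toGradedModule z v m := by
  -- The exponent `1 + m` is that of the term `L(-1)v ⊗ t · t^m` in the bracket, which thus becomes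
  -- a multiple of `τ(v ⊗ t^m)`.
  have hd := modeQ_deriv M₁ M₂ z v (1 + m)
  rw [modeQ, LQ_zero_lie_tauQ, ratElt_mul, 𝒱.L_zero h v hv, ← TensorProduct.smul_tmul', map_smul]
  rw [modeQ, modeQ, add_sub_cancel_left] at hd
  rw [hd]
  push_cast
  module

/-- The operators `τ_{Q(z)}(v ⊗ t^m)` and `L'(j)` preserve the sum of the doubly graded pieces, for
the (generalized) eigenspaces `E n` of `L'(0)`. -/
theorem operatorsQ_mem_iSup {L' : ℤ → Module.End ℂ (TensorDual W₁ W₂)}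
    (hL' : ∀ j ∈ ({-1, 0, 1} : Set ℤ), L' j = LQ M₁.sl2 M₂.sl2 z j)
    {E : ℂ → Submodule ℂ (TensorDual W₁ W₂)}
    (hE : ∀ (T : Module.End ℂ (TensorDual W₁ W₂)) (c : ℂ), ⁅L' 0, T⁆ = c • T →
      ∀ n, ∀ x ∈ E n, T x ∈ E (n + c))
    {T : Module.End ℂ (TensorDual W₁ W₂)}
    (hT : T ∈ operatorsQ 𝒱 M₁.toGradedModule M₂.toGradedModule z L') (i : ℂ × B)
    (x : TensorDual W₁ W₂) (hx : x ∈ dualGr M₁.gr M₂.gr i.2 ⊓ E i.1) :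
    T x ∈ ⨆ p : ℂ × B, dualGr M₁.gr M₂.gr p.2 ⊓ E p.1 := by
  have mem : ∀ (p : ℂ × B) (y : TensorDual W₁ W₂), y ∈ dualGr M₁.gr M₂.gr p.2 → y ∈ E p.1 →
      y ∈ ⨆ p : ℂ × B, dualGr M₁.gr M₂.gr p.2 ⊓ E p.1 := fun p y h1 h2 =>
    Submodule.mem_iSup_of_mem p ⟨h1, h2⟩
  have h0 := hL' 0 (by simp)
  rw [h0] at hE
  have key : ∀ j ∈ ({-1, 0, 1} : Set ℤ), ∀ c : ℂ,
      ⁅LQ M₁.sl2 M₂.sl2 z 0, LQ M₁.sl2 M₂.sl2 z j⁆ = c • LQ M₁.sl2 M₂.sl2 z j →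
      L' j x ∈ ⨆ p : ℂ × B, dualGr M₁.gr M₂.gr p.2 ⊓ E p.1 := by
    intro j hj c hc
    rw [hL' j hj]
    exact mem (i.1 + c, i.2) _ (LQ_mem_dualGr M₁ M₂ z j hx.1) (hE _ c hc _ _ hx.2)
  rcases hT with ⟨v, m, rfl⟩ | rfl | rfl | rfl
  · induction v using 𝒱.doublyHomogeneous_induction with
    | h0 =>
      rw [modeQ, TensorProduct.zero_tmul, map_zero, LinearMap.zero_apply]
      exact zero_mem _
    | hadd u v hu hv =>
      rw [modeQ, TensorProduct.add_tmul, map_add, LinearMap.add_apply]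
      exact add_mem hu hv
    | hgr α h v hv =>
      exact mem (i.1 + ((h : ℂ) - m - 1), α + i.2) _ (modeQ_mem_dualGr M₁ M₂ z hv m hx.1)
        (hE _ _ (LQ_zero_lie_modeQ M₁ M₂ z hv.2 m) _ _ hx.2)
  · exact key (-1) (by simp) 1 (by rw [LQ_zero_lie_neg, one_smul])
  · exact key 0 (by simp) 0 (by rw [Ring.lie_def, sub_self, zero_smul])
  · exact key 1 (by simp) (-1) (by rw [LQ_zero_lie_one]; module)

/-- The stability of the three subspaces, for operators `L'(j)` that agree with `L'_{Q(z)}(j)`. -/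
theorem isStableQ_of_eq_LQ {L' : ℤ → Module.End ℂ (TensorDual W₁ W₂)}
    (hL' : ∀ j ∈ ({-1, 0, 1} : Set ℤ), L' j = LQ M₁.sl2 M₂.sl2 z j) :
    IsStableQ 𝒱 M₁.toGradedModule M₂.toGradedModule z L'
      (compQ 𝒱 M₁.toGradedModule M₂.toGradedModule z) ∧
    IsStableQ 𝒱 M₁.toGradedModule M₂.toGradedModule z L'
      (lgrGen 𝒱 M₁.toGradedModule M₂.toGradedModule z L') ∧
    IsStableQ 𝒱 M₁.toGradedModule M₂.toGradedModule z L'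
      (lgrOrd 𝒱 M₁.toGradedModule M₂.toGradedModule z L') := by
  have hmode : ∀ v n, modeQ 𝒱 M₁.toGradedModule M₂.toGradedModule z v n ∈
      operatorsQ 𝒱 M₁.toGradedModule M₂.toGradedModule z L' := fun v n => Or.inl ⟨v, n, rfl⟩
  have hL : ∀ j ∈ ({-1, 0, 1} : Set ℤ), L' j ∈
      operatorsQ 𝒱 M₁.toGradedModule M₂.toGradedModule z L' := by
    rintro j (rfl | rfl | rfl)
    · exact Or.inr (Or.inl rfl)
    · exact Or.inr (Or.inr (Or.inl rfl))
    · exact Or.inr (Or.inr (Or.inr rfl))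
  have gen : ∀ T ∈ operatorsQ 𝒱 M₁.toGradedModule M₂.toGradedModule z L',
      ∀ lam ∈ lgrGen 𝒱 M₁.toGradedModule M₂.toGradedModule z L',
      T lam ∈ lgrGen 𝒱 M₁.toGradedModule M₂.toGradedModule z L' := fun T hT lam hl =>
    gradingRestricted_stable _ hT (operatorsQ_mem_iSup M₁ M₂ z hL'
      (fun T c h n x => maxGenEigenspace_shift h n) hT) hl
  have ord : ∀ T ∈ operatorsQ 𝒱 M₁.toGradedModule M₂.toGradedModule z L',
      ∀ lam ∈ lgrOrd 𝒱 M₁.toGradedModule M₂.toGradedModule z L',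
      T lam ∈ lgrOrd 𝒱 M₁.toGradedModule M₂.toGradedModule z L' := fun T hT lam hl =>
    gradingRestricted_stable _ hT (operatorsQ_mem_iSup M₁ M₂ z hL'
      (fun T c h n x => eigenspace_shift h n) hT) hl
  refine ⟨⟨fun v n lam hl => compQ_modeQ M₁ M₂ z v n hl, fun j hj lam hl => ?_⟩,
    ⟨fun v n => gen _ (hmode v n), fun j hj => gen _ (hL j hj)⟩,
    ⟨fun v n => ord _ (hmode v n), fun j hj => ord _ (hL j hj)⟩⟩
  rw [hL' j hj]
  exact compQ_LQ M₁ M₂ z hj hl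

end Grading

/-! ### The conformal case -/

section ConformalCase

variable {B : Type*} [AddCommGroup B] {A : AddSubgroup B}
  {V W W₁ W₂ : Type*} [AddCommGroup V] [Module ℂ V] [AddCommGroup W] [Module ℂ W]
  [AddCommGroup W₁] [Module ℂ W₁] [AddCommGroup W₂] [Module ℂ W₂]
  {𝒱 : ConformalVertexAlgebra A V}

/-- A generalized module for a conformal vertex algebra is a generalized module for the underlying
Möbius vertex algebra. -/
def ConformalVertexAlgebra.GenModule.toMobius (M : 𝒱.GenModule W) :
    𝒱.toMobius.GenModule W where
  toGradedModule := M.toGradedModule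
  sl2 := M.virasoro.sl2
  sl2_comm := M.jacobi.sl2_comm 𝒱.virasoro M.virasoro
  derivative := M.derivative
  L_zero := M.L_zero
  L_gr j β w hw := by
    have key : ∀ n, mode M.Y 𝒱.ω n w ∈ M.gr β := fun n => by
      simpa using M.mode_gr 0 β 𝒱.ω w n 𝒱.ω_mem.1 hw
    unfold Sl2Rep.L VirasoroRelations.sl2
    split_ifs <;> simp [key]

/-- Apply `[L(1), L(-2)] = 3L(-1)` to the vacuum: `L(-2)` produces `ω`, while `L(1)` and `L(-1)`
annihilate the vacuum. -/
theorem ConformalVertexAlgebra.L_one_omega : mode 𝒱.Y 𝒱.ω 2 𝒱.ω = 0 := by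
  have h := LinearMap.congr_fun (𝒱.virasoro 1 (-2)) 𝒱.vac
  norm_num at h
  rw [Ring.lie_def, LinearMap.sub_apply, Module.End.mul_apply, Module.End.mul_apply,
    𝒱.creation, 𝒱.creation_regular _ 2 (by norm_num), 𝒱.creation_regular _ 0 le_rfl,
    map_zero, smul_zero, sub_zero] at h
  exact h

theorem serPlus_tpow (Y : V →ₗ[ℂ] VertexOperator ℂ W) (v : V) (n : ℤ) :
    serPlus Y v (tpow 1 n) = mode Y v n := by
  rw [tpow, one_mul]; exact tauW_single Y v n

/-- As `L(1)ω = 0` and `ω` has weight `2`, its opposite vector is the single term `ω ⊗ t²`. -/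
theorem serMinus_omega (Y : V →ₗ[ℂ] VertexOperator ℂ W) (n : ℤ) :
    serMinus 𝒱.toMobius Y 𝒱.ω (tpow (-1) n) = mode Y 𝒱.ω (2 - n) := by
  have hK : ∀ a ≥ 1, dpow 𝒱.toMobius.sl2.Lone a 𝒱.ω = 0 := by
    intro a ha
    obtain ⟨b, rfl⟩ := Nat.exists_eq_add_of_le' ha
    rw [dpow_eq_zero_iff, pow_succ, Module.End.mul_apply,
      show 𝒱.toMobius.sl2.Lone 𝒱.ω = 0 from 𝒱.L_one_omega, map_zero]
  rw [serMinus_tpow (𝒱 := 𝒱.toMobius) (h := 2) 𝒱.ω_mem.2 hK, Finset.sum_range_one, dpow_zero,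
    Module.End.one_apply]
  norm_num

theorem tsubPow_zero (ε : ℤ) (z : ℂ) : tsubPow ε z 0 = tpow ε 0 := by
  simp [tsubPow, tpow]

theorem tsubPow_one (ε : ℤ) (z : ℂ) : tsubPow ε z 1 = tpow ε 1 - z • tpow ε 0 := by
  rw [tpow_one_eq ε z, ← HahnSeries.C_mul_eq_smul, show tpow ε 0 = 1 by simp [tpow], mul_one,
    add_sub_cancel_right]

theorem tsubPow_two (ε : ℤ) (z : ℂ) :
    tsubPow ε z 2 = tpow ε 2 - (2 * z) • tpow ε 1 + z ^ 2 • tpow ε 0 := by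
  rw [tpow_two_eq ε z, tpow_one_eq ε z, ← HahnSeries.C_mul_eq_smul, ← HahnSeries.C_mul_eq_smul,
    show tpow ε 0 = 1 by simp [tpow], mul_one]
  simp only [map_mul, map_pow, map_ofNat]
  ring

theorem LQConformal_apply (M₁ : 𝒱.GenModule W₁) (M₂ : 𝒱.GenModule W₂) (z : ℂ) (j : ℤ) :
    LQConformal 𝒱 M₁.toGradedModule M₂.toGradedModule z j =
      dualDiff (serMinus 𝒱.toMobius M₁.Y 𝒱.ω (tsubPow (-1) z (j + 1)))
        (serPlus M₂.Y 𝒱.ω (tsubPow 1 z (j + 1))) :=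
  modeQ_eq M₁.toMobius.toGradedModule M₂.toMobius.toGradedModule z 𝒱.ω (j + 1)

/-- Expanding `(t - z)^{j+1}` yields the binomial coefficients of `L'(j)`, and `ω ⊗ t^{i+1}` acts as
`L(-i)` on `W₁` and as `L(i)` on `W₂`. -/
theorem LQConformal_eq_LQ (M₁ : 𝒱.GenModule W₁) (M₂ : 𝒱.GenModule W₂) (z : ℂ) :
    ∀ j ∈ ({-1, 0, 1} : Set ℤ), LQConformal 𝒱 M₁.toGradedModule M₂.toGradedModule z j =
      LQ M₁.toMobius.sl2 M₂.toMobius.sl2 z j := by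
  rintro j (rfl | rfl | rfl)
  · rw [LQ_neg, LQConformal_apply, show (-1 : ℤ) + 1 = 0 from rfl, tsubPow_zero, tsubPow_zero,
      serMinus_omega, serPlus_tpow]
    rfl
  · rw [LQ_zero, LQConformal_apply, zero_add, tsubPow_one, tsubPow_one]
    simp only [map_sub, LinearMap.map_smul, serMinus_omega, serPlus_tpow]
    rfl
  · rw [LQ_one, LQConformal_apply, show (1 : ℤ) + 1 = 2 from rfl, tsubPow_two, tsubPow_two]
    simp only [map_sub, map_add, LinearMap.map_smul, serMinus_omega, serPlus_tpow]
    rfl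

end ConformalCase

end

end LogTensor

theorem mainTheorem8 {B : Type*} [AddCommGroup B] (A : AddSubgroup B)
    {V W₁ W₂ : Type*} [AddCommGroup V] [Module ℂ V] [AddCommGroup W₁] [Module ℂ W₁]
    [AddCommGroup W₂] [Module ℂ W₂] (z : ℂ) (hz : z ≠ 0) :
    (∀ (𝒱 : LogTensor.MobiusVertexAlgebra A V) (M₁ : 𝒱.GenModule W₁) (M₂ : 𝒱.GenModule W₂),
      let N₁ := M₁.toGradedModule
      let N₂ := M₂.toGradedModule
      let L' := LogTensor.LQ M₁.sl2 M₂.sl2 z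
      LogTensor.IsStableQ 𝒱 N₁ N₂ z L' (LogTensor.compQ 𝒱 N₁ N₂ z) ∧
      LogTensor.IsStableQ 𝒱 N₁ N₂ z L' (LogTensor.lgrGen 𝒱 N₁ N₂ z L') ∧
      LogTensor.IsStableQ 𝒱 N₁ N₂ z L' (LogTensor.lgrOrd 𝒱 N₁ N₂ z L')) ∧
    (∀ (𝒱 : LogTensor.ConformalVertexAlgebra A V) (M₁ : 𝒱.GenModule W₁) (M₂ : 𝒱.GenModule W₂),
      let N₁ := M₁.toGradedModule
      let N₂ := M₂.toGradedModule
      let L' := LogTensor.LQConformal 𝒱 N₁ N₂ z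
      LogTensor.IsStableQ 𝒱.toMobius N₁ N₂ z L' (LogTensor.compQ 𝒱.toMobius N₁ N₂ z) ∧
      LogTensor.IsStableQ 𝒱.toMobius N₁ N₂ z L' (LogTensor.lgrGen 𝒱.toMobius N₁ N₂ z L') ∧
      LogTensor.IsStableQ 𝒱.toMobius N₁ N₂ z L' (LogTensor.lgrOrd 𝒱.toMobius N₁ N₂ z L')) := by
  refine ⟨fun 𝒱 M₁ M₂ => LogTensor.isStableQ_of_eq_LQ M₁ M₂ z fun _ _ => rfl,
    fun 𝒱 M₁ M₂ => ?_⟩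
  -- The underlying Möbius modules have the same graded data, and agreement of the `L'(j)` for `j =
  -- -1, 0, 1` is all that is required.
  exact LogTensor.isStableQ_of_eq_LQ M₁.toMobius M₂.toMobius z
    (LogTensor.LQConformal_eq_LQ M₁ M₂ z)
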